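/- **Setting.** Let $\mathfrak X$ be a finite token alphabet, $d_y=|\mathfrak X|$, and $\mathfrak Z$ a finite set of concepts with prior $\mathbb P_{\mathcal Z}$. The nominal model is given by next-token probabilities $\mathbb P(x\mid S,z)$, $x\in\mathfrak X$, $S\in\mathfrak X^*$ (finite sequences, the empty one included), $z\in\mathfrak Z$. Put $\mathbb P(S\mid z)=\prod_i\mathbb P(x_i\mid x_1\cdots x_{i-1},z)$ for $S=x_1\cdots x_k$, $\mathbb P(S)=\sum_z\mathbb P_{\mathcal Z}(z)\mathbb P(S\mid z)$ and $\mathbb P(x\mid S)=\sum_z\mathbb P(x\mid S,z)\mathbb P(z\mid S)$ with the posterior $\mathbb P(z\mid S)$. A covariate is a string of $l$ tokens, a response is one token, an input–output pair is a covariate followed by a response, and $$\mathrm{KL}_{\rm pair}(z\|z')=\sum_{(c,r)}\mathbb P(c,r\mid z)\log\frac{\mathbb P(c,r\mid z)}{\mathbb P(c,r\mid z')}.$$ **Pretrained model.** The transformer has $D\ge1$ layers, token dimension $d\ge1$, query/key dimension $d_h\ge1$, feed-forward width $d_F\ge1$, $h\ge1$ heads and temperature $\tau\in(0,1]$. Tokens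 are embedded as vectors of $\mathbb R^d$ of norm at most $R$, where $R>0$. Layer $s$ maps $X\in\mathbb R^{L\times d}$ to $\Pi[\mathrm{ReLU}(YA_1)A_2+\gamma_2Y]$ with $Y=\Pi[\sum_{i\le h}\mathrm{softmax}(XW_i^Q(XW_i^K)^\top)XW_i^V+\gamma_1X]$. Here the softmax is row-wise, $\Pi$ projects each row onto the Euclidean unit ball, and the matrices and scalars depend on $s$. The output is $\mathbb P_\theta(\cdot\mid S)=\mathrm{softmax}(\mathbb 1^\top X^{(D)}A^{(D+1)}/(L\tau))\in\mathbb R^{d_y}$, $L=|S|$. The parameter set $\Theta$ consists of all $\theta$ with $\|(A^{(D+1)})^\top\|_{1,2}\le B_A$ (the Euclidean norm of the vector of $\ell_1$ norms of the rows of $A^{(D+1)}$), $|\gamma_1|,|\gamma_2|\le1$, and Frobenius norms of $A_1,A_2,W_i^Q,W_i^K,W_i^V$ at most $B_{A,1},B_{A,2},B_Q,B_K,B_V$ in every layer. All the bounds $B$ are at least $1$. The pretraining data are $N_{\rm p}\ge1$ i.i.d. trajectories $(x_1^n,\dots,x_{T_{\rm p}+1}^n)\sim\mathbb P$ with $T_{\rm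 p}\ge1$ (a concept is drawn from the prior for each trajectory), $S_t^n=(x_1^n,\dots,x_t^n)$, and $$\hat\theta\in\operatorname*{argmin}_{\theta\in\Theta}\;-\frac1{N_{\rm p}T_{\rm p}}\sum_{n\le N_{\rm p}}\sum_{t\le T_{\rm p}}\log\mathbb P_\theta(x^n_{t+1}\mid S^n_t).$$ Let $\mathbb P_{\mathcal D}$ be the law of $S_t$ for $t$ uniform on $\{1,\dots,T_{\rm p}\}$, and $\mathbb E_{S\sim\mathcal D}$ its expectation. Let $t_{\rm mix}$ be the mixing time of the chains $S_1,\dots,S_{T_{\rm p}}$, i.e. the least $k\ge0$ such that for all $z$, all $i\ge1$ with $i+k\le T_{\rm p}$ and all $s,s'\in\mathfrak X^i$ the laws of $S_{i+k}$ given $S_i=s$ and given $S_i=s'$ (under concept $z$) have total variation distance at most $1/4$. With $\bar B=\tau^{-1}RhB_AB_{A,1}B_{A,2}B_QB_KB_V$ and $\bar D=D^2d(d_F+d_h+d)+d\,d_y$ put $$\Delta_{\rm pre}(N_{\rm p},T_{\rm p},\delta)=\inf_{\theta\in\Theta}\sqrt{\mathbb E_{S\sim\mathcal D}\mathrm{KL}(\mathbb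 P(\cdot|S)\|\mathbb P_\theta(\cdot|S))}+\frac{t_{\rm mix}^{1/4}\log(1/\delta)}{(N_{\rm p}T_{\rm p})^{1/4}}+\frac{\sqrt{t_{\rm mix}}}{\sqrt{N_{\rm p}T_{\rm p}}}\Big(\bar D\log(1+N_{\rm p}T_{\rm p}\bar B)+\log\frac1\delta\Big).$$ **Assumptions.** Let $c_0,c_1>0$, $z_*\in\mathfrak Z$. 1. $\mathbb P(x\mid S,z)\ge c_0$ for all $x,S,z$. 2. Conditionally on each $z$, input–output pairs are independent: $\mathbb P((S,S')\mid z)=\mathbb P(S\mid z)\mathbb P(S'\mid z)$ for any two sequences $S,S'$ of input–output pairs. 3. $\mathbb P_{\mathcal Z}(z_*)\ge c_1$. 4. $\mathrm{KL}_{\rm pair}(z_*\|z)>2\log(1/c_0)$ for all $z\ne z_*$. 5. The random prompt $\mathtt{prompt}'=(S'_t,\tilde c_{t+1})$, $S_t'=(\tilde c_1,r_1',\dots,\tilde c_t,r_t')$, has $t\ge0$ examples; it is independent of the pretraining data; its covariates $\tilde c_1,\dots,\tilde c_{t+1}$ are i.i.d. with law $\mathbb P(\cdot\mid z_*)$; its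 labels $r'_i$ are arbitrary (possibly wrong, random and dependent on everything else in the prompt). 6. The prompt is covered by the pretraining distribution: for some $\kappa$, $\Pr(\mathtt{prompt}'=p)\le\kappa\,\mathbb P_{\mathcal D}(p)$ for every prompt $p$. **Proposition.** For all given $h_0,B_0,\tau_0>0,R_0>0$ there is a constant $C>0$, depending only on these, on $c_0,c_1$ and on $\mathfrak X,\mathfrak Z$, such that whenever $h\le h_0$, $B_A\le B_0$, $\tau\ge\tau_0$, $R\ge R_0$ and Assumptions 1–6 hold, then for every $\delta\in(0,1)$, with probability at least $1-\delta$ over the pretraining data, $$\mathbb E_{\mathtt{prompt}'}\Big[\mathrm{KL}\big(\mathbb P(\cdot\mid\tilde c_{t+1},z_*)\,\|\,\mathbb P_{\hat\theta}(\cdot\mid S_t',\tilde c_{t+1})\big)\Big]\le C\bigg(\kappa\,\Delta_{\rm pre}(N_{\rm p},T_{\rm p},\delta)+\exp\Big(-\frac{\sqrt t}{2(1+l)\log(1/c_0)}\Big(\min_{z\ne z_*}\mathrm{KL}_{\rm pair}(z_*\|z)+2\log c_0\Big)\Big)\bigg).$$ (If $\mathfrak Z=\{z_*\}$ the minimum is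 read as $0$; if $c_0=1$ the exponential is read as $1$.) -/

import Mathlib

open scoped BigOperators

noncomputable section

namespace ICL

/-! ### Divergences between distributions on discrete spaces -/

/-- Kullback-Leibler divergence `∑ p log (p / q)` on a finite space.
It is only ever applied to everywhere positive `q`. -/
def kl {α : Type*} [Fintype α] (p q : α → ℝ) : ℝ :=
  ∑ x, p x * Real.log (p x / q x)

/-- Total variation distance `sup_A |P(A) - Q(A)|` of two finitely supported mass functions
(for these, finite events `A` exhaust the supremum). -/
def tv {α : Type*} (p q : α → ℝ) : ℝ :=
  ⨆ A : Finset α, |∑ a ∈ A, p a - ∑ a ∈ A, q a|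

/-! ### The nominal language model

`𝔛` is the finite alphabet, `Z` the finite concept space, token sequences are `List 𝔛`.
The nominal model is the next-token kernel `P z S x = ℙ(x | S, z)` with a prior `π` on `Z`. -/

section Nominal

variable {𝔛 Z : Type*} [Fintype 𝔛] [Fintype Z]

/-- Probability that, under concept `z`, the sequence `S` is continued by exactly the tokens `w`
(autoregressively). -/
def contProb (P : Z → List 𝔛 → stdSimplex ℝ 𝔛) (z : Z) : List 𝔛 → List 𝔛 → ℝ
  | _, [] => 1
  | S, x :: w => P z S x * contProb P z (S ++ [x]) w

/-- `ℙ(S | z)`: probability that the first `|S|` tokens are `S`. -/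
def seqProb (P : Z → List 𝔛 → stdSimplex ℝ 𝔛) (z : Z) (S : List 𝔛) : ℝ :=
  contProb P z [] S

/-- `ℙ(S) = ∑_z π(z) ℙ(S | z)`. -/
def margProb (P : Z → List 𝔛 → stdSimplex ℝ 𝔛) (π : stdSimplex ℝ Z) (S : List 𝔛) : ℝ :=
  ∑ z, π z * seqProb P z S

/-- Posterior `ℙ(z | S)`. -/
def posterior (P : Z → List 𝔛 → stdSimplex ℝ 𝔛) (π : stdSimplex ℝ Z) (S : List 𝔛) (z : Z) : ℝ :=
  π z * seqProb P z S / margProb P π S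

/-- `ℙ(x | S) = ∑_z ℙ(x | S, z) ℙ(z | S)`. -/
def predictive (P : Z → List 𝔛 → stdSimplex ℝ 𝔛) (π : stdSimplex ℝ Z) (S : List 𝔛) (x : 𝔛) : ℝ :=
  ∑ z, posterior P π S z * P z S x

/-- One step transition probability `S → S'` of the Markov chain `S_{t+1} = (S_t, x_{t+1})`,
`x_{t+1} ∼ ℙ(· | S_t, z)`, iterated `k` times. -/
def stepProb (P : Z → List 𝔛 → stdSimplex ℝ 𝔛) (z : Z) : ℕ → List 𝔛 → List 𝔛 → ℝ
  | 0, S, S' => open Classical in if S' = S then 1 else 0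
  | k + 1, S, S' => ∑ x, P z S x * stepProb P z k (S ++ [x]) S'

/-- Mixing time `t_mix(ε)` of the pretraining chains `S_1, …, S_T`, where `S_i` has `i` tokens:
the least `k` such that for every concept `z`, every `i ≥ 1` with `i + k ≤ T` and any two possible
values `s`, `s'` of `S_i`, the conditional laws of `S_{i+k}` given `S_i = s` and given `S_i = s'`
are within `ε` in total variation. -/
def mixTimeOf (P : Z → List 𝔛 → stdSimplex ℝ 𝔛) (T : ℕ) (ε : ℝ) : ℕ :=
  sInf {k : ℕ | ∀ (z : Z) (i : ℕ), 1 ≤ i → i + k ≤ T → ∀ s s' : List 𝔛,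
    s.length = i → s'.length = i → tv (stepProb P z k s) (stepProb P z k s') ≤ ε}

/-- `t_mix = t_mix(1/4)`. -/
def mixTime (P : Z → List 𝔛 → stdSimplex ℝ 𝔛) (T : ℕ) : ℕ :=
  mixTimeOf P T (1 / 4)

/-! ### Pretraining data -/

/-- `N` trajectories of `T + 1` tokens each. -/
abbrev Dataset (𝔛 : Type*) (N T : ℕ) := Fin N → Fin (T + 1) → 𝔛

/-- Probability of a dataset: the trajectories are i.i.d., each with an own concept drawn
from the prior. -/
def datasetProb (P : Z → List 𝔛 → stdSimplex ℝ 𝔛) (π : stdSimplex ℝ Z) {N T : ℕ}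
    (ω : Dataset 𝔛 N T) : ℝ :=
  ∏ n, margProb P π (List.ofFn (ω n))

/-- Probability of an event about the dataset. -/
def dataProb (P : Z → List 𝔛 → stdSimplex ℝ 𝔛) (π : stdSimplex ℝ Z) {N T : ℕ}
    (E : Set (Dataset 𝔛 N T)) : ℝ :=
  open Classical in ∑ ω, if ω ∈ E then datasetProb P π ω else 0

/-- `ℙ_𝒟`: the law of `S_t` for `t` uniform on `{1, …, T}`. -/
def pretrainProb (P : Z → List 𝔛 → stdSimplex ℝ 𝔛) (π : stdSimplex ℝ Z) (T : ℕ)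
    (S : List 𝔛) : ℝ :=
  if 1 ≤ S.length ∧ S.length ≤ T then margProb P π S / T else 0

/-- `𝔼_{S ∼ 𝒟} [f(S)]`, the average over `t = 1, …, T` of `𝔼 [f(S_t)]`. -/
def pretrainExp (P : Z → List 𝔛 → stdSimplex ℝ 𝔛) (π : stdSimplex ℝ Z) (T : ℕ)
    (f : List 𝔛 → ℝ) : ℝ :=
  (∑ t ∈ Finset.Icc 1 T, ∑ s : Fin t → 𝔛, margProb P π (List.ofFn s) * f (List.ofFn s)) / T

end Nominal

/-! ### The transformer -/

/-- Size parameters of the transformer: depth `D`, token dimension `d`, query/key dimension `dh`,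
feed-forward width `dF`, number of heads `h`, temperature `τ`, bound `R` on the
token embeddings, and the bounds on the weights. -/
structure Arch where
  D : ℕ
  d : ℕ
  dh : ℕ
  dF : ℕ
  h : ℕ
  τ : ℝ
  R : ℝ
  BA : ℝ
  BA1 : ℝ
  BA2 : ℝ
  BQ : ℝ
  BK : ℝ
  BV : ℝ
  D_pos : 0 < D
  d_pos : 0 < d
  dh_pos : 0 < dh
  dF_pos : 0 < dF
  h_pos : 0 < h
  τ_pos : 0 < τ
  τ_le : τ ≤ 1
  R_pos : 0 < R
  one_le_BA : 1 ≤ BA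
  one_le_BA1 : 1 ≤ BA1
  one_le_BA2 : 1 ≤ BA2
  one_le_BQ : 1 ≤ BQ
  one_le_BK : 1 ≤ BK
  one_le_BV : 1 ≤ BV

/-- Parameters of one layer. -/
structure LayerParam (A : Arch) where
  γ1 : ℝ
  γ2 : ℝ
  WQ : Fin A.h → Matrix (Fin A.d) (Fin A.dh) ℝ
  WK : Fin A.h → Matrix (Fin A.d) (Fin A.dh) ℝ
  WV : Fin A.h → Matrix (Fin A.d) (Fin A.d) ℝ
  A1 : Matrix (Fin A.d) (Fin A.dF) ℝ
  A2 : Matrix (Fin A.dF) (Fin A.d) ℝ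

/-- Parameters of the whole network; `Aout` is the matrix of the last layer. -/
structure Param (A : Arch) (𝔛 : Type*) where
  layer : Fin A.D → LayerParam A
  Aout : Matrix (Fin A.d) 𝔛 ℝ

/-- Frobenius norm. -/
def frob {m n : Type*} [Fintype m] [Fintype n] (M : Matrix m n ℝ) : ℝ :=
  √(∑ i, ∑ j, M i j ^ 2)

/-- `‖Mᵀ‖_{1,2}`: the Euclidean norm of the vector of the `ℓ₁` norms of the rows of `M`. -/
def normT12 {m n : Type*} [Fintype m] [Fintype n] (M : Matrix m n ℝ) : ℝ :=
  √(∑ i, (∑ j, |M i j|) ^ 2)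

/-- The parameter set `Θ`. -/
def paramSet (A : Arch) (𝔛 : Type*) [Fintype 𝔛] : Set (Param A 𝔛) :=
  {θ | normT12 θ.Aout ≤ A.BA ∧ ∀ t,
    |(θ.layer t).γ1| ≤ 1 ∧ |(θ.layer t).γ2| ≤ 1 ∧
    frob (θ.layer t).A1 ≤ A.BA1 ∧ frob (θ.layer t).A2 ≤ A.BA2 ∧
    ∀ i, frob ((θ.layer t).WQ i) ≤ A.BQ ∧ frob ((θ.layer t).WK i) ≤ A.BK ∧
      frob ((θ.layer t).WV i) ≤ A.BV}

/-- Softmax of a vector. -/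
def softmax {ι : Type*} [Fintype ι] (v : ι → ℝ) (i : ι) : ℝ :=
  Real.exp (v i) / ∑ j, Real.exp (v j)

/-- `attn(Q, K, V) = softmax(Q Kᵀ) V` with the softmax taken row by row. -/
def attn {L k m : ℕ} (Q K : Matrix (Fin L) (Fin k) ℝ) (V : Matrix (Fin L) (Fin m) ℝ) :
    Matrix (Fin L) (Fin m) ℝ :=
  (Matrix.of fun i => softmax ((Q * K.transpose) i)) * V

/-- Multi-head attention. -/
def mha {A : Arch} (w : LayerParam A) {L : ℕ} (X : Matrix (Fin L) (Fin A.d) ℝ) :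
    Matrix (Fin L) (Fin A.d) ℝ :=
  ∑ i, attn (X * w.WQ i) (X * w.WK i) (X * w.WV i)

/-- Feed-forward module `ReLU(Y A₁) A₂`. -/
def ffn {A : Arch} (w : LayerParam A) {L : ℕ} (Y : Matrix (Fin L) (Fin A.d) ℝ) :
    Matrix (Fin L) (Fin A.d) ℝ :=
  ((Y * w.A1).map fun x => max x 0) * w.A2

/-- Layer normalization: every row is projected onto the Euclidean unit ball. -/
def layerNorm {L d : ℕ} (X : Matrix (Fin L) (Fin d) ℝ) : Matrix (Fin L) (Fin d) ℝ :=
  Matrix.of fun i j => X i j / max 1 √(∑ k, X i k ^ 2)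

/-- One layer of the transformer. -/
def layerMap {A : Arch} {L : ℕ} (X : Matrix (Fin L) (Fin A.d) ℝ) (w : LayerParam A) :
    Matrix (Fin L) (Fin A.d) ℝ :=
  let Y := layerNorm (mha w X + w.γ1 • X)
  layerNorm (ffn w Y + w.γ2 • Y)

/-- `ℙ_θ(· | S)`: the rows of the input are the embeddings of the tokens of `S`, the `D` layers
are applied in order, and the output is the softmax of `𝟙ᵀ X^{(D)} A^{(D+1)} / (L τ)`. -/
def transformer {A : Arch} {𝔛 : Type*} [Fintype 𝔛] (emb : 𝔛 → EuclideanSpace ℝ (Fin A.d))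
    (θ : Param A 𝔛) (S : List 𝔛) : 𝔛 → ℝ :=
  let X0 : Matrix (Fin S.length) (Fin A.d) ℝ := Matrix.of fun i j => emb (S.get i) j
  let XD := (List.ofFn θ.layer).foldl layerMap X0
  softmax fun x => (∑ i, (XD * θ.Aout) i x) / (S.length * A.τ)

/-- The cross-entropy loss of `θ` on a dataset. For `t = 1, …, T` the token following
`S_t^n = (x_1^n, …, x_t^n)` is predicted. -/
def loss {A : Arch} {𝔛 : Type*} [Fintype 𝔛] (emb : 𝔛 → EuclideanSpace ℝ (Fin A.d)) {N T : ℕ}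
    (ω : Dataset 𝔛 N T) (θ : Param A 𝔛) : ℝ :=
  -(1 / (N * T)) * ∑ n : Fin N, ∑ t : Fin T,
    Real.log (transformer emb θ ((List.ofFn (ω n)).take (t + 1)) (ω n t.succ))

/-- `θ` is a maximum likelihood estimate over `Θ`. -/
def IsMLE {A : Arch} {𝔛 : Type*} [Fintype 𝔛] (emb : 𝔛 → EuclideanSpace ℝ (Fin A.d)) {N T : ℕ}
    (ω : Dataset 𝔛 N T) (θ : Param A 𝔛) : Prop :=
  θ ∈ paramSet A 𝔛 ∧ ∀ θ' ∈ paramSet A 𝔛, loss emb ω θ ≤ loss emb ω θ'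

/-- `B̄ = τ⁻¹ R h B_A B_{A,1} B_{A,2} B_Q B_K B_V`. -/
def Bbar (A : Arch) : ℝ :=
  A.τ⁻¹ * A.R * A.h * A.BA * A.BA1 * A.BA2 * A.BQ * A.BK * A.BV

/-- `D̄ = D² d (d_F + d_h + d) + d d_y`, where `d_y` is the size of the alphabet. -/
def Dbar (A : Arch) (dy : ℕ) : ℝ :=
  (A.D : ℝ) ^ 2 * A.d * (A.dF + A.dh + A.d) + A.d * dy

/-- The pretraining error `Δ_pre(N, T, δ)`. -/
def pretrainErr {𝔛 Z : Type*} [Fintype 𝔛] [Fintype Z] (P : Z → List 𝔛 → stdSimplex ℝ 𝔛)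
    (π : stdSimplex ℝ Z) (A : Arch) (emb : 𝔛 → EuclideanSpace ℝ (Fin A.d)) (N T : ℕ)
    (δ : ℝ) : ℝ :=
  (⨅ θ : paramSet A 𝔛,
      √(pretrainExp P π T fun S => kl (predictive P π S) (transformer emb θ.1 S)))
    + (mixTime P T : ℝ) ^ (1 / 4 : ℝ) * Real.log (1 / δ) / ((N : ℝ) * T) ^ (1 / 4 : ℝ)
    + √(mixTime P T) / √((N : ℝ) * T) *
      (Dbar A (Fintype.card 𝔛) * Real.log (1 + N * T * Bbar A) + Real.log (1 / δ))

/-! ### In-context learning with wrong labels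

A covariate has `l` tokens, a response is one token. -/

section Prompts

variable {𝔛 Z : Type*} [Fintype 𝔛] [Fintype Z]

/-- The token sequence of an input-output pair. -/
def pairTokens {𝔛 : Type*} {l : ℕ} (p : (Fin l → 𝔛) × 𝔛) : List 𝔛 :=
  List.ofFn p.1 ++ [p.2]

/-- The token sequence of a sequence of input-output pairs. -/
def pairsTokens {𝔛 : Type*} {l : ℕ} (S : List ((Fin l → 𝔛) × 𝔛)) : List 𝔛 :=
  S.flatMap pairTokens

/-- Conditionally on any concept the input-output pairs are independent. -/
def PairsIndep (P : Z → List 𝔛 → stdSimplex ℝ 𝔛) (l : ℕ) : Prop :=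
  ∀ (z : Z) (S S' : List ((Fin l → 𝔛) × 𝔛)),
    seqProb P z (pairsTokens S ++ pairsTokens S') =
      seqProb P z (pairsTokens S) * seqProb P z (pairsTokens S')

/-- `KL_pair(ℙ(· | z) ‖ ℙ(· | z'))`: divergence between the laws of an input-output pair. -/
def klPair (P : Z → List 𝔛 → stdSimplex ℝ 𝔛) (l : ℕ) (z z' : Z) : ℝ :=
  kl (fun p : (Fin l → 𝔛) × 𝔛 => seqProb P z (pairTokens p))
    (fun p => seqProb P z' (pairTokens p))

/-- A prompt `(c̃_1, r_1, …, c̃_t, r_t, c̃_{t+1})`: the covariates and the labels. -/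
abbrev Prompt (𝔛 : Type*) (l t : ℕ) := (Fin (t + 1) → Fin l → 𝔛) × (Fin t → 𝔛)

/-- The query `c̃_{t+1}` of a prompt. -/
def queryTokens {𝔛 : Type*} {l t : ℕ} (p : Prompt 𝔛 l t) : List 𝔛 :=
  List.ofFn (p.1 (Fin.last t))

/-- The token sequence of a prompt. -/
def promptTokens {𝔛 : Type*} {l t : ℕ} (p : Prompt 𝔛 l t) : List 𝔛 :=
  pairsTokens (List.ofFn fun i : Fin t => (p.1 i.castSucc, p.2 i)) ++ queryTokens p

/-- `Q` is a law of prompts with perturbed labels for the concept `z`: the covariates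
are those of independent examples generated from `z`, while the labels may be replaced
arbitrarily (deterministically or at random, depending on the whole prompt). -/
def IsPerturbedPromptLaw (P : Z → List 𝔛 → stdSimplex ℝ 𝔛) (z : Z) {l t : ℕ}
    (Q : stdSimplex ℝ (Prompt 𝔛 l t)) : Prop :=
  ∀ c : Fin (t + 1) → Fin l → 𝔛, ∑ r : Fin t → 𝔛, Q (c, r) = ∏ i, seqProb P z (List.ofFn (c i))

end Prompts

end ICL

end

noncomputable section

set_option linter.unusedSectionVars false

namespace ICL

/-! ### The nominal model: sequence laws, predictive distribution, pretraining averages. -/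

section NominalLemmas

variable {𝔛 Z : Type*} [Fintype 𝔛] [Fintype Z]

/-! The output probabilities of every network in Θ are bounded below by a constant `m` depending on
`B₀`, `τ₀` and the alphabet (`le_transformer`), so the KL divergence is at most `1 / m` times an ℓ¹
distance (`kl_le_sum_abs_sub`). The triangle inequality through the Bayesian predictive distribution
then splits the error into a pretraining part and a posterior part.

Pretraining part. The states of the chain are prefixes, which never forget their first token, so the
mixing time is at least `T` (`le_mixTime`) and `√t_mix / √(N T) ≥ 1 / √N`. It therefore suffices to
count each trajectory as one observation; no concentration along a trajectory is needed. Jensen's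
inequality for the time average bounds the exponential moments of half log-likelihood ratios by
Hellinger and KL terms (`sum_margProb_exp_average_le`), and Markov's inequality with a union bound
over a finite net gives a maximum likelihood bound (`one_sub_le_dataProb_sum_abs_sub`). The net is a
grid of parameters. Its log-cardinality is at most a constant times the square of `W = D̄ log (1 + N
T B̄)` (`exists_numParams_mul_log_le`); this is affordable because the squared Hellinger distance is
of order `W² / N` and the ℓ¹ distance of order `W / √N`. Crude Lipschitz constants of the network
are thus enough. Coverage transfers the bound to prompts at the cost of a factor `κ`
(`sum_prompt_le_mul_pretrainExp`).

Posterior part. Under independence of pairs the likelihood of a prompt factors into label and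
covariate terms. Arbitrary labels shift a log-likelihood ratio by at most `log (1 / c₀)` per
example, while the covariates are genuinely sampled from `z_*` and contribute in the mean at least
`KL_pair - log (1 / c₀)` each (`klPair_le`). The margin `KL_pair - 2 log (1 / c₀)` is positive by
assumption, and a Chernoff bound with parameter of order `1 / √t` gives decay of the wrong posterior
mass (`sum_mul_posterior_le_exp_sqrt`). -/

theorem contProb_append (P : Z → List 𝔛 → stdSimplex ℝ 𝔛) (z : Z) (S u v : List 𝔛) :
    contProb P z S (u ++ v) = contProb P z S u * contProb P z (S ++ u) v := by
  induction u generalizing S with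
  | nil => simp [contProb]
  | cons x u ih => simp [contProb, ih, mul_assoc]

theorem seqProb_append (P : Z → List 𝔛 → stdSimplex ℝ 𝔛) (z : Z) (u v : List 𝔛) :
    seqProb P z (u ++ v) = seqProb P z u * contProb P z u v := by
  simp [seqProb, contProb_append]

theorem seqProb_nil (P : Z → List 𝔛 → stdSimplex ℝ 𝔛) (z : Z) : seqProb P z [] = 1 := rfl

theorem seqProb_append_singleton (P : Z → List 𝔛 → stdSimplex ℝ 𝔛) (z : Z) (S : List 𝔛) (x : 𝔛) :
    seqProb P z (S ++ [x]) = seqProb P z S * P z S x := by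
  simp [seqProb_append, contProb]

theorem seqProb_nonneg (P : Z → List 𝔛 → stdSimplex ℝ 𝔛) (z : Z) (S : List 𝔛) :
    0 ≤ seqProb P z S := by
  induction S using List.reverseRecOn with
  | nil => simp [seqProb_nil]
  | append_singleton S x ih =>
    rw [seqProb_append_singleton]
    exact mul_nonneg ih ((P z S).2.1 x)

theorem stdSimplex_apply_le_one (p : stdSimplex ℝ 𝔛) (x : 𝔛) : p x ≤ 1 :=
  (mem_Icc_of_mem_stdSimplex p.2 x).2

theorem seqProb_le_one (P : Z → List 𝔛 → stdSimplex ℝ 𝔛) (z : Z) (S : List 𝔛) :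
    seqProb P z S ≤ 1 := by
  induction S using List.reverseRecOn with
  | nil => simp [seqProb_nil]
  | append_singleton S x ih =>
    rw [seqProb_append_singleton]
    exact mul_le_one₀ ih ((P z S).2.1 x) (stdSimplex_apply_le_one _ x)

theorem pow_le_seqProb {P : Z → List 𝔛 → stdSimplex ℝ 𝔛} {c₀ : ℝ} (hc₀ : 0 < c₀)
    (hP : ∀ z S x, c₀ ≤ P z S x) (z : Z) (S : List 𝔛) : c₀ ^ S.length ≤ seqProb P z S := by
  induction S using List.reverseRecOn with
  | nil => simp [seqProb_nil]
  | append_singleton S x ih =>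
    rw [seqProb_append_singleton, List.length_append, List.length_singleton, pow_succ]
    exact mul_le_mul ih (hP z S x) hc₀.le (seqProb_nonneg P z S)

theorem seqProb_pos {P : Z → List 𝔛 → stdSimplex ℝ 𝔛} {c₀ : ℝ} (hc₀ : 0 < c₀)
    (hP : ∀ z S x, c₀ ≤ P z S x) (z : Z) (S : List 𝔛) : 0 < seqProb P z S :=
  (pow_pos hc₀ _).trans_le (pow_le_seqProb hc₀ hP z S)

theorem sum_seqProb_append_singleton (P : Z → List 𝔛 → stdSimplex ℝ 𝔛) (z : Z) (S : List 𝔛) :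
    ∑ x, seqProb P z (S ++ [x]) = seqProb P z S := by
  simp only [seqProb_append_singleton, ← Finset.mul_sum]
  rw [show ∑ x, P z S x = 1 from (P z S).2.2, mul_one]

theorem sum_ofFn_succ {M : Type*} [AddCommMonoid M] (n : ℕ) (F : List 𝔛 → M) :
    ∑ w : Fin (n + 1) → 𝔛, F (List.ofFn w) =
      ∑ s : Fin n → 𝔛, ∑ x, F (List.ofFn s ++ [x]) := by
  rw [← (Fin.snocEquiv fun _ : Fin (n + 1) => 𝔛).sum_comp, Fintype.sum_prod_type, Finset.sum_comm]
  refine Finset.sum_congr rfl fun s _ => Finset.sum_congr rfl fun x _ => ?_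
  rw [List.ofFn_succ']
  simp [Fin.snocEquiv]

theorem sum_seqProb_ofFn (P : Z → List 𝔛 → stdSimplex ℝ 𝔛) (z : Z) (n : ℕ) :
    ∑ w : Fin n → 𝔛, seqProb P z (List.ofFn w) = 1 := by
  induction n with
  | zero => simp [seqProb_nil]
  | succ n ih => rw [sum_ofFn_succ]; simp only [sum_seqProb_append_singleton, ih]

theorem margProb_nonneg (P : Z → List 𝔛 → stdSimplex ℝ 𝔛) (π : stdSimplex ℝ Z) (S : List 𝔛) :
    0 ≤ margProb P π S :=
  Finset.sum_nonneg fun z _ => mul_nonneg (π.2.1 z) (seqProb_nonneg P z S)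

theorem margProb_pos {P : Z → List 𝔛 → stdSimplex ℝ 𝔛} (π : stdSimplex ℝ Z) {c₀ : ℝ}
    (hc₀ : 0 < c₀) (hP : ∀ z S x, c₀ ≤ P z S x) (S : List 𝔛) : 0 < margProb P π S := by
  obtain ⟨z, -, hz⟩ : ∃ z ∈ Finset.univ, 0 < π z := by
    by_contra! h
    have h1 : ∑ z, π z = 1 := π.2.2
    have := Finset.sum_nonpos h
    linarith
  exact Finset.sum_pos' (fun z _ => mul_nonneg (π.2.1 z) (seqProb_nonneg P z S))
    ⟨z, Finset.mem_univ z, mul_pos hz (seqProb_pos hc₀ hP z S)⟩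

theorem sum_margProb_append_singleton (P : Z → List 𝔛 → stdSimplex ℝ 𝔛) (π : stdSimplex ℝ Z)
    (S : List 𝔛) : ∑ x, margProb P π (S ++ [x]) = margProb P π S := by
  unfold margProb
  rw [Finset.sum_comm]
  simp only [← Finset.mul_sum, sum_seqProb_append_singleton]

theorem sum_margProb_ofFn (P : Z → List 𝔛 → stdSimplex ℝ 𝔛) (π : stdSimplex ℝ Z) (n : ℕ) :
    ∑ w : Fin n → 𝔛, margProb P π (List.ofFn w) = 1 := by
  induction n with
  | zero =>
    have h1 : ∑ z, π z = 1 := π.2.2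
    simp [margProb, seqProb_nil, h1]
  | succ n ih => rw [sum_ofFn_succ]; simp only [sum_margProb_append_singleton, ih]

/-- Chain rule for the mixture over concepts: the posterior denominator cancels against the
marginal. Hence a pretraining trajectory is an autoregressive process with kernel `predictive`, and
the latent concept plays no further role in the analysis of maximum likelihood. -/
theorem margProb_mul_predictive {P : Z → List 𝔛 → stdSimplex ℝ 𝔛} (π : stdSimplex ℝ Z) {c₀ : ℝ}
    (hc₀ : 0 < c₀) (hP : ∀ z S x, c₀ ≤ P z S x) (S : List 𝔛) (x : 𝔛) :
    margProb P π S * predictive P π S x = margProb P π (S ++ [x]) := by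
  have h := (margProb_pos π hc₀ hP S).ne'
  simp only [predictive, posterior, Finset.mul_sum]
  rw [margProb.eq_1 P π (S ++ [x])]
  refine Finset.sum_congr rfl fun z _ => ?_
  rw [seqProb_append_singleton]
  field_simp

theorem predictive_pos {P : Z → List 𝔛 → stdSimplex ℝ 𝔛} (π : stdSimplex ℝ Z) {c₀ : ℝ}
    (hc₀ : 0 < c₀) (hP : ∀ z S x, c₀ ≤ P z S x) (S : List 𝔛) (x : 𝔛) :
    0 < predictive P π S x := by
  have h := margProb_mul_predictive π hc₀ hP S x
  have h1 := margProb_pos π hc₀ hP S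
  have h2 := margProb_pos π hc₀ hP (S ++ [x])
  rw [← h] at h2
  exact pos_of_mul_pos_right h2 h1.le

theorem sum_predictive {P : Z → List 𝔛 → stdSimplex ℝ 𝔛} (π : stdSimplex ℝ Z) {c₀ : ℝ}
    (hc₀ : 0 < c₀) (hP : ∀ z S x, c₀ ≤ P z S x) (S : List 𝔛) :
    ∑ x, predictive P π S x = 1 := by
  have h1 := margProb_pos π hc₀ hP S
  have h : margProb P π S * ∑ x, predictive P π S x = margProb P π S * 1 := by
    rw [Finset.mul_sum, mul_one]
    simp only [margProb_mul_predictive π hc₀ hP, sum_margProb_append_singleton]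
  exact mul_left_cancel₀ h1.ne' h

theorem posterior_nonneg (P : Z → List 𝔛 → stdSimplex ℝ 𝔛) (π : stdSimplex ℝ Z) (S : List 𝔛)
    (z : Z) : 0 ≤ posterior P π S z :=
  div_nonneg (mul_nonneg (π.2.1 z) (seqProb_nonneg P z S)) (margProb_nonneg P π S)

theorem sum_posterior {P : Z → List 𝔛 → stdSimplex ℝ 𝔛} (π : stdSimplex ℝ Z) {c₀ : ℝ}
    (hc₀ : 0 < c₀) (hP : ∀ z S x, c₀ ≤ P z S x) (S : List 𝔛) :
    ∑ z, posterior P π S z = 1 := by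
  simp only [posterior, ← Finset.sum_div]
  exact div_self (margProb_pos π hc₀ hP S).ne'

/-- Discarding the tokens after the first `k`. -/
theorem sum_margProb_take (P : Z → List 𝔛 → stdSimplex ℝ 𝔛) (π : stdSimplex ℝ Z) {k n : ℕ}
    (hkn : k ≤ n) (F : List 𝔛 → ℝ) :
    ∑ w : Fin n → 𝔛, margProb P π (List.ofFn w) * F ((List.ofFn w).take k) =
      ∑ s : Fin k → 𝔛, margProb P π (List.ofFn s) * F (List.ofFn s) := by
  induction n, hkn using Nat.le_induction with
  | base =>
    refine Finset.sum_congr rfl fun s _ => ?_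
    rw [List.take_of_length_le (by simp)]
  | succ n hkn ih =>
    rw [sum_ofFn_succ n fun L => margProb P π L * F (L.take k), ← ih]
    refine Finset.sum_congr rfl fun s _ => ?_
    rw [← sum_margProb_append_singleton, Finset.sum_mul]
    refine Finset.sum_congr rfl fun x _ => ?_
    rw [List.take_append_of_le_length (by simpa using hkn)]

/-- The law of the first `t + 2` tokens of a trajectory, split into prefix and next token. -/
theorem sum_margProb_next {P : Z → List 𝔛 → stdSimplex ℝ 𝔛} (π : stdSimplex ℝ Z) {c₀ : ℝ}
    (hc₀ : 0 < c₀) (hP : ∀ z S x, c₀ ≤ P z S x) {T : ℕ} (t : Fin T) (g : List 𝔛 → 𝔛 → ℝ) :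
    ∑ w : Fin (T + 1) → 𝔛, margProb P π (List.ofFn w) *
        g ((List.ofFn w).take (t + 1)) (w t.succ) =
      ∑ s : Fin (t + 1) → 𝔛, margProb P π (List.ofFn s) *
        ∑ x, predictive P π (List.ofFn s) x * g (List.ofFn s) x := by
  classical
  -- Encoding prefix and next token as a function of one list makes `sum_margProb_take` applicable;
  -- the value at the empty list is never used.
  let F : List 𝔛 → ℝ := fun L => (L.getLast?).elim 0 fun x => g L.dropLast x
  have hFx : ∀ L x, F (L ++ [x]) = g L x := fun L x => by simp [F]
  have hF : ∀ w : Fin (T + 1) → 𝔛,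
      g ((List.ofFn w).take (t + 1)) (w t.succ) = F ((List.ofFn w).take (t + 2)) := by
    intro w
    have h : (List.ofFn w).take (t + 2) = (List.ofFn w).take (t + 1) ++ [w t.succ] := by
      rw [List.take_succ_eq_append_getElem (by simp)]
      simp only [List.getElem_ofFn]
      congr
    rw [h, hFx]
  simp only [hF]
  rw [sum_margProb_take P π (by omega) F, sum_ofFn_succ (t + 1) fun L => margProb P π L * F L]
  refine Finset.sum_congr rfl fun s _ => ?_
  rw [Finset.mul_sum]
  refine Finset.sum_congr rfl fun x _ => ?_
  rw [← mul_assoc, margProb_mul_predictive π hc₀ hP, hFx]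

theorem pretrainExp_eq (P : Z → List 𝔛 → stdSimplex ℝ 𝔛) (π : stdSimplex ℝ Z) (T : ℕ)
    (f : List 𝔛 → ℝ) : pretrainExp P π T f =
      (∑ t : Fin T, ∑ s : Fin (t + 1) → 𝔛, margProb P π (List.ofFn s) * f (List.ofFn s)) / T := by
  rw [pretrainExp, Fin.sum_univ_eq_sum_range
    (fun t => ∑ s : Fin (t + 1) → 𝔛, margProb P π (List.ofFn s) * f (List.ofFn s)) T,
    Finset.range_eq_Ico,
    Finset.sum_Ico_add' (fun t => ∑ s : Fin t → 𝔛, margProb P π (List.ofFn s) * f (List.ofFn s))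
      0 T 1]
  rfl

theorem pretrainExp_mono (P : Z → List 𝔛 → stdSimplex ℝ 𝔛) (π : stdSimplex ℝ Z) (T : ℕ)
    {f g : List 𝔛 → ℝ} (hfg : ∀ S, S ≠ [] → f S ≤ g S) :
    pretrainExp P π T f ≤ pretrainExp P π T g := by
  rw [pretrainExp_eq, pretrainExp_eq]
  refine div_le_div_of_nonneg_right (Finset.sum_le_sum fun t _ => Finset.sum_le_sum fun s _ => ?_)
    (Nat.cast_nonneg T)
  exact mul_le_mul_of_nonneg_left (hfg _ (by simp)) (margProb_nonneg P π _)

theorem pretrainExp_const (P : Z → List 𝔛 → stdSimplex ℝ 𝔛) (π : stdSimplex ℝ Z) {T : ℕ}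
    (hT : 0 < T) (a : ℝ) : pretrainExp P π T (fun _ => a) = a := by
  rw [pretrainExp_eq]
  simp only [← Finset.sum_mul, sum_margProb_ofFn]
  have : (T : ℝ) ≠ 0 := by positivity
  simp
  field_simp

theorem pretrainExp_add (P : Z → List 𝔛 → stdSimplex ℝ 𝔛) (π : stdSimplex ℝ Z) (T : ℕ)
    (f g : List 𝔛 → ℝ) : pretrainExp P π T (fun S => f S + g S) =
      pretrainExp P π T f + pretrainExp P π T g := by
  simp only [pretrainExp, mul_add, Finset.sum_add_distrib, add_div]

theorem pretrainExp_const_mul (P : Z → List 𝔛 → stdSimplex ℝ 𝔛) (π : stdSimplex ℝ Z) (T : ℕ)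
    (a : ℝ) (f : List 𝔛 → ℝ) : pretrainExp P π T (fun S => a * f S) =
      a * pretrainExp P π T f := by
  simp only [pretrainExp, mul_left_comm _ a, ← Finset.mul_sum, mul_div_assoc]

theorem pretrainExp_nonneg (P : Z → List 𝔛 → stdSimplex ℝ 𝔛) (π : stdSimplex ℝ Z) (T : ℕ)
    {f : List 𝔛 → ℝ} (hf : ∀ S, S ≠ [] → 0 ≤ f S) : 0 ≤ pretrainExp P π T f := by
  simpa [pretrainExp] using pretrainExp_mono P π T (f := fun _ => 0) hf

/-- The expected average of `g(S_t, x_{t+1})` along a trajectory. -/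
theorem sum_margProb_average {P : Z → List 𝔛 → stdSimplex ℝ 𝔛} (π : stdSimplex ℝ Z) {c₀ : ℝ}
    (hc₀ : 0 < c₀) (hP : ∀ z S x, c₀ ≤ P z S x) (T : ℕ) (g : List 𝔛 → 𝔛 → ℝ) :
    ∑ w : Fin (T + 1) → 𝔛, margProb P π (List.ofFn w) *
        ((∑ t : Fin T, g ((List.ofFn w).take (t + 1)) (w t.succ)) / T) =
      pretrainExp P π T fun S => ∑ x, predictive P π S x * g S x := by
  rw [pretrainExp_eq]
  simp only [← mul_div_assoc, Finset.mul_sum, ← Finset.sum_div]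
  rw [Finset.sum_comm]
  congr 1
  refine Finset.sum_congr rfl fun t _ => ?_
  rw [sum_margProb_next π hc₀ hP]
  simp only [Finset.mul_sum]

/-! ### The mixing time -/

theorem sum_contProb_ofFn (P : Z → List 𝔛 → stdSimplex ℝ 𝔛) (z : Z) (S : List 𝔛) (n : ℕ) :
    ∑ w : Fin n → 𝔛, contProb P z S (List.ofFn w) = 1 := by
  induction n with
  | zero => simp [contProb]
  | succ n ih =>
    rw [sum_ofFn_succ, ← ih]
    refine Finset.sum_congr rfl fun s _ => ?_
    simp only [contProb_append, contProb, mul_one, ← Finset.mul_sum]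
    rw [show ∑ x, P z (S ++ List.ofFn s) x = 1 from (P z _).2.2, mul_one]

/-- The chain only appends tokens, so it reaches nothing but extensions of its starting state. -/
theorem stepProb_eq_zero (P : Z → List 𝔛 → stdSimplex ℝ 𝔛) (z : Z) (k : ℕ) {S S' : List 𝔛}
    (h : ¬ S <+: S') : stepProb P z k S S' = 0 := by
  induction k generalizing S with
  | zero =>
    simp only [stepProb]
    rw [if_neg]
    rintro rfl
    exact h List.prefix_rfl
  | succ k ih =>
    simp only [stepProb]
    refine Finset.sum_eq_zero fun x _ => ?_
    rw [ih fun h' => h ((List.prefix_append S [x]).trans h'), mul_zero]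

theorem stepProb_append (P : Z → List 𝔛 → stdSimplex ℝ 𝔛) (z : Z) (S w : List 𝔛) :
    stepProb P z w.length S (S ++ w) = contProb P z S w := by
  induction w generalizing S with
  | nil => simp [stepProb, contProb]
  | cons x w ih =>
    simp only [List.length_cons, stepProb, contProb]
    rw [Finset.sum_eq_single x]
    · rw [← ih, List.append_assoc, List.singleton_append]
    · intro y _ hy
      rw [stepProb_eq_zero, mul_zero]
      intro h
      have := (List.prefix_append_right_inj S).1 h
      simp at this
      exact hy this
    · simp

/-- Two different first tokens are never forgotten by the chain of prefixes, so that it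
does not mix before the horizon. -/
theorem le_mixTime (P : Z → List 𝔛 → stdSimplex ℝ 𝔛) (z : Z) (T : ℕ) [Nontrivial 𝔛] :
    T ≤ mixTime P T := by
  classical
  obtain ⟨a, b, hab⟩ := exists_pair_ne 𝔛
  -- `T` satisfies the defining condition vacuously, since `i ≥ 1` and `i + T ≤ T` are incompatible.
  -- Without such a witness the infimum in ℕ could be the default value `0`.
  refine le_csInf ⟨T, fun z i hi hiT => by omega⟩ fun k hk => ?_
  by_contra! hkT
  have h := hk z 1 le_rfl (by omega) [a] [b] rfl rfl
  -- The event that the first token is `a` has probability one from `[a]` and zero from `[b]`, so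
  -- the total variation distance is 1.
  let A : Finset (List 𝔛) := Finset.univ.image fun w : Fin k → 𝔛 => [a] ++ List.ofFn w
  have hinj : Function.Injective fun w : Fin k → 𝔛 => [a] ++ List.ofFn w := fun v w hvw =>
    List.ofFn_injective (List.append_cancel_left hvw)
  have hsum : ∀ S : List 𝔛, ∑ L ∈ A, stepProb P z k S L =
      ∑ w : Fin k → 𝔛, stepProb P z k S ([a] ++ List.ofFn w) := fun S =>
    Finset.sum_image fun v _ w _ hvw => hinj hvw
  have ha : ∑ L ∈ A, stepProb P z k [a] L = 1 := by
    rw [hsum, ← sum_contProb_ofFn P z [a] k]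
    refine Finset.sum_congr rfl fun w _ => ?_
    have := stepProb_append P z [a] (List.ofFn w)
    rwa [List.length_ofFn] at this
  have hb : ∑ L ∈ A, stepProb P z k [b] L = 0 := by
    rw [hsum]
    refine Finset.sum_eq_zero fun w _ => stepProb_eq_zero P z k fun h => hab ?_
    simpa using ((List.cons_prefix_cons.1 h).1).symm
  have hnn : ∀ (k : ℕ) (S L : List 𝔛), 0 ≤ stepProb P z k S L := by
    intro k
    induction k with
    | zero => intro S L; simp only [stepProb]; split_ifs <;> norm_num
    | succ k ih => exact fun S L => Finset.sum_nonneg fun x _ => mul_nonneg ((P z S).2.1 x) (ih _ _)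
  have hle : ∀ (k : ℕ) (S : List 𝔛) (B : Finset (List 𝔛)), ∑ L ∈ B, stepProb P z k S L ≤ 1 := by
    intro k
    induction k with
    | zero =>
      intro S B
      simp only [stepProb, Finset.sum_ite_eq']
      split_ifs <;> norm_num
    | succ k ih =>
      intro S B
      simp only [stepProb]
      rw [Finset.sum_comm]
      simp only [← Finset.mul_sum]
      calc _ ≤ ∑ x, P z S x * 1 := Finset.sum_le_sum fun x _ =>
            mul_le_mul_of_nonneg_left (ih _ B) ((P z S).2.1 x)
        _ = 1 := by simp only [mul_one]; exact (P z S).2.2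
  -- An unbounded real supremum would be `0` by convention, so boundedness is needed before the
  -- supremum can be compared with its value at `A`.
  have hbdd : BddAbove (Set.range fun B : Finset (List 𝔛) =>
      |∑ L ∈ B, stepProb P z k [a] L - ∑ L ∈ B, stepProb P z k [b] L|) := by
    refine ⟨1, ?_⟩
    rintro _ ⟨B, rfl⟩
    have h1 := hle k [a] B
    have h2 := hle k [b] B
    have h3 := Finset.sum_nonneg fun L (_ : L ∈ B) => hnn k [a] L
    have h4 := Finset.sum_nonneg fun L (_ : L ∈ B) => hnn k [b] L
    exact abs_le.2 ⟨by linarith, by linarith⟩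
  have h5 := (le_ciSup hbdd A).trans h
  rw [ha, hb] at h5
  norm_num at h5

end NominalLemmas

/-! ### Maximum likelihood estimation from independent trajectories -/

section Divergences

variable {𝔛 : Type*} [Fintype 𝔛]

/-- Squared Hellinger distance. -/
def hellingerSq (p q : 𝔛 → ℝ) : ℝ := ∑ x, (√(p x) - √(q x)) ^ 2

theorem hellingerSq_eq {p q : 𝔛 → ℝ} (hp : ∀ x, 0 < p x) (hq : ∀ x, 0 < q x)
    (hp1 : ∑ x, p x = 1) (hq1 : ∑ x, q x = 1) :
    hellingerSq p q = 2 - 2 * ∑ x, √(p x) * √(q x) := by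
  have h : ∀ x, (√(p x) - √(q x)) ^ 2 = p x + q x - 2 * (√(p x) * √(q x)) := fun x => by
    rw [sub_sq, Real.sq_sqrt (hp x).le, Real.sq_sqrt (hq x).le]; ring
  simp only [hellingerSq, h, Finset.sum_sub_distrib, Finset.sum_add_distrib, hp1, hq1,
    ← Finset.mul_sum]
  ring

theorem mul_sqrt_div_self {a b : ℝ} (ha : 0 < a) (hb : 0 < b) : a * √(b / a) = √a * √b := by
  rw [Real.sqrt_div hb.le]
  have := Real.sq_sqrt ha.le
  have h2 : √a ≠ 0 := (Real.sqrt_pos.2 ha).ne'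
  field_simp
  nlinarith

/-- Halving the log-ratio makes its exponential moment the Bhattacharyya coefficient `∑ √p √q`. This
is finite without any bound on the ratio, which is why Hellinger distance is the natural measure for
the net. -/
theorem sum_mul_exp_half_log {p q : 𝔛 → ℝ} (hp : ∀ x, 0 < p x) (hq : ∀ x, 0 < q x)
    (hp1 : ∑ x, p x = 1) (hq1 : ∑ x, q x = 1) :
    ∑ x, p x * Real.exp ((Real.log (q x) - Real.log (p x)) / 2) = 1 - hellingerSq p q / 2 := by
  rw [hellingerSq_eq hp hq hp1 hq1]
  have h : ∀ x, p x * Real.exp ((Real.log (q x) - Real.log (p x)) / 2) = √(p x) * √(q x) :=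
    fun x => by
      rw [← Real.log_div (hq x).ne' (hp x).ne', Real.exp_half,
        Real.exp_log (div_pos (hq x) (hp x)), mul_sqrt_div_self (hp x) (hq x)]
  simp only [h]
  ring

/-- Apply `log u ≥ 1 - 1 / u` at `u = √(p / q)`. -/
theorem hellingerSq_le_kl {p q : 𝔛 → ℝ} (hp : ∀ x, 0 < p x) (hq : ∀ x, 0 < q x)
    (hp1 : ∑ x, p x = 1) (hq1 : ∑ x, q x = 1) : hellingerSq p q ≤ kl p q := by
  rw [hellingerSq_eq hp hq hp1 hq1, kl]
  have h : ∀ x, 2 * (p x - √(p x) * √(q x)) ≤ p x * Real.log (p x / q x) := fun x => by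
    have h1 := Real.one_sub_inv_le_log_of_pos (Real.sqrt_pos.2 (div_pos (hp x) (hq x)))
    rw [Real.log_sqrt (div_pos (hp x) (hq x)).le, ← Real.sqrt_inv, inv_div] at h1
    have h2 := mul_le_mul_of_nonneg_left h1 (hp x).le
    rw [mul_sub, mul_sqrt_div_self (hp x) (hq x)] at h2
    linarith
  calc _ = ∑ x, 2 * (p x - √(p x) * √(q x)) := by
        rw [← Finset.mul_sum, Finset.sum_sub_distrib, hp1]; ring
    _ ≤ _ := Finset.sum_le_sum fun x _ => h x

theorem le_one_of_sum_eq_one {p : 𝔛 → ℝ} (hp : ∀ x, 0 < p x) (hp1 : ∑ x, p x = 1) (x : 𝔛) :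
    p x ≤ 1 :=
  hp1 ▸ Finset.single_le_sum (fun y _ => (hp y).le) (Finset.mem_univ x)

/-- The opposite direction, used for the reference network only, needs a lower bound on `q`. By `√u
≤ (1 + u) / 2` the excess over 1 is at most half the χ² divergence, and `(p - q)² ≤ 4 (√p - √q)²`
reduces that to Hellinger and then to KL. -/
theorem sum_mul_exp_neg_half_log_le {p q : 𝔛 → ℝ} {m : ℝ} (hm : 0 < m) (hp : ∀ x, 0 < p x)
    (hq : ∀ x, m ≤ q x) (hp1 : ∑ x, p x = 1) (hq1 : ∑ x, q x = 1) :
    ∑ x, p x * Real.exp ((Real.log (p x) - Real.log (q x)) / 2) ≤ 1 + 2 / m * kl p q := by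
  have hq0 : ∀ x, 0 < q x := fun x => hm.trans_le (hq x)
  have h : ∀ x, p x * Real.exp ((Real.log (p x) - Real.log (q x)) / 2) ≤
      p x + (p x - q x) / 2 + 2 / m * (√(p x) - √(q x)) ^ 2 := fun x => by
    have hpx := hp x
    have hqx := hq0 x
    rw [← Real.log_div hpx.ne' hqx.ne', Real.exp_half, Real.exp_log (div_pos hpx hqx)]
    have h1 : √(p x / q x) ≤ (1 + p x / q x) / 2 := by
      have h2 := Real.sq_sqrt (div_pos hpx hqx).le
      nlinarith [sq_nonneg (√(p x / q x) - 1)]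
    have h3 : (p x - q x) ^ 2 ≤ 4 * (√(p x) - √(q x)) ^ 2 := by
      have h4 := Real.sq_sqrt hpx.le
      have h5 := Real.sq_sqrt hqx.le
      have h6 : (p x - q x) ^ 2 = (√(p x) + √(q x)) ^ 2 * (√(p x) - √(q x)) ^ 2 := by
        rw [← mul_pow, ← sq_sub_sq, h4, h5]
      rw [h6]
      refine mul_le_mul_of_nonneg_right ?_ (sq_nonneg _)
      have h7 : √(p x) ≤ 1 := Real.sqrt_le_one.2 (le_one_of_sum_eq_one hp hp1 x)
      have h8 : √(q x) ≤ 1 := Real.sqrt_le_one.2 (le_one_of_sum_eq_one hq0 hq1 x)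
      nlinarith [Real.sqrt_nonneg (p x), Real.sqrt_nonneg (q x)]
    calc p x * √(p x / q x) ≤ p x * ((1 + p x / q x) / 2) := mul_le_mul_of_nonneg_left h1 hpx.le
      _ = p x + (p x - q x) / 2 + (p x - q x) ^ 2 / q x / 2 := by field_simp; ring
      _ ≤ p x + (p x - q x) / 2 + (p x - q x) ^ 2 / m / 2 := by
        gcongr
        exact hq x
      _ ≤ p x + (p x - q x) / 2 + 4 * (√(p x) - √(q x)) ^ 2 / m / 2 := by gcongr
      _ = _ := by ring
  refine (Finset.sum_le_sum fun x _ => h x).trans ?_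
  rw [Finset.sum_add_distrib, Finset.sum_add_distrib, ← Finset.sum_div, Finset.sum_sub_distrib,
    hp1, hq1, ← Finset.mul_sum]
  have := mul_le_mul_of_nonneg_left (hellingerSq_le_kl hp hq0 hp1 hq1) (by positivity : 0 ≤ 2 / m)
  simp only [hellingerSq] at this
  linarith

/-- Cauchy–Schwarz for `|p - q| = (√p + √q) |√p - √q|`, linearised by AM-GM with a free weight `a`.
Being affine in the squared Hellinger distance, it can be averaged over `S` directly, and `a` is
chosen at the very end. -/
theorem sum_abs_sub_le_hellingerSq {p q : 𝔛 → ℝ} (hp : ∀ x, 0 < p x) (hq : ∀ x, 0 < q x)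
    (hp1 : ∑ x, p x = 1) (hq1 : ∑ x, q x = 1) {a : ℝ} (ha : 0 < a) :
    ∑ x, |p x - q x| ≤ (hellingerSq p q / a + 4 * a) / 2 := by
  have h : ∀ x, |p x - q x| ≤ ((√(p x) - √(q x)) ^ 2 / a + a * (2 * p x + 2 * q x)) / 2 :=
    fun x => by
      have h4 := Real.sq_sqrt (hp x).le
      have h5 := Real.sq_sqrt (hq x).le
      set u := √(p x)
      set v := √(q x)
      have h6 : p x - q x = (u + v) * (u - v) := by rw [← sq_sub_sq, h4, h5]
      have h7 : |p x - q x| = (u + v) * |u - v| := by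
        rw [h6, abs_mul, abs_of_nonneg (add_nonneg (Real.sqrt_nonneg _) (Real.sqrt_nonneg _))]
      have h8 : a * (2 * p x + 2 * q x) ≥ a * (u + v) ^ 2 := by
        apply mul_le_mul_of_nonneg_left _ ha.le
        nlinarith [sq_nonneg (u - v)]
      have h9 : 2 * ((u + v) * |u - v|) ≤ (u - v) ^ 2 / a + a * (u + v) ^ 2 := by
        rw [← sq_abs (u - v)]
        have : |u - v| ^ 2 / a + a * (u + v) ^ 2 - 2 * ((u + v) * |u - v|) =
            (|u - v| - a * (u + v)) ^ 2 / a := by field_simp; ring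
        have h10 : 0 ≤ (|u - v| - a * (u + v)) ^ 2 / a := by positivity
        linarith
      linarith
  refine (Finset.sum_le_sum fun x _ => h x).trans (le_of_eq ?_)
  rw [← Finset.sum_div, Finset.sum_add_distrib, ← Finset.sum_div, ← Finset.mul_sum,
    Finset.sum_add_distrib, ← Finset.mul_sum, ← Finset.mul_sum, hp1, hq1, hellingerSq]
  ring

/-- KL is at most the χ² divergence; there `1 / q ≤ 1 / m` and `|p - q| ≤ 1` leave a first power. -/
theorem kl_le_sum_abs_sub {p q : 𝔛 → ℝ} {m : ℝ} (hm : 0 < m) (hp : ∀ x, 0 < p x)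
    (hq : ∀ x, m ≤ q x) (hp1 : ∑ x, p x = 1) (hq1 : ∑ x, q x = 1) :
    kl p q ≤ 1 / m * ∑ x, |p x - q x| := by
  have hq0 : ∀ x, 0 < q x := fun x => hm.trans_le (hq x)
  have h : ∀ x, p x * Real.log (p x / q x) ≤ (p x - q x) + 1 / m * |p x - q x| := fun x => by
    have h1 := Real.log_le_sub_one_of_pos (div_pos (hp x) (hq0 x))
    have h2 : |p x - q x| ≤ 1 := abs_le.2
      ⟨by linarith [hp x, le_one_of_sum_eq_one hq0 hq1 x],
        by linarith [hq0 x, le_one_of_sum_eq_one hp hp1 x]⟩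
    calc p x * Real.log (p x / q x) ≤ p x * (p x / q x - 1) :=
          mul_le_mul_of_nonneg_left h1 (hp x).le
      _ = (p x - q x) + |p x - q x| ^ 2 / q x := by
          rw [sq_abs]; have := (hq0 x).ne'; field_simp; ring
      _ ≤ (p x - q x) + |p x - q x| / m := by
          gcongr
          · nlinarith [abs_nonneg (p x - q x)]
          · exact hq x
      _ = _ := by ring
  refine (Finset.sum_le_sum fun x _ => h x).trans (le_of_eq ?_)
  rw [Finset.sum_add_distrib, Finset.sum_sub_distrib, hp1, hq1, ← Finset.mul_sum]
  ring

theorem abs_sub_le_of_abs_log_sub_le {a b ε : ℝ} (ha : 0 < a) (hb : 0 < b)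
    (h : |Real.log a - Real.log b| ≤ ε) : |a - b| ≤ ε * (a + b) := by
  wlog hab : b ≤ a generalizing a b
  · rw [abs_sub_comm, add_comm]
    exact this hb ha (by rwa [abs_sub_comm]) (le_of_not_ge hab)
  have h1 := Real.one_sub_inv_le_log_of_pos (div_pos ha hb)
  rw [Real.log_div ha.ne' hb.ne', inv_div] at h1
  have h2 := (le_abs_self _).trans h
  rw [abs_of_nonneg (sub_nonneg.2 hab)]
  have h3 : a - b = a * (1 - b / a) := by field_simp
  have h4 : 0 ≤ ε := (abs_nonneg _).trans h
  rw [h3]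
  nlinarith

end Divergences

/-! ### Exponential moments of log-likelihood ratios and the likelihood bound over a net. -/

section MaximumLikelihood

variable {𝔛 Z : Type*} [Fintype 𝔛] [Fintype Z]

/-- Average log-likelihood of the next-token kernel `q` along a trajectory. -/
def avgLogLik (q : List 𝔛 → 𝔛 → ℝ) {T : ℕ} (w : Fin (T + 1) → 𝔛) : ℝ :=
  (∑ t : Fin T, Real.log (q ((List.ofFn w).take (t + 1)) (w t.succ))) / T

/-- Convexity of `exp` moves the time average outside, so the dependence between the steps of a
trajectory becomes irrelevant. The price is that a trajectory counts as one observation instead of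
`T`, which the size of the mixing time permits. -/
theorem sum_margProb_exp_average_le {P : Z → List 𝔛 → stdSimplex ℝ 𝔛} (π : stdSimplex ℝ Z)
    {c₀ : ℝ} (hc₀ : 0 < c₀) (hP : ∀ z S x, c₀ ≤ P z S x) {T : ℕ} (hT : 0 < T)
    (g : List 𝔛 → 𝔛 → ℝ) :
    ∑ w : Fin (T + 1) → 𝔛, margProb P π (List.ofFn w) *
        Real.exp ((∑ t : Fin T, g ((List.ofFn w).take (t + 1)) (w t.succ)) / T) ≤
      pretrainExp P π T fun S => ∑ x, predictive P π S x * Real.exp (g S x) := by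
  rw [← sum_margProb_average π hc₀ hP T fun S x => Real.exp (g S x)]
  refine Finset.sum_le_sum fun w _ => mul_le_mul_of_nonneg_left ?_ (margProb_nonneg P π _)
  have hT' : (T : ℝ) ≠ 0 := by positivity
  have h := convexOn_exp.map_sum_le (t := Finset.univ) (w := fun _ : Fin T => (1 / T : ℝ))
    (p := fun t => g ((List.ofFn w).take (t + 1)) (w t.succ))
    (fun _ _ => by positivity) (by simp [hT']) (fun _ _ => Set.mem_univ _)
  simp only [smul_eq_mul, ← Finset.mul_sum] at h
  rwa [one_div_mul_eq_div, one_div_mul_eq_div] at h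

/-- The exponential moment is at most `1 - H / 2 ≤ exp (-H / 2)`; normalising by it gives a
functional of mean at most one, ready for tensorisation over trajectories and Markov's inequality.
-/
theorem sum_margProb_exp_avgLogLik_le {P : Z → List 𝔛 → stdSimplex ℝ 𝔛} (π : stdSimplex ℝ Z)
    {c₀ : ℝ} (hc₀ : 0 < c₀) (hP : ∀ z S x, c₀ ≤ P z S x) {T : ℕ} (hT : 0 < T)
    {q : List 𝔛 → 𝔛 → ℝ} (hq : ∀ S x, 0 < q S x) (hq1 : ∀ S, ∑ x, q S x = 1) :
    ∑ w : Fin (T + 1) → 𝔛, margProb P π (List.ofFn w) *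
        Real.exp ((avgLogLik q w - avgLogLik (predictive P π) w) / 2 +
          (pretrainExp P π T fun S => hellingerSq (predictive P π S) (q S)) / 2) ≤ 1 := by
  set H := pretrainExp P π T fun S => hellingerSq (predictive P π S) (q S) with hH
  have h := sum_margProb_exp_average_le π hc₀ hP hT
    fun S x => (Real.log (q S x) - Real.log (predictive P π S x)) / 2
  simp only [sum_mul_exp_half_log (predictive_pos π hc₀ hP _) (hq _) (sum_predictive π hc₀ hP _)
    (hq1 _)] at h
  have h2 : (pretrainExp P π T fun S => 1 - hellingerSq (predictive P π S) (q S) / 2) =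
      1 - H / 2 := by
    have h3 := pretrainExp_add P π T (fun _ => 1)
      fun S => -(1 / 2) * hellingerSq (predictive P π S) (q S)
    rw [pretrainExp_const P π hT, pretrainExp_const_mul] at h3
    rw [sub_eq_add_neg, show -(H / 2) = -(1 / 2) * H by ring, hH, ← h3]
    congr 1
    funext S
    ring
  rw [h2] at h
  have h4 : ∀ w : Fin (T + 1) → 𝔛, (avgLogLik q w - avgLogLik (predictive P π) w) / 2 =
      (∑ t : Fin T, (Real.log (q ((List.ofFn w).take (t + 1)) (w t.succ)) -
        Real.log (predictive P π ((List.ofFn w).take (t + 1)) (w t.succ))) / 2) / T := fun w => by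
    rw [← Finset.sum_div, Finset.sum_sub_distrib, avgLogLik, avgLogLik]
    ring
  simp only [h4, Real.exp_add, ← mul_assoc, ← Finset.sum_mul]
  calc _ ≤ (1 - H / 2) * Real.exp (H / 2) := mul_le_mul_of_nonneg_right h (Real.exp_pos _).le
    _ ≤ Real.exp (-(H / 2)) * Real.exp (H / 2) := by
      gcongr
      linarith [Real.add_one_le_exp (-(H / 2))]
    _ = 1 := by rw [← Real.exp_add]; simp

/-- Controls how much likelihood the reference kernel loses against the true one, at the scale of
its KL approximation error. -/
theorem sum_margProb_exp_neg_avgLogLik_le {P : Z → List 𝔛 → stdSimplex ℝ 𝔛} (π : stdSimplex ℝ Z)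
    {c₀ : ℝ} (hc₀ : 0 < c₀) (hP : ∀ z S x, c₀ ≤ P z S x) {T : ℕ} (hT : 0 < T)
    {q : List 𝔛 → 𝔛 → ℝ} {m : ℝ} (hm : 0 < m) (hq : ∀ S x, m ≤ q S x)
    (hq1 : ∀ S, ∑ x, q S x = 1) :
    ∑ w : Fin (T + 1) → 𝔛, margProb P π (List.ofFn w) *
        Real.exp ((avgLogLik (predictive P π) w - avgLogLik q w) / 2 -
          2 / m * pretrainExp P π T fun S => kl (predictive P π S) (q S)) ≤ 1 := by
  set K := pretrainExp P π T fun S => kl (predictive P π S) (q S) with hK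
  have h := (sum_margProb_exp_average_le π hc₀ hP hT
    fun S x => (Real.log (predictive P π S x) - Real.log (q S x)) / 2).trans
    (pretrainExp_mono P π T fun S _ => sum_mul_exp_neg_half_log_le hm (predictive_pos π hc₀ hP S)
      (hq S) (sum_predictive π hc₀ hP S) (hq1 S))
  rw [pretrainExp_add, pretrainExp_const P π hT, pretrainExp_const_mul, ← hK] at h
  have h4 : ∀ w : Fin (T + 1) → 𝔛, (avgLogLik (predictive P π) w - avgLogLik q w) / 2 =
      (∑ t : Fin T, (Real.log (predictive P π ((List.ofFn w).take (t + 1)) (w t.succ)) -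
        Real.log (q ((List.ofFn w).take (t + 1)) (w t.succ))) / 2) / T := fun w => by
    rw [← Finset.sum_div, Finset.sum_sub_distrib, avgLogLik, avgLogLik]
    ring
  simp only [h4]
  simp only [sub_eq_add_neg _ (2 / m * K), Real.exp_add, ← mul_assoc, ← Finset.sum_mul]
  calc _ ≤ (1 + 2 / m * K) * Real.exp (-(2 / m * K)) :=
        mul_le_mul_of_nonneg_right h (Real.exp_pos _).le
    _ ≤ Real.exp (2 / m * K) * Real.exp (-(2 / m * K)) := by
      gcongr
      linarith [Real.add_one_le_exp (2 / m * K)]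
    _ = 1 := by rw [← Real.exp_add]; simp

theorem datasetProb_nonneg (P : Z → List 𝔛 → stdSimplex ℝ 𝔛) (π : stdSimplex ℝ Z) {N T : ℕ}
    (ω : Dataset 𝔛 N T) : 0 ≤ datasetProb P π ω :=
  Finset.prod_nonneg fun _ _ => margProb_nonneg P π _

theorem sum_datasetProb_exp_le_one (P : Z → List 𝔛 → stdSimplex ℝ 𝔛) (π : stdSimplex ℝ Z)
    {N T : ℕ} {φ : (Fin (T + 1) → 𝔛) → ℝ}
    (hφ : ∑ w : Fin (T + 1) → 𝔛, margProb P π (List.ofFn w) * Real.exp (φ w) ≤ 1) :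
    ∑ ω : Dataset 𝔛 N T, datasetProb P π ω * Real.exp (∑ n, φ (ω n)) ≤ 1 := by
  have h := Fintype.sum_pow (fun w : Fin (T + 1) → 𝔛 =>
    margProb P π (List.ofFn w) * Real.exp (φ w)) N
  simp only [datasetProb, Real.exp_sum, ← Finset.prod_mul_distrib]
  exact h.symm.trans_le (pow_le_one₀ (Finset.sum_nonneg fun w _ =>
    mul_nonneg (margProb_nonneg P π _) (Real.exp_pos _).le) hφ)

theorem sum_datasetProb (P : Z → List 𝔛 → stdSimplex ℝ 𝔛) (π : stdSimplex ℝ Z) (N T : ℕ) :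
    ∑ ω : Dataset 𝔛 N T, datasetProb P π ω = 1 := by
  have h := Fintype.sum_pow (fun w : Fin (T + 1) → 𝔛 => margProb P π (List.ofFn w)) N
  rw [sum_margProb_ofFn, one_pow] at h
  exact h.symm

/-- Markov's inequality for a nonnegative functional of mean at most one. -/
theorem one_sub_le_dataProb (P : Z → List 𝔛 → stdSimplex ℝ 𝔛) (π : stdSimplex ℝ Z) {N T : ℕ}
    {Φ : Dataset 𝔛 N T → ℝ} (hΦ : ∀ ω, 0 ≤ Φ ω) (h1 : ∑ ω, datasetProb P π ω * Φ ω ≤ 1)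
    {δ : ℝ} (hδ : 0 < δ) {E : Set (Dataset 𝔛 N T)} (hE : ∀ ω, Φ ω ≤ 1 / δ → ω ∈ E) :
    1 - δ ≤ dataProb P π E := by
  classical
  have h : ∀ ω, datasetProb P π ω - δ * (datasetProb P π ω * Φ ω) ≤
      if ω ∈ E then datasetProb P π ω else 0 := by
    intro ω
    have h0 := datasetProb_nonneg P π ω
    split_ifs with hω
    · have := mul_nonneg hδ.le (mul_nonneg h0 (hΦ ω))
      linarith
    · have h2 : 1 / δ < Φ ω := by
        by_contra! h3
        exact hω (hE ω h3)
      rw [div_lt_iff₀ hδ] at h2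
      nlinarith
  have h3 := Finset.sum_le_sum fun ω (_ : ω ∈ Finset.univ) => h ω
  rw [Finset.sum_sub_distrib, ← Finset.mul_sum, sum_datasetProb] at h3
  unfold dataProb
  have h4 := mul_le_mul_of_nonneg_left h1 hδ.le
  refine (h3.trans' (by linarith)).trans_eq (Finset.sum_congr rfl fun ω _ => by congr)

/-- With high probability, every kernel `q` that is at least as likely as the reference `qs`
and close to some element of the finite net `G` is close to the predictive distribution. -/
theorem one_sub_le_dataProb_sum_abs_sub {P : Z → List 𝔛 → stdSimplex ℝ 𝔛} (π : stdSimplex ℝ Z)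
    {c₀ : ℝ} (hc₀ : 0 < c₀) (hP : ∀ z S x, c₀ ≤ P z S x) {N T : ℕ} (hN : 0 < N) (hT : 0 < T)
    {G : Type*} [Fintype G] [Nonempty G] {qG : G → List 𝔛 → 𝔛 → ℝ}
    (hG : ∀ g S x, 0 < qG g S x) (hG1 : ∀ g S, ∑ x, qG g S x = 1)
    {qs : List 𝔛 → 𝔛 → ℝ} {m : ℝ} (hm : 0 < m) (hqs : ∀ S x, m ≤ qs S x)
    (hqs1 : ∀ S, ∑ x, qs S x = 1) {δ : ℝ} (hδ : 0 < δ) (ε : ℝ) :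
    1 - δ ≤ dataProb P π {ω : Dataset 𝔛 N T | ∀ q : List 𝔛 → 𝔛 → ℝ,
      (∀ S x, 0 < q S x) → (∀ S, ∑ x, q S x = 1) →
      (∑ n, avgLogLik qs (ω n) ≤ ∑ n, avgLogLik q (ω n)) →
      (∃ g, ∀ S, S ≠ [] → ∀ x, |Real.log (q S x) - Real.log (qG g S x)| ≤ ε) →
      ∀ a, 0 < a → (pretrainExp P π T fun S => ∑ x, |predictive P π S x - q S x|) ≤
        2 * ε + ((ε + 4 / m * (pretrainExp P π T fun S => kl (predictive P π S) (qs S)) +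
          2 / N * (Real.log (2 * Fintype.card G / δ) + Real.log (2 / δ))) / a + 4 * a) / 2} := by
  set p := predictive P π with hp
  have hp0 : ∀ S x, 0 < p S x := predictive_pos π hc₀ hP
  have hp1 : ∀ S, ∑ x, p S x = 1 := sum_predictive π hc₀ hP
  let H : G → ℝ := fun g => pretrainExp P π T fun S => hellingerSq (p S) (qG g S)
  set K := pretrainExp P π T fun S => kl (p S) (qs S) with hK
  let φ : G → (Fin (T + 1) → 𝔛) → ℝ := fun g w =>
    (avgLogLik (qG g) w - avgLogLik p w) / 2 + H g / 2
  let ψ : (Fin (T + 1) → 𝔛) → ℝ := fun w => (avgLogLik p w - avgLogLik qs w) / 2 - 2 / m * K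
  have hcard : (0 : ℝ) < Fintype.card G := by exact_mod_cast Fintype.card_pos
  -- Union bound in one functional: half the weight is spread evenly over the net, the other half
  -- goes to the reference kernel. This produces the thresholds `2 |G| / δ` and `2 / δ`.
  let Φ : Dataset 𝔛 N T → ℝ := fun ω =>
    (∑ g, Real.exp (∑ n, φ g (ω n))) / (2 * Fintype.card G) + Real.exp (∑ n, ψ (ω n)) / 2
  refine one_sub_le_dataProb P π (Φ := Φ) (fun ω => ?_) ?_ hδ fun ω hω q hq hq1 hlik hg a ha => ?_
  · have : 0 ≤ ∑ g, Real.exp (∑ n, φ g (ω n)) := Finset.sum_nonneg fun g _ => (Real.exp_pos _).le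
    positivity
  · have h1 : ∀ g, ∑ ω : Dataset 𝔛 N T, datasetProb P π ω * Real.exp (∑ n, φ g (ω n)) ≤ 1 :=
      fun g => sum_datasetProb_exp_le_one P π
        (sum_margProb_exp_avgLogLik_le π hc₀ hP hT (hG g) (hG1 g))
    have h2 : ∑ ω : Dataset 𝔛 N T, datasetProb P π ω * Real.exp (∑ n, ψ (ω n)) ≤ 1 :=
      sum_datasetProb_exp_le_one P π (sum_margProb_exp_neg_avgLogLik_le π hc₀ hP hT hm hqs hqs1)
    have h3 : ∑ ω : Dataset 𝔛 N T, datasetProb P π ω * Φ ω =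
        (∑ g, ∑ ω : Dataset 𝔛 N T, datasetProb P π ω * Real.exp (∑ n, φ g (ω n))) /
          (2 * Fintype.card G) +
        (∑ ω : Dataset 𝔛 N T, datasetProb P π ω * Real.exp (∑ n, ψ (ω n))) / 2 := by
      simp only [Φ, mul_add, Finset.sum_add_distrib, ← mul_div_assoc, ← Finset.sum_div,
        Finset.mul_sum]
      rw [Finset.sum_comm]
    have h4 : ∑ g, ∑ ω : Dataset 𝔛 N T, datasetProb P π ω * Real.exp (∑ n, φ g (ω n)) ≤
        Fintype.card G := by
      simpa using Finset.sum_le_sum fun g (_ : g ∈ Finset.univ) => h1 g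
    have h5 : (∑ g, ∑ ω : Dataset 𝔛 N T, datasetProb P π ω * Real.exp (∑ n, φ g (ω n))) /
        (2 * Fintype.card G) ≤ 1 / 2 := by
      rw [div_le_div_iff₀ (by positivity) (by norm_num)]
      linarith
    rw [h3]
    linarith
  · obtain ⟨g, hg⟩ := hg
    have hN' : (0 : ℝ) < N := by exact_mod_cast hN
    have hT' : (0 : ℝ) < T := by exact_mod_cast hT
    have hsum : 0 ≤ ∑ g, Real.exp (∑ n, φ g (ω n)) :=
      Finset.sum_nonneg fun g _ => (Real.exp_pos _).le
    have h1 : ∑ n, φ g (ω n) ≤ Real.log (2 * Fintype.card G / δ) := by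
      rw [Real.le_log_iff_exp_le (by positivity)]
      have h2 : Real.exp (∑ n, φ g (ω n)) ≤ ∑ g, Real.exp (∑ n, φ g (ω n)) :=
        Finset.single_le_sum (f := fun g => Real.exp (∑ n, φ g (ω n)))
          (fun g _ => (Real.exp_pos _).le) (Finset.mem_univ g)
      have h3 : (∑ g, Real.exp (∑ n, φ g (ω n))) / (2 * Fintype.card G) ≤ 1 / δ :=
        (le_add_of_nonneg_right (by positivity)).trans hω
      rw [div_le_iff₀ (by positivity)] at h3
      calc _ ≤ _ := h2
        _ ≤ _ := h3
        _ = _ := by ring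
    have h2 : ∑ n, ψ (ω n) ≤ Real.log (2 / δ) := by
      rw [Real.le_log_iff_exp_le (by positivity)]
      have h3 : Real.exp (∑ n, ψ (ω n)) / 2 ≤ 1 / δ :=
        (le_add_of_nonneg_left (by positivity)).trans hω
      calc _ ≤ 1 / δ * 2 := by linarith
        _ = _ := by ring
    have h3 : ∑ n, avgLogLik q (ω n) ≤ ∑ n, avgLogLik (qG g) (ω n) + N * ε := by
      have : ∀ n, avgLogLik q (ω n) ≤ avgLogLik (qG g) (ω n) + ε := fun n => by
        rw [avgLogLik, avgLogLik, div_add' _ _ _ hT'.ne']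
        refine div_le_div_of_nonneg_right ?_ hT'.le
        have : ∑ t : Fin T, (ε : ℝ) = ε * T := by simp [mul_comm]
        rw [← this, ← Finset.sum_add_distrib]
        refine Finset.sum_le_sum fun t _ => ?_
        have := (le_abs_self _).trans
          (hg ((List.ofFn (ω n)).take (t + 1)) (by simp) (ω n t.succ))
        linarith
      refine (Finset.sum_le_sum fun n _ => this n).trans (le_of_eq ?_)
      simp [Finset.sum_add_distrib]
    -- Adding the two deviation bounds cancels the log-likelihood of the true kernel; what remains
    -- compares the reference with the net point and is controlled by `hlik` and `h3`.
    have h4 : H g ≤ ε + 4 / m * K +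
        2 / N * (Real.log (2 * Fintype.card G / δ) + Real.log (2 / δ)) := by
      simp only [φ, ψ, Finset.sum_add_distrib, Finset.sum_sub_distrib, ← Finset.sum_div,
        Finset.sum_const, Finset.card_univ, Fintype.card_fin, nsmul_eq_mul] at h1 h2
      have h5 : N * (H g / 2) ≤ N * (ε / 2) + N * (2 / m * K) +
          (Real.log (2 * Fintype.card G / δ) + Real.log (2 / δ)) := by linarith
      have h6 := mul_le_mul_of_nonneg_left h5 (by positivity : (0 : ℝ) ≤ 2 / N)
      have e1 : (2 / N : ℝ) * (N * (H g / 2)) = H g := by field_simp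
      have e2 : ∀ L : ℝ, (2 / N : ℝ) * (N * (ε / 2) + N * (2 / m * K) + L) =
          ε + 4 / m * K + 2 / N * L := fun L => by field_simp; ring
      rwa [e1, e2] at h6
    have h5 : (pretrainExp P π T fun S => ∑ x, |p S x - q S x|) ≤
        pretrainExp P π T fun S => 2 * ε + (1 / (2 * a) * hellingerSq (p S) (qG g S) + 2 * a) := by
      refine pretrainExp_mono P π T fun S hS => ?_
      have h6 := sum_abs_sub_le_hellingerSq (hp0 S) (hG g S) (hp1 S) (hG1 g S) ha
      have h7 : ∑ x, |p S x - q S x| ≤ ∑ x, (|p S x - qG g S x| + ε * (q S x + qG g S x)) := by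
        refine Finset.sum_le_sum fun x _ => ?_
        have h8 := abs_sub_le_of_abs_log_sub_le (hq S x) (hG g S x) (hg S hS x)
        have h9 := abs_sub_le (p S x) (qG g S x) (q S x)
        rw [abs_sub_comm (qG g S x)] at h9
        linarith
      rw [Finset.sum_add_distrib, ← Finset.mul_sum, Finset.sum_add_distrib, hq1, hG1] at h7
      have h8 : (hellingerSq (p S) (qG g S) / a + 4 * a) / 2 =
          1 / (2 * a) * hellingerSq (p S) (qG g S) + 2 * a := by field_simp; ring
      linarith
    rw [pretrainExp_add, pretrainExp_add, pretrainExp_const P π hT, pretrainExp_const P π hT,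
      pretrainExp_const_mul] at h5
    have h6 := div_le_div_of_nonneg_right h4 ha.le
    have h7 : 1 / (2 * a) * H g = H g / a / 2 := by field_simp
    change _ ≤ 2 * ε + (1 / (2 * a) * H g + 2 * a) at h5
    linarith

end MaximumLikelihood

/-! ### Continuity of the transformer in its parameters -/

section Softmax

variable {ι : Type*} [Fintype ι]

theorem sum_exp_pos [Nonempty ι] (v : ι → ℝ) : 0 < ∑ j, Real.exp (v j) :=
  Finset.sum_pos (fun _ _ => Real.exp_pos _) Finset.univ_nonempty

theorem softmax_pos (v : ι → ℝ) (i : ι) : 0 < softmax v i :=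
  have : Nonempty ι := ⟨i⟩
  div_pos (Real.exp_pos _) (sum_exp_pos v)

theorem sum_softmax [Nonempty ι] (v : ι → ℝ) : ∑ i, softmax v i = 1 := by
  simp only [softmax, ← Finset.sum_div]
  exact div_self (sum_exp_pos v).ne'

theorem log_softmax (v : ι → ℝ) (i : ι) :
    Real.log (softmax v i) = v i - Real.log (∑ j, Real.exp (v j)) := by
  have : Nonempty ι := ⟨i⟩
  rw [softmax, Real.log_div (Real.exp_pos _).ne' (sum_exp_pos v).ne', Real.log_exp]

theorem log_sum_exp_le_add {v v' : ι → ℝ} [Nonempty ι] {ε : ℝ} (h : ∀ i, |v i - v' i| ≤ ε) :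
    Real.log (∑ j, Real.exp (v j)) ≤ Real.log (∑ j, Real.exp (v' j)) + ε := by
  rw [← Real.log_exp ε, ← Real.log_mul (sum_exp_pos v').ne' (Real.exp_pos ε).ne']
  refine Real.log_le_log (sum_exp_pos v) ?_
  rw [Finset.sum_mul]
  refine Finset.sum_le_sum fun j _ => ?_
  rw [← Real.exp_add]
  exact Real.exp_le_exp.2 (by linarith [(abs_le.1 (h j)).2])

/-- One `ε` comes from the logit and one from the log-normaliser, irrespective of the size of `ι`.
-/
theorem abs_log_softmax_sub_le {v v' : ι → ℝ} {ε : ℝ} (h : ∀ i, |v i - v' i| ≤ ε) (i : ι) :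
    |Real.log (softmax v i) - Real.log (softmax v' i)| ≤ 2 * ε := by
  have : Nonempty ι := ⟨i⟩
  rw [log_softmax, log_softmax]
  have h1 := log_sum_exp_le_add h
  have h2 := log_sum_exp_le_add (v := v') (v' := v) fun i => by rw [abs_sub_comm]; exact h i
  have h3 := abs_le.1 (h i)
  exact abs_le.2 ⟨by linarith, by linarith⟩

/-- Relative closeness sums against total mass one, so no factor `|ι|` appears. Applied to attention
rows, this keeps the Lipschitz constants independent of the prompt length. -/
theorem sum_abs_softmax_sub_le [Nonempty ι] {v v' : ι → ℝ} {ε : ℝ} (h : ∀ i, |v i - v' i| ≤ ε) :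
    ∑ i, |softmax v i - softmax v' i| ≤ 4 * ε := by
  refine (Finset.sum_le_sum fun i _ => abs_sub_le_of_abs_log_sub_le (softmax_pos v i)
    (softmax_pos v' i) (abs_log_softmax_sub_le h i)).trans (le_of_eq ?_)
  rw [← Finset.mul_sum, Finset.sum_add_distrib, sum_softmax, sum_softmax]
  ring

theorem le_softmax {v : ι → ℝ} {b : ℝ} (h : ∀ i, |v i| ≤ b) (i : ι) :
    Real.exp (-(2 * b)) / Fintype.card ι ≤ softmax v i := by
  have : Nonempty ι := ⟨i⟩
  have hc : (0 : ℝ) < Fintype.card ι := by exact_mod_cast Fintype.card_pos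
  rw [softmax, div_le_div_iff₀ hc (sum_exp_pos v)]
  have h1 : ∑ j, Real.exp (v j) ≤ Fintype.card ι * Real.exp b := by
    simpa using Finset.sum_le_sum fun j (_ : j ∈ Finset.univ) =>
      Real.exp_le_exp.2 (abs_le.1 (h j)).2
  calc _ ≤ Real.exp (-(2 * b)) * (Fintype.card ι * Real.exp b) :=
        mul_le_mul_of_nonneg_left h1 (Real.exp_pos _).le
    _ = Real.exp (-b) * Fintype.card ι := by
        rw [show -(2 * b) = -b + -b by ring, Real.exp_add]
        have : Real.exp (-b) * Real.exp b = 1 := by rw [← Real.exp_add]; simp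
        linear_combination Real.exp (-b) * Fintype.card ι * this
    _ ≤ _ := mul_le_mul_of_nonneg_right (Real.exp_le_exp.2 (abs_le.1 (h i)).1) hc.le

end Softmax

/-! ### Entrywise perturbation bounds for matrix products, attention and row projection. -/

section Entrywise

theorem abs_mul_apply_le {ι κ n : Type*} [Fintype n] {X : Matrix ι n ℝ} {W : Matrix n κ ℝ}
    {a b : ℝ} (hX : ∀ i j, |X i j| ≤ a) (hW : ∀ j k, |W j k| ≤ b) (i : ι) (k : κ) :
    |(X * W) i k| ≤ Fintype.card n * (a * b) := by
  rw [Matrix.mul_apply]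
  refine (Finset.abs_sum_le_sum_abs _ _).trans ?_
  have : ∀ j, |X i j * W j k| ≤ a * b := fun j => by
    rw [abs_mul]
    exact mul_le_mul (hX i j) (hW j k) (abs_nonneg _) ((abs_nonneg _).trans (hX i j))
  simpa using Finset.sum_le_sum fun j (_ : j ∈ Finset.univ) => this j

theorem abs_mul_sub_mul_le {x x' y y' a b e f : ℝ} (hx : |x'| ≤ a) (hy : |y| ≤ b)
    (he : |x - x'| ≤ e) (hf : |y - y'| ≤ f) : |x * y - x' * y'| ≤ e * b + a * f := by
  have : x * y - x' * y' = (x - x') * y + x' * (y - y') := by ring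
  rw [this]
  refine (abs_add_le _ _).trans ?_
  rw [abs_mul, abs_mul]
  exact add_le_add (mul_le_mul he hy (abs_nonneg _) ((abs_nonneg _).trans he))
    (mul_le_mul hx hf (abs_nonneg _) ((abs_nonneg _).trans hx))

theorem abs_mul_apply_sub_le {ι κ n : Type*} [Fintype n] {X X' : Matrix ι n ℝ}
    {W W' : Matrix n κ ℝ} {a b e f : ℝ} (hX : ∀ i j, |X' i j| ≤ a) (hW : ∀ j k, |W j k| ≤ b)
    (he : ∀ i j, |X i j - X' i j| ≤ e) (hf : ∀ j k, |W j k - W' j k| ≤ f) (i : ι) (k : κ) :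
    |(X * W) i k - (X' * W') i k| ≤ Fintype.card n * (e * b + a * f) := by
  rw [Matrix.mul_apply, Matrix.mul_apply, ← Finset.sum_sub_distrib]
  refine (Finset.abs_sum_le_sum_abs _ _).trans ?_
  refine (Finset.sum_le_sum fun j _ =>
    abs_mul_sub_mul_le (hX i j) (hW j k) (he i j) (hf j k)).trans (le_of_eq ?_)
  rw [Finset.sum_const, Finset.card_univ, nsmul_eq_mul]

variable {L k m : ℕ}

/-- Attention averages the rows of `V` with probability weights: changing the weights costs their ℓ¹
distance, changing `V` costs nothing extra. Neither depends on `L`. -/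
theorem abs_attn_sub_le {Q K Q' K' : Matrix (Fin L) (Fin k) ℝ} {V V' : Matrix (Fin L) (Fin m) ℝ}
    {a s f : ℝ} (hV : ∀ i j, |V i j| ≤ a)
    (hs : ∀ i j, |(Q * K.transpose) i j - (Q' * K'.transpose) i j| ≤ s)
    (hf : ∀ i j, |V i j - V' i j| ≤ f) (i : Fin L) (j : Fin m) :
    |attn Q K V i j - attn Q' K' V' i j| ≤ 4 * s * a + f := by
  have : Nonempty (Fin L) := ⟨i⟩
  have ha : 0 ≤ a := (abs_nonneg _).trans (hV i j)
  rw [attn, attn, Matrix.mul_apply, Matrix.mul_apply, ← Finset.sum_sub_distrib]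
  refine (Finset.abs_sum_le_sum_abs _ _).trans ?_
  calc _ ≤ ∑ r, (|softmax ((Q * K.transpose) i) r - softmax ((Q' * K'.transpose) i) r| * a +
          softmax ((Q' * K'.transpose) i) r * f) := Finset.sum_le_sum fun r _ =>
        abs_mul_sub_mul_le (abs_of_pos (softmax_pos _ r)).le (hV r j) le_rfl (hf r j)
    _ ≤ _ := by
      rw [Finset.sum_add_distrib, ← Finset.sum_mul, ← Finset.sum_mul, sum_softmax, one_mul]
      gcongr
      exact sum_abs_softmax_sub_le (hs i)

theorem sum_sq_layerNorm_le {X : Matrix (Fin L) (Fin m) ℝ} (i : Fin L) :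
    ∑ j, layerNorm X i j ^ 2 ≤ 1 := by
  have h : ∀ j, layerNorm X i j ^ 2 = X i j ^ 2 / (max 1 √(∑ k, X i k ^ 2)) ^ 2 := fun j => by
    simp [layerNorm, div_pow]
  simp only [h, ← Finset.sum_div]
  have h0 : 0 ≤ ∑ k, X i k ^ 2 := Finset.sum_nonneg fun _ _ => sq_nonneg _
  have h1 : (0 : ℝ) < max 1 √(∑ k, X i k ^ 2) := lt_max_of_lt_left one_pos
  rw [div_le_one (by positivity)]
  calc _ = (√(∑ k, X i k ^ 2)) ^ 2 := (Real.sq_sqrt h0).symm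
    _ ≤ _ := by gcongr; exact le_max_right _ _

theorem abs_layerNorm_apply_le_one {X : Matrix (Fin L) (Fin m) ℝ} (i : Fin L) (j : Fin m) :
    |layerNorm X i j| ≤ 1 :=
  abs_le_one_iff_mul_self_le_one.2 (by
    rw [← sq]
    exact (Finset.single_le_sum (f := fun j => layerNorm X i j ^ 2) (fun _ _ => sq_nonneg _)
      (Finset.mem_univ j)).trans (sum_sq_layerNorm_le i))

theorem abs_sqrt_sum_sq_sub_le (x y : Fin m → ℝ) {e : ℝ} (h : ∀ j, |x j - y j| ≤ e) :
    |√(∑ k, x k ^ 2) - √(∑ k, y k ^ 2)| ≤ m * e := by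
  have hn : ∀ z : Fin m → ℝ, √(∑ k, z k ^ 2) = ‖WithLp.toLp 2 z‖ := fun z => by
    simp [EuclideanSpace.norm_eq]
  rw [hn, hn]
  refine (abs_norm_sub_norm_le _ _).trans ?_
  rw [← WithLp.toLp_sub, ← hn]
  refine Real.sqrt_le_iff.2 ⟨?_, ?_⟩
  · rcases Nat.eq_zero_or_pos m with rfl | hm
    · simp
    · exact mul_nonneg (Nat.cast_nonneg _) ((abs_nonneg _).trans (h ⟨0, hm⟩))
  · have h1 : ∑ k, (x - y) k ^ 2 ≤ ∑ _k : Fin m, e ^ 2 := Finset.sum_le_sum fun k _ => by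
      rw [← sq_abs]
      exact pow_le_pow_left₀ (abs_nonneg _) (h k) 2
    refine h1.trans ?_
    simp only [Finset.sum_const, Finset.card_univ, Fintype.card_fin, nsmul_eq_mul, mul_pow]
    refine mul_le_mul_of_nonneg_right ?_ (sq_nonneg e)
    exact_mod_cast Nat.le_self_pow two_ne_zero m

/-- The denominators are at least 1 and differ by at most `m * e`, while the normalised entry
multiplying that difference is at most 1. -/
theorem abs_layerNorm_sub_le {X X' : Matrix (Fin L) (Fin m) ℝ} {e : ℝ}
    (h : ∀ i j, |X i j - X' i j| ≤ e) (i : Fin L) (j : Fin m) :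
    |layerNorm X i j - layerNorm X' i j| ≤ (1 + m) * e := by
  have h1 := abs_layerNorm_apply_le_one (X := X') i j
  have h2 := abs_sqrt_sum_sq_sub_le (X i) (X' i) (h i)
  simp only [layerNorm, Matrix.of_apply] at h1 ⊢
  set M := max 1 √(∑ k, X i k ^ 2)
  set M' := max 1 √(∑ k, X' i k ^ 2)
  have hM : 1 ≤ M := le_max_left _ _
  have hM' : 1 ≤ M' := le_max_left _ _
  have hMM : |M' - M| ≤ m * e := by
    rw [abs_sub_comm]
    refine (abs_max_sub_max_le_max _ _ _ _).trans ?_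
    rw [sub_self, abs_zero]
    exact max_le ((abs_nonneg _).trans h2) h2
  have h3 : X i j / M - X' i j / M' = (X i j - X' i j) / M + X' i j / M' * ((M' - M) / M) := by
    field_simp
    ring
  rw [h3]
  refine (abs_add_le _ _).trans ?_
  rw [abs_mul, abs_div, abs_div (M' - M), abs_of_pos (by linarith : 0 < M), add_mul, one_mul]
  refine add_le_add ((div_le_self (abs_nonneg _) hM).trans (h i j)) ?_
  calc _ ≤ 1 * |M' - M| := mul_le_mul h1 (div_le_self (abs_nonneg _) hM) (by positivity) one_pos.le
    _ ≤ _ := by rwa [one_mul]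

end Entrywise

/-! ### Perturbation of one layer and of the stack of layers. -/

section Layers

variable {A : Arch}

/-- All entries of the layer are at most `U` in absolute value. -/
structure LayerParam.EntriesLe (w : LayerParam A) (U : ℝ) : Prop where
  γ1 : |w.γ1| ≤ U
  γ2 : |w.γ2| ≤ U
  WQ : ∀ i a b, |w.WQ i a b| ≤ U
  WK : ∀ i a b, |w.WK i a b| ≤ U
  WV : ∀ i a b, |w.WV i a b| ≤ U
  A1 : ∀ a b, |w.A1 a b| ≤ U
  A2 : ∀ a b, |w.A2 a b| ≤ U

/-- The entries of the two layers differ by at most `η`. -/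
structure LayerParam.Close (w w' : LayerParam A) (η : ℝ) : Prop where
  γ1 : |w.γ1 - w'.γ1| ≤ η
  γ2 : |w.γ2 - w'.γ2| ≤ η
  WQ : ∀ i a b, |w.WQ i a b - w'.WQ i a b| ≤ η
  WK : ∀ i a b, |w.WK i a b - w'.WK i a b| ≤ η
  WV : ∀ i a b, |w.WV i a b - w'.WV i a b| ≤ η
  A1 : ∀ a b, |w.A1 a b - w'.A1 a b| ≤ η
  A2 : ∀ a b, |w.A2 a b - w'.A2 a b| ≤ η

/-- `U` bounds the sizes of the architecture. -/
structure Arch.SizeLe (A : Arch) (U : ℝ) : Prop where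
  one_le : 1 ≤ U
  d : (A.d : ℝ) ≤ U
  dh : (A.dh : ℝ) ≤ U
  dF : (A.dF : ℝ) ≤ U
  h : (A.h : ℝ) ≤ U

variable {L : ℕ} {U e η : ℝ}

/-- Each matrix product costs a power of `U` for its inner dimension and further powers for the
entries; the logits move by `2 U⁶ (e + η)`, softmax multiplies by 4 and by the value bound `U³`, and
the sum over heads adds the last factor `U`. -/
theorem abs_mha_sub_le (hU : A.SizeLe U) {w w' : LayerParam A} (hw : w.EntriesLe U)
    (hw' : w'.EntriesLe U) (hη : w.Close w' η) {X X' : Matrix (Fin L) (Fin A.d) ℝ}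
    (hX : ∀ i j, |X i j| ≤ U) (hX' : ∀ i j, |X' i j| ≤ U) (he : ∀ i j, |X i j - X' i j| ≤ e)
    (i : Fin L) (j : Fin A.d) : |mha w X i j - mha w' X' i j| ≤ 9 * U ^ 10 * (e + η) := by
  have hU1 := hU.one_le
  have hU0 : 0 ≤ U := by linarith
  have he0 : 0 ≤ e := (abs_nonneg _).trans (he i j)
  have hη0 : 0 ≤ η := (abs_nonneg _).trans hη.γ1
  have hbd : ∀ {n : ℕ} {Y : Matrix (Fin L) (Fin A.d) ℝ} {W : Matrix (Fin A.d) (Fin n) ℝ},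
      (∀ i j, |Y i j| ≤ U) → (∀ i j, |W i j| ≤ U) → ∀ i j, |(Y * W) i j| ≤ U ^ 3 := by
    intro n Y W hY hW i j
    refine (abs_mul_apply_le hY hW i j).trans ?_
    rw [Fintype.card_fin]
    calc (A.d : ℝ) * (U * U) ≤ U * (U * U) := by gcongr; exact hU.d
      _ = U ^ 3 := by ring
  have hcl : ∀ {n : ℕ} {W W' : Matrix (Fin A.d) (Fin n) ℝ}, (∀ i j, |W i j| ≤ U) →
      (∀ i j, |W i j - W' i j| ≤ η) → ∀ i j, |(X * W) i j - (X' * W') i j| ≤ U ^ 2 * (e + η) := by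
    intro n W W' hW hWW i j
    refine (abs_mul_apply_sub_le hX' hW he hWW i j).trans ?_
    rw [Fintype.card_fin]
    calc (A.d : ℝ) * (e * U + U * η) ≤ U * (e * U + U * η) := by gcongr; exact hU.d
      _ = U ^ 2 * (e + η) := by ring
  have hQK : ∀ r i j, |((X * w.WQ r) * (X * w.WK r).transpose) i j -
      ((X' * w'.WQ r) * (X' * w'.WK r).transpose) i j| ≤ 2 * U ^ 6 * (e + η) := by
    intro r i j
    refine (abs_mul_apply_sub_le (hbd hX' (hw'.WQ r))
      (W := (X * w.WK r).transpose) (W' := (X' * w'.WK r).transpose)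
      (fun j k => hbd hX (hw.WK r) k j) (hcl (hw.WQ r) (hη.WQ r))
      (fun j k => hcl (hw.WK r) (hη.WK r) k j) i j).trans ?_
    rw [Fintype.card_fin]
    calc (A.dh : ℝ) * (U ^ 2 * (e + η) * U ^ 3 + U ^ 3 * (U ^ 2 * (e + η)))
        ≤ U * (U ^ 2 * (e + η) * U ^ 3 + U ^ 3 * (U ^ 2 * (e + η))) := by gcongr; exact hU.dh
      _ = _ := by ring
  rw [mha, mha, Matrix.sum_apply, Matrix.sum_apply, ← Finset.sum_sub_distrib]
  refine (Finset.abs_sum_le_sum_abs _ _).trans ?_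
  have h1 : ∀ r, |attn (X * w.WQ r) (X * w.WK r) (X * w.WV r) i j -
      attn (X' * w'.WQ r) (X' * w'.WK r) (X' * w'.WV r) i j| ≤ 9 * U ^ 9 * (e + η) := by
    intro r
    refine (abs_attn_sub_le (hbd hX (hw.WV r)) (hQK r) (hcl (hw.WV r) (hη.WV r)) i j).trans ?_
    have : U ^ 2 ≤ U ^ 9 := pow_le_pow_right₀ hU1 (by norm_num)
    calc _ = 8 * U ^ 9 * (e + η) + U ^ 2 * (e + η) := by ring
      _ ≤ 8 * U ^ 9 * (e + η) + U ^ 9 * (e + η) := by gcongr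
      _ = _ := by ring
  refine (Finset.sum_le_sum fun r _ => h1 r).trans ?_
  simp only [Finset.sum_const, Finset.card_univ, Fintype.card_fin, nsmul_eq_mul]
  calc (A.h : ℝ) * (9 * U ^ 9 * (e + η)) ≤ U * (9 * U ^ 9 * (e + η)) := by gcongr; exact hU.h
    _ = _ := by ring

theorem abs_ffn_sub_le (hU : A.SizeLe U) {w w' : LayerParam A} (hw : w.EntriesLe U)
    (hw' : w'.EntriesLe U) (hη : w.Close w' η) {Y Y' : Matrix (Fin L) (Fin A.d) ℝ}
    (hY' : ∀ i j, |Y' i j| ≤ 1) (he : ∀ i j, |Y i j - Y' i j| ≤ e)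
    (i : Fin L) (j : Fin A.d) : |ffn w Y i j - ffn w' Y' i j| ≤ 2 * U ^ 4 * (e + η) := by
  have hU1 := hU.one_le
  have hU0 : 0 ≤ U := by linarith
  have he0 : 0 ≤ e := (abs_nonneg _).trans (he i j)
  have hη0 : 0 ≤ η := (abs_nonneg _).trans hη.γ1
  have h1 : ∀ i j, |(Y * w.A1) i j - (Y' * w'.A1) i j| ≤ U ^ 2 * (e + η) := by
    intro i j
    refine (abs_mul_apply_sub_le hY' hw.A1 he hη.A1 i j).trans ?_
    rw [Fintype.card_fin]
    calc (A.d : ℝ) * (e * U + 1 * η) ≤ U * (e * U + U * η) := by gcongr; exact hU.d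
      _ = _ := by ring
  have h2 : ∀ i j, |(Y' * w'.A1) i j| ≤ U ^ 2 := by
    intro i j
    refine (abs_mul_apply_le hY' hw'.A1 i j).trans ?_
    rw [Fintype.card_fin]
    calc (A.d : ℝ) * (1 * U) ≤ U * (1 * U) := by gcongr; exact hU.d
      _ = _ := by ring
  have h3 : ∀ x y : ℝ, |max x 0 - max y 0| ≤ |x - y| := fun x y => by
    simpa using abs_max_sub_max_le_abs x y 0
  refine (abs_mul_apply_sub_le (X := (Y * w.A1).map fun x => max x 0)
    (X' := (Y' * w'.A1).map fun x => max x 0) (a := U ^ 2) ?_ hw.A2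
    (fun i j => (h3 _ _).trans (h1 i j)) hη.A2 i j).trans ?_
  · intro i j
    have := h3 ((Y' * w'.A1) i j) 0
    simp only [max_self, sub_zero] at this
    exact this.trans (h2 i j)
  · rw [Fintype.card_fin]
    calc (A.dF : ℝ) * (U ^ 2 * (e + η) * U + U ^ 2 * η)
        ≤ U * (U ^ 2 * (e + η) * U + U ^ 2 * U * (e + η)) := by
          rw [mul_assoc (U ^ 2)]
          gcongr
          · exact hU.dF
          · nlinarith
          · linarith
      _ = _ := by ring

/-- Bookkeeping of the constant, per unit of `e + η`: attention with skip connection `10 U¹⁰`,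
projection times `2 U`, feed-forward with skip connection `(42 + 21) U¹⁵`, projection times `2 U`
again. -/
theorem abs_layerMap_sub_le (hU : A.SizeLe U) {w w' : LayerParam A} (hw : w.EntriesLe U)
    (hw' : w'.EntriesLe U) (hη : w.Close w' η) {X X' : Matrix (Fin L) (Fin A.d) ℝ}
    (hX : ∀ i j, |X i j| ≤ U) (hX' : ∀ i j, |X' i j| ≤ U) (he : ∀ i j, |X i j - X' i j| ≤ e)
    (i : Fin L) (j : Fin A.d) : |layerMap X w i j - layerMap X' w' i j| ≤ 126 * U ^ 16 * (e + η) := by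
  have hU1 := hU.one_le
  have hU0 : 0 ≤ U := by linarith
  have he0 : 0 ≤ e := (abs_nonneg _).trans (he i j)
  have hη0 : 0 ≤ η := (abs_nonneg _).trans hη.γ1
  have hd : (1 + (A.d : ℝ)) ≤ 2 * U := by linarith [hU.d]
  have hd0 : (0 : ℝ) ≤ 1 + A.d := by positivity
  set s := e + η with hs
  have hs0 : 0 ≤ s := by positivity
  have h1 : ∀ i j, |(mha w X + w.γ1 • X) i j - (mha w' X' + w'.γ1 • X') i j| ≤
      10 * U ^ 10 * s := by
    intro i j
    have h2 := abs_mha_sub_le hU hw hw' hη hX hX' he i j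
    have h3 := abs_mul_sub_mul_le hw'.γ1 (hX i j) hη.γ1 (he i j)
    simp only [Matrix.add_apply, Matrix.smul_apply, smul_eq_mul]
    have h4 : U ^ 1 ≤ U ^ 10 := pow_le_pow_right₀ hU1 (by norm_num)
    have h5 : U * s ≤ U ^ 10 * s := by
      gcongr; simpa using h4
    rw [add_sub_add_comm]
    refine (abs_add_le _ _).trans ?_
    have h6 : η * U + U * e = U * s := by rw [hs]; ring
    linarith
  have h2 : ∀ i j, |layerNorm (mha w X + w.γ1 • X) i j - layerNorm (mha w' X' + w'.γ1 • X') i j| ≤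
      20 * U ^ 11 * s := fun i j => by
    refine (abs_layerNorm_sub_le h1 i j).trans ?_
    calc _ ≤ 2 * U * (10 * U ^ 10 * s) := by gcongr
      _ = _ := by ring
  simp only [layerMap]
  set Y := layerNorm (mha w X + w.γ1 • X) with hY
  set Y' := layerNorm (mha w' X' + w'.γ1 • X') with hY'
  have hb : ∀ i j, |Y i j| ≤ 1 := fun i j => abs_layerNorm_apply_le_one i j
  have hb' : ∀ i j, |Y' i j| ≤ 1 := fun i j => abs_layerNorm_apply_le_one i j
  have hηs : η ≤ U ^ 11 * s := by
    have : 1 ≤ U ^ 11 := one_le_pow₀ hU1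
    nlinarith
  have h3 : ∀ i j, |(ffn w Y + w.γ2 • Y) i j - (ffn w' Y' + w'.γ2 • Y') i j| ≤
      63 * U ^ 15 * s := by
    intro i j
    have h4 := abs_ffn_sub_le hU hw hw' hη hb' h2 i j
    have h5 := abs_mul_sub_mul_le hw'.γ2 (hb i j) hη.γ2 (h2 i j)
    simp only [Matrix.add_apply, Matrix.smul_apply, smul_eq_mul]
    rw [add_sub_add_comm]
    refine (abs_add_le _ _).trans ?_
    have h6 : 2 * U ^ 4 * (20 * U ^ 11 * s + η) ≤ 2 * U ^ 4 * (20 * U ^ 11 * s + U ^ 11 * s) := by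
      gcongr
    have h7 : η * 1 + U * (20 * U ^ 11 * s) ≤ 21 * U ^ 12 * s := by
      have : U ^ 11 * s ≤ U ^ 12 * s := by
        gcongr
        norm_num
      nlinarith
    have h8 : 21 * U ^ 12 * s ≤ 21 * U ^ 15 * s := by
      gcongr
      norm_num
    nlinarith
  refine (abs_layerNorm_sub_le h3 i j).trans ?_
  calc _ ≤ 2 * U * (63 * U ^ 15 * s) := by gcongr
    _ = _ := by ring

theorem abs_layerMap_le_one {X : Matrix (Fin L) (Fin A.d) ℝ} {w : LayerParam A} (i : Fin L)
    (j : Fin A.d) : |layerMap X w i j| ≤ 1 :=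
  abs_layerNorm_apply_le_one i j

/-- Layer outputs lie in the unit ball, so the same one-layer bound applies at every depth. Listing
the layers in pairs lets one induction run both networks; 127 instead of 126 absorbs the fresh `η`
of each layer. -/
theorem abs_foldl_layerMap_sub_le (hU : A.SizeLe U) (hη0 : 0 ≤ η)
    (ls : List (LayerParam A × LayerParam A))
    (hls : ∀ p ∈ ls, p.1.EntriesLe U ∧ p.2.EntriesLe U ∧ p.1.Close p.2 η) (he0 : 0 ≤ e)
    {X X' : Matrix (Fin L) (Fin A.d) ℝ} (hX : ∀ i j, |X i j| ≤ U) (hX' : ∀ i j, |X' i j| ≤ U)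
    (he : ∀ i j, |X i j - X' i j| ≤ e) (i : Fin L) (j : Fin A.d) :
    |(ls.map Prod.fst).foldl layerMap X i j - (ls.map Prod.snd).foldl layerMap X' i j| ≤
      (127 * U ^ 16) ^ ls.length * (e + η) := by
  have hU1 := hU.one_le
  have hU16 : 1 ≤ U ^ 16 := one_le_pow₀ hU1
  induction ls generalizing X X' e with
  | nil =>
    simp only [List.map_nil, List.foldl_nil, List.length_nil, pow_zero, one_mul]
    linarith [he i j]
  | cons p ls ih =>
    obtain ⟨h1, h2, h3⟩ := hls p (by simp)
    simp only [List.map_cons, List.foldl_cons, List.length_cons]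
    refine (ih (fun q hq => hls q (by simp [hq])) (e := 126 * U ^ 16 * (e + η)) (by positivity)
      (fun i j => (abs_layerMap_le_one i j).trans hU1)
      (fun i j => (abs_layerMap_le_one i j).trans hU1)
      (abs_layerMap_sub_le hU h1 h2 h3 hX hX' he)).trans ?_
    have h4 : 126 * U ^ 16 * (e + η) + η ≤ 127 * U ^ 16 * (e + η) := by
      nlinarith [mul_nonneg (sub_nonneg.2 hU16) he0, mul_nonneg (sub_nonneg.2 hU16) hη0]
    rw [pow_succ (127 * U ^ 16), mul_assoc ((127 * U ^ 16) ^ ls.length)]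
    exact mul_le_mul_of_nonneg_left h4 (by positivity)

end Layers

/-! ### Output probabilities: lower bound and dependence on the parameters. -/

section Output

variable {A : Arch} {𝔛 : Type*} [Fintype 𝔛]

theorem transformer_pos (emb : 𝔛 → EuclideanSpace ℝ (Fin A.d)) (θ : Param A 𝔛) (S : List 𝔛)
    (x : 𝔛) : 0 < transformer emb θ S x := by
  rw [transformer]
  exact softmax_pos _ x

theorem sum_transformer [Nonempty 𝔛] (emb : 𝔛 → EuclideanSpace ℝ (Fin A.d)) (θ : Param A 𝔛)
    (S : List 𝔛) : ∑ x, transformer emb θ S x = 1 :=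
  sum_softmax _

theorem abs_average_le {L : ℕ} {v : Fin L → ℝ} {b τ : ℝ} (hb0 : 0 ≤ b) (hb : ∀ i, |v i| ≤ b)
    (hτ : 0 < τ) : |(∑ i, v i) / (L * τ)| ≤ b / τ := by
  rcases Nat.eq_zero_or_pos L with rfl | hL
  -- For the empty sequence the division by `L = 0` gives `0`.
  · simp; positivity
  have hL' : (0 : ℝ) < L := by exact_mod_cast hL
  rw [abs_div, abs_of_pos (mul_pos hL' hτ), div_le_div_iff₀ (mul_pos hL' hτ) hτ]
  have h := (Finset.abs_sum_le_sum_abs v Finset.univ).trans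
    (Finset.sum_le_sum fun i _ => hb i)
  simp only [Finset.sum_const, Finset.card_univ, Fintype.card_fin, nsmul_eq_mul] at h
  calc _ ≤ (L * b) * τ := mul_le_mul_of_nonneg_right h hτ.le
    _ = _ := by ring

/-- The output probabilities are bounded below in terms of `B_A / τ` only. -/
theorem le_transformer (emb : 𝔛 → EuclideanSpace ℝ (Fin A.d)) {θ : Param A 𝔛}
    (hθ : θ ∈ paramSet A 𝔛) (S : List 𝔛) (x : 𝔛) :
    Real.exp (-(2 * (A.BA / A.τ))) / Fintype.card 𝔛 ≤ transformer emb θ S x := by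
  rw [transformer]
  refine le_softmax (fun x => ?_) x
  have hBA : 0 ≤ A.BA := by linarith [A.one_le_BA]
  refine abs_average_le hBA (fun i => ?_) A.τ_pos
  -- There is at least one layer and the last one ends with a projection, so rows have norm at most
  -- 1. Cauchy–Schwarz against a column of `Aout` bounds the logits regardless of all other weights.
  obtain ⟨ls, w, hw⟩ : ∃ ls w, List.ofFn θ.layer = ls ++ [w] := by
    have hne : List.ofFn θ.layer ≠ [] := by
      have := A.D_pos
      intro h
      have h2 := congrArg List.length h
      simp at h2
      omega
    exact ⟨_, _, (List.dropLast_append_getLast hne).symm⟩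
  rw [hw, List.foldl_append, List.foldl_cons, List.foldl_nil, Matrix.mul_apply]
  set Y := layerMap _ w with hY
  have h1 : ∑ k, Y i k ^ 2 ≤ 1 := sum_sq_layerNorm_le i
  have h2 : ∑ k, θ.Aout k x ^ 2 ≤ A.BA ^ 2 := by
    have h3 := hθ.1
    rw [normT12, Real.sqrt_le_left hBA] at h3
    refine (Finset.sum_le_sum fun k _ => ?_).trans h3
    rw [← sq_abs]
    exact pow_le_pow_left₀ (abs_nonneg _)
      (Finset.single_le_sum (f := fun x => |θ.Aout k x|) (fun _ _ => abs_nonneg _)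
        (Finset.mem_univ x)) 2
  refine abs_le_of_sq_le_sq ?_ hBA
  calc _ ≤ (∑ k, Y i k ^ 2) * ∑ k, θ.Aout k x ^ 2 := Finset.sum_mul_sq_le_sq_mul_sq _ _ _
    _ ≤ 1 * A.BA ^ 2 := mul_le_mul h1 h2 (Finset.sum_nonneg fun _ _ => sq_nonneg _) one_pos.le
    _ = _ := one_mul _

/-- Entrywise close parameters have close log-probabilities. -/
theorem abs_log_transformer_sub_le {U η : ℝ} (hU : A.SizeLe U) (hη0 : 0 ≤ η) (hτ : 1 / A.τ ≤ U)
    {emb : 𝔛 → EuclideanSpace ℝ (Fin A.d)} (hemb : ∀ x, ‖emb x‖ ≤ U) {θ θ' : Param A 𝔛}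
    (hθ : ∀ t, (θ.layer t).EntriesLe U) (hθ' : ∀ t, (θ'.layer t).EntriesLe U)
    (hA : ∀ i j, |θ.Aout i j| ≤ U) (hl : ∀ t, (θ.layer t).Close (θ'.layer t) η)
    (hAη : ∀ i j, |θ.Aout i j - θ'.Aout i j| ≤ η) (S : List 𝔛) (x : 𝔛) :
    |Real.log (transformer emb θ S x) - Real.log (transformer emb θ' S x)| ≤
      4 * U ^ 3 * (127 * U ^ 16) ^ A.D * η := by
  have hU1 := hU.one_le
  have hU0 : 0 ≤ U := by linarith
  have hK : 1 ≤ (127 * U ^ 16) ^ A.D := one_le_pow₀ (by linarith [one_le_pow₀ hU1 (n := 16)])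
  set X0 : Matrix (Fin S.length) (Fin A.d) ℝ := Matrix.of fun i j => emb (S.get i) j with hX0
  have hX : ∀ i j, |X0 i j| ≤ U := fun i j => by
    have := PiLp.norm_apply_le (emb (S.get i)) j
    rw [Real.norm_eq_abs] at this
    exact this.trans (hemb _)
  have hfold : ∀ i j, |(List.ofFn θ.layer).foldl layerMap X0 i j -
      (List.ofFn θ'.layer).foldl layerMap X0 i j| ≤ (127 * U ^ 16) ^ A.D * η := by
    intro i j
    have h := abs_foldl_layerMap_sub_le (e := 0) hU hη0
      (List.ofFn fun t => (θ.layer t, θ'.layer t)) (by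
        intro p hp
        obtain ⟨t, rfl⟩ := List.mem_ofFn.1 hp
        exact ⟨hθ t, hθ' t, hl t⟩) le_rfl hX hX (by simp) i j
    simpa [List.map_ofFn, Function.comp_def] using h
  have hbd : ∀ i j, |(List.ofFn θ'.layer).foldl layerMap X0 i j| ≤ U := by
    have : ∀ (ls : List (LayerParam A)) (X : Matrix (Fin S.length) (Fin A.d) ℝ),
        (∀ i j, |X i j| ≤ U) → ∀ i j, |ls.foldl layerMap X i j| ≤ U := by
      intro ls
      induction ls with
      | nil => exact fun X hX => hX
      | cons w ls ih => exact fun X hX => ih _ fun i j => (abs_layerMap_le_one i j).trans hU1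
    exact this _ _ hX
  have hlog : ∀ x, |(∑ i, ((List.ofFn θ.layer).foldl layerMap X0 * θ.Aout) i x) /
        (S.length * A.τ) -
      (∑ i, ((List.ofFn θ'.layer).foldl layerMap X0 * θ'.Aout) i x) / (S.length * A.τ)| ≤
      2 * U ^ 3 * (127 * U ^ 16) ^ A.D * η := by
    intro x
    rw [← sub_div, ← Finset.sum_sub_distrib]
    have hb : ∀ i, |((List.ofFn θ.layer).foldl layerMap X0 * θ.Aout) i x -
        ((List.ofFn θ'.layer).foldl layerMap X0 * θ'.Aout) i x| ≤
        2 * U ^ 2 * (127 * U ^ 16) ^ A.D * η := by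
      intro i
      refine (abs_mul_apply_sub_le hbd hA hfold hAη i x).trans ?_
      rw [Fintype.card_fin]
      calc (A.d : ℝ) * ((127 * U ^ 16) ^ A.D * η * U + U * η)
          ≤ U * ((127 * U ^ 16) ^ A.D * η * U + U * ((127 * U ^ 16) ^ A.D * η)) := by
            gcongr
            · exact hU.d
            · nlinarith
        _ = _ := by ring
    refine (abs_average_le (by positivity) hb A.τ_pos).trans ?_
    rw [div_eq_mul_one_div]
    calc _ ≤ 2 * U ^ 2 * (127 * U ^ 16) ^ A.D * η * U := by gcongr
      _ = _ := by ring
  refine (abs_log_softmax_sub_le hlog x).trans (le_of_eq ?_)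
  ring

end Output

/-! ### A finite net of the parameter set -/

theorem exists_grid {U η : ℝ} (hU : 0 < U) (hη : 0 < η) :
    ∃ n : ℕ, 0 < n ∧ (n : ℝ) ≤ 2 * U / η + 1 ∧ ∃ v : Fin n → ℝ, (∀ k, |v k| ≤ U) ∧
      ∀ x, |x| ≤ U → ∃ k, |x - v k| ≤ η := by
  refine ⟨⌊2 * U / η⌋₊ + 1, Nat.succ_pos _, ?_, fun k => -U + k * η, fun k => ?_, fun x hx => ?_⟩
  · push_cast
    have := Nat.floor_le (by positivity : 0 ≤ 2 * U / η)
    linarith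
  · have h1 : ((k : ℕ) : ℝ) ≤ 2 * U / η :=
      (Nat.le_floor_iff (by positivity)).1 (Nat.lt_succ_iff.1 k.2)
    rw [le_div_iff₀ hη] at h1
    have h2 : 0 ≤ ((k : ℕ) : ℝ) * η := by positivity
    exact abs_le.2 ⟨by linarith, by linarith⟩
  · obtain ⟨h1, h2⟩ := abs_le.1 hx
    have h3 : 0 ≤ (x + U) / η := div_nonneg (by linarith) hη.le
    refine ⟨⟨⌊(x + U) / η⌋₊, Nat.lt_succ_of_le (Nat.floor_le_floor ?_)⟩, ?_⟩
    · gcongr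
      linarith
    · have h4 := Nat.floor_le h3
      have h5 := (Nat.lt_floor_add_one ((x + U) / η)).le
      rw [le_div_iff₀ hη] at h4
      rw [div_le_iff₀ hη] at h5
      exact abs_le.2 ⟨by simp only; linarith, by simp only; linarith⟩

section Net

variable {A : Arch} {𝔛 : Type*} [Fintype 𝔛]

/-- Parameters whose entries are taken from a set indexed by `F`. -/
abbrev ParamCode (A : Arch) (𝔛 F : Type*) :=
  (Fin A.D → F × F × (Fin A.h → Fin A.d → Fin A.dh → F) × (Fin A.h → Fin A.d → Fin A.dh → F) ×
    (Fin A.h → Fin A.d → Fin A.d → F) × (Fin A.d → Fin A.dF → F) × (Fin A.dF → Fin A.d → F)) ×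
  (Fin A.d → 𝔛 → F)

/-- The parameters with a given code. -/
def ParamCode.decode {F : Type*} (v : F → ℝ) (g : ParamCode A 𝔛 F) : Param A 𝔛 where
  layer t :=
    { γ1 := v (g.1 t).1
      γ2 := v (g.1 t).2.1
      WQ := fun i a b => v ((g.1 t).2.2.1 i a b)
      WK := fun i a b => v ((g.1 t).2.2.2.1 i a b)
      WV := fun i a b => v ((g.1 t).2.2.2.2.1 i a b)
      A1 := fun a b => v ((g.1 t).2.2.2.2.2.1 a b)
      A2 := fun a b => v ((g.1 t).2.2.2.2.2.2 a b) }
  Aout := fun a b => v (g.2 a b)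

/-- The number of scalar parameters. -/
def numParams (A : Arch) (dy : ℕ) : ℕ :=
  A.D * (2 + 2 * (A.h * A.d * A.dh) + A.h * A.d * A.d + 2 * (A.d * A.dF)) + A.d * dy

set_option synthInstance.maxHeartbeats 400000 in
set_option synthInstance.maxSize 2000 in
theorem card_paramCode (n : ℕ) [DecidableEq 𝔛] :
    Fintype.card (ParamCode A 𝔛 (Fin n)) = n ^ numParams A (Fintype.card 𝔛) := by
  simp only [Fintype.card_prod, Fintype.card_pi, Fintype.card_fin, Finset.prod_const,
    Finset.card_univ, numParams]
  ring

theorem abs_le_frob {m n : Type*} [Fintype m] [Fintype n] (M : Matrix m n ℝ) (i : m) (j : n) :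
    |M i j| ≤ frob M := by
  refine Real.le_sqrt_of_sq_le ?_
  rw [sq_abs]
  exact (Finset.single_le_sum (f := fun j => M i j ^ 2) (fun _ _ => sq_nonneg _)
    (Finset.mem_univ j)).trans (Finset.single_le_sum (f := fun i => ∑ j, M i j ^ 2)
      (fun _ _ => Finset.sum_nonneg fun _ _ => sq_nonneg _) (Finset.mem_univ i))

theorem abs_le_normT12 {m n : Type*} [Fintype m] [Fintype n] (M : Matrix m n ℝ) (i : m) (j : n) :
    |M i j| ≤ normT12 M := by
  refine Real.le_sqrt_of_sq_le ?_
  refine (pow_le_pow_left₀ (abs_nonneg _) (Finset.single_le_sum (f := fun j => |M i j|)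
    (fun _ _ => abs_nonneg _) (Finset.mem_univ j)) 2).trans ?_
  exact Finset.single_le_sum (f := fun i => (∑ j, |M i j|) ^ 2) (fun _ _ => sq_nonneg _)
    (Finset.mem_univ i)

theorem entriesLe_of_mem_paramSet {θ : Param A 𝔛} (hθ : θ ∈ paramSet A 𝔛) {U : ℝ} (h1 : 1 ≤ U)
    (hA1 : A.BA1 ≤ U) (hA2 : A.BA2 ≤ U) (hQ : A.BQ ≤ U) (hK : A.BK ≤ U) (hV : A.BV ≤ U)
    (t : Fin A.D) : (θ.layer t).EntriesLe U where
  γ1 := (hθ.2 t).1.trans h1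
  γ2 := (hθ.2 t).2.1.trans h1
  WQ i a b := (abs_le_frob _ a b).trans (((hθ.2 t).2.2.2.2 i).1.trans hQ)
  WK i a b := (abs_le_frob _ a b).trans (((hθ.2 t).2.2.2.2 i).2.1.trans hK)
  WV i a b := (abs_le_frob _ a b).trans (((hθ.2 t).2.2.2.2 i).2.2.trans hV)
  A1 a b := (abs_le_frob _ a b).trans ((hθ.2 t).2.2.1.trans hA1)
  A2 a b := (abs_le_frob _ a b).trans ((hθ.2 t).2.2.2.1.trans hA2)

/-- Parameters coded by a grid of mesh `η` form a net of the parameter set. -/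
theorem exists_abs_log_transformer_sub_decode_le {U η : ℝ} (hU : A.SizeLe U) (hη : 0 ≤ η)
    (hτ : 1 / A.τ ≤ U) (hA : A.BA ≤ U) (hA1 : A.BA1 ≤ U) (hA2 : A.BA2 ≤ U) (hQ : A.BQ ≤ U)
    (hK : A.BK ≤ U) (hV : A.BV ≤ U) {emb : 𝔛 → EuclideanSpace ℝ (Fin A.d)}
    (hemb : ∀ x, ‖emb x‖ ≤ U) {F : Type*} {v : F → ℝ} (hv : ∀ k, |v k| ≤ U)
    (hvη : ∀ x, |x| ≤ U → ∃ k, |x - v k| ≤ η) {θ : Param A 𝔛} (hθ : θ ∈ paramSet A 𝔛) :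
    ∃ g : ParamCode A 𝔛 F, ∀ S x,
      |Real.log (transformer emb θ S x) - Real.log (transformer emb (g.decode v) S x)| ≤
        4 * U ^ 3 * (127 * U ^ 16) ^ A.D * η := by
  classical
  -- A total rounding map, arbitrary outside `[-U, U]`.
  have hF : ∀ x, ∃ k, |x| ≤ U → |x - v k| ≤ η := fun x => by
    by_cases hx : |x| ≤ U
    · obtain ⟨k, hk⟩ := hvη x hx
      exact ⟨k, fun _ => hk⟩
    · obtain ⟨k, -⟩ := hvη 0 (by simpa using (by linarith [hU.one_le] : (0 : ℝ) ≤ U))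
      exact ⟨k, fun h => absurd h hx⟩
  choose r hr using hF
  have hl := entriesLe_of_mem_paramSet hθ hU.one_le hA1 hA2 hQ hK hV
  have hAout : ∀ i j, |θ.Aout i j| ≤ U := fun i j =>
    (abs_le_normT12 _ i j).trans (hθ.1.trans hA)
  -- The rounded parameter may violate the norm constraints of Θ. This is harmless: net points only
  -- have to be positive probability kernels.
  let g : ParamCode A 𝔛 F := (fun t => (r (θ.layer t).γ1, r (θ.layer t).γ2,
    fun i a b => r ((θ.layer t).WQ i a b), fun i a b => r ((θ.layer t).WK i a b),
    fun i a b => r ((θ.layer t).WV i a b), fun a b => r ((θ.layer t).A1 a b),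
    fun a b => r ((θ.layer t).A2 a b)), fun a b => r (θ.Aout a b))
  refine ⟨g, fun S x => abs_log_transformer_sub_le hU hη hτ hemb hl (fun t => ?_) hAout
    (fun t => ?_) (fun i j => hr _ (hAout i j)) S x⟩
  · exact ⟨hv _, hv _, fun _ _ _ => hv _, fun _ _ _ => hv _, fun _ _ _ => hv _, fun _ _ => hv _,
      fun _ _ => hv _⟩
  · exact ⟨hr _ (hl t).γ1, hr _ (hl t).γ2, fun i a b => hr _ ((hl t).WQ i a b),
      fun i a b => hr _ ((hl t).WK i a b), fun i a b => hr _ ((hl t).WV i a b),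
      fun a b => hr _ ((hl t).A1 a b), fun a b => hr _ ((hl t).A2 a b)⟩

end Net

/-! ### Log-cardinality of the net against the complexity term. -/

section Entropy

theorem one_le_prod_and_le_prod {l : List ℝ} (hl : ∀ a ∈ l, 1 ≤ a) :
    1 ≤ l.prod ∧ ∀ a ∈ l, a ≤ l.prod := by
  induction l with
  | nil => simp
  | cons b l ih =>
    obtain ⟨h1, h2⟩ := ih fun a ha => hl a (by simp [ha])
    have hb : 1 ≤ b := hl b (by simp)
    rw [List.prod_cons]
    refine ⟨one_le_mul_of_one_le_of_one_le hb h1, fun a ha => ?_⟩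
    rcases List.mem_cons.1 ha with rfl | ha
    · exact le_mul_of_one_le_right (by linarith) h1
    · exact (h2 a ha).trans (le_mul_of_one_le_left (by linarith) hb)

/-- `R` is the only factor that may be below 1, and `R ≥ R₀`. This keeps `log (1 + N T B̄)` away
from zero, so additive constants can later be absorbed into it. -/
theorem Bbar_ge {A : Arch} {R₀ : ℝ} (hR : R₀ ≤ A.R) {N T : ℕ} (hN : 0 < N) (hT : 0 < T) :
    R₀ ≤ N * T * Bbar A := by
  have hN1 : (1 : ℝ) ≤ N := by exact_mod_cast hN
  have hT1 : (1 : ℝ) ≤ T := by exact_mod_cast hT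
  have hh1 : (1 : ℝ) ≤ A.h := by exact_mod_cast A.h_pos
  obtain ⟨hp1, -⟩ := one_le_prod_and_le_prod
    (l := [(N : ℝ), T, A.τ⁻¹, A.h, A.BA, A.BA1, A.BA2, A.BQ, A.BK, A.BV]) (by
      simp only [List.mem_cons, List.not_mem_nil, or_false]
      rintro a (rfl | rfl | rfl | rfl | rfl | rfl | rfl | rfl | rfl | rfl)
      exacts [hN1, hT1, (one_le_inv₀ A.τ_pos).2 A.τ_le, hh1, A.one_le_BA, A.one_le_BA1,
        A.one_le_BA2, A.one_le_BQ, A.one_le_BK, A.one_le_BV])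
  refine hR.trans ((le_mul_of_one_le_right A.R_pos.le hp1).trans (le_of_eq ?_))
  simp only [Bbar, List.prod_cons, List.prod_nil]
  ring

/-- A number that dominates all sizes and weights of the architecture and the sample size. -/
def sizeBound (A : Arch) (N : ℕ) : ℝ :=
  1 + A.R + N + A.h + A.τ⁻¹ + (A.BA + A.BA1 + A.BA2 + A.BQ + A.BK + A.BV) + (A.d + A.dh + A.dF)

/-- The weights and `N` are factors of `N T B̄` whose cofactor is at least `R₀`. The dimensions do
not occur in `B̄` and go into an exponential: after taking logarithms they enter linearly and are
paid for by `D̄`. -/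
theorem sizeBound_le {A : Arch} {h₀ : ℕ} {τ₀ R₀ : ℝ} (hτ₀ : 0 < τ₀) (hR₀ : 0 < R₀)
    (hh : A.h ≤ h₀) (hτ : τ₀ ≤ A.τ) (hR : R₀ ≤ A.R) {N T : ℕ} (hN : 0 < N) (hT : 0 < T) :
    sizeBound A N ≤ (5 + h₀ + 1 / τ₀ + 7 / R₀) * (1 + N * T * Bbar A) *
      Real.exp (A.d + A.dh + A.dF) := by
  set l : List ℝ := [(N : ℝ), T, A.τ⁻¹, A.h, A.BA, A.BA1, A.BA2, A.BQ, A.BK, A.BV] with hl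
  have hl1 : ∀ a ∈ l, 1 ≤ a := by
    simp only [hl, List.mem_cons, List.not_mem_nil, or_false]
    rintro a (rfl | rfl | rfl | rfl | rfl | rfl | rfl | rfl | rfl | rfl)
    · exact_mod_cast hN
    · exact_mod_cast hT
    · exact (one_le_inv₀ A.τ_pos).2 A.τ_le
    · exact_mod_cast A.h_pos
    · exact A.one_le_BA
    · exact A.one_le_BA1
    · exact A.one_le_BA2
    · exact A.one_le_BQ
    · exact A.one_le_BK
    · exact A.one_le_BV
  obtain ⟨hp1, hp⟩ := one_le_prod_and_le_prod hl1
  set x := (N : ℝ) * T * Bbar A with hx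
  have hxl : x = A.R * l.prod := by
    simp only [hx, hl, Bbar, List.prod_cons, List.prod_nil]
    ring
  have hR0 : 0 < A.R := A.R_pos
  have hRx : A.R ≤ x := by rw [hxl]; exact le_mul_of_one_le_right hR0.le hp1
  have hx0 : 0 ≤ x := hR0.le.trans hRx
  have hle : ∀ a ∈ l, a ≤ 1 / R₀ * (1 + x) := fun a ha => by
    have h1 : R₀ * a ≤ x := by
      rw [hxl]
      exact mul_le_mul hR (hp a ha) (by linarith [hl1 a ha]) hR0.le
    rw [one_div_mul_eq_div, le_div_iff₀ hR₀]
    linarith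
  set D := (A.d : ℝ) + A.dh + A.dF with hD
  have hD0 : 0 ≤ D := by positivity
  have hE1 : 1 ≤ Real.exp D := Real.one_le_exp hD0
  have hDE : D ≤ Real.exp D := by linarith [Real.add_one_le_exp D]
  have hτ1 : A.τ⁻¹ ≤ 1 / τ₀ := by rw [one_div]; exact inv_anti₀ hτ₀ hτ
  have hh' : (A.h : ℝ) ≤ h₀ := by exact_mod_cast hh
  have hN' := hle N (by simp [hl])
  have e1 := hle A.BA (by simp [hl])
  have e2 := hle A.BA1 (by simp [hl])
  have e3 := hle A.BA2 (by simp [hl])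
  have e4 := hle A.BQ (by simp [hl])
  have e5 := hle A.BK (by simp [hl])
  have e6 := hle A.BV (by simp [hl])
  have hh0 : (0 : ℝ) ≤ h₀ := Nat.cast_nonneg _
  have hτ2 : 0 < 1 / τ₀ := by positivity
  have hR2 : 0 < 1 / R₀ := by positivity
  have key : 1 + A.R + N + A.h + A.τ⁻¹ + (A.BA + A.BA1 + A.BA2 + A.BQ + A.BK + A.BV) ≤
      (4 + h₀ + 1 / τ₀ + 7 * (1 / R₀)) * (1 + x) := by
    have h1 : (h₀ : ℝ) ≤ h₀ * (1 + x) := le_mul_of_one_le_right hh0 (by linarith)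
    have h2 : 1 / τ₀ ≤ 1 / τ₀ * (1 + x) := le_mul_of_one_le_right hτ2.le (by linarith)
    linarith
  have key2 : (4 + h₀ + 1 / τ₀ + 7 * (1 / R₀)) * (1 + x) ≤
      (4 + h₀ + 1 / τ₀ + 7 * (1 / R₀)) * (1 + x) * Real.exp D :=
    le_mul_of_one_le_right (by positivity) hE1
  have key3 : D ≤ (1 + x) * Real.exp D :=
    hDE.trans (le_mul_of_one_le_left (Real.exp_pos _).le (by linarith))
  have : sizeBound A N = 1 + A.R + N + A.h + A.τ⁻¹ +
      (A.BA + A.BA1 + A.BA2 + A.BQ + A.BK + A.BV) + D := rfl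
  rw [this]
  calc _ ≤ (4 + h₀ + 1 / τ₀ + 7 * (1 / R₀)) * (1 + x) * Real.exp D + (1 + x) * Real.exp D := by
        linarith
    _ = _ := by ring

variable {A : Arch} (dy : ℕ)

theorem sizes_le_Dbar : (1 : ℝ) ≤ Dbar A dy ∧ (A.D : ℝ) ≤ Dbar A dy ∧
    (A.D : ℝ) * (A.d + A.dh + A.dF) ≤ Dbar A dy := by
  have h1 : (1 : ℝ) ≤ A.D := by exact_mod_cast A.D_pos
  have h2 : (1 : ℝ) ≤ A.d := by exact_mod_cast A.d_pos
  have h3 : (1 : ℝ) ≤ A.dh := by exact_mod_cast A.dh_pos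
  have h4 : (1 : ℝ) ≤ A.dF := by exact_mod_cast A.dF_pos
  have h5 : (A.D : ℝ) * (A.d + A.dh + A.dF) ≤ Dbar A dy := by
    rw [Dbar]
    have h6 : (A.D : ℝ) ≤ (A.D : ℝ) ^ 2 * A.d := by nlinarith
    have h7 : (0 : ℝ) ≤ A.d * dy := by positivity
    have h8 := mul_le_mul_of_nonneg_right h6 (by positivity : (0 : ℝ) ≤ A.dF + A.dh + A.d)
    linarith
  refine ⟨?_, ?_, h5⟩ <;> nlinarith

theorem numParams_le {h₀ : ℕ} (hh : A.h ≤ h₀) :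
    (numParams A dy : ℝ) ≤ (4 + 2 * h₀) * Dbar A dy := by
  have h1 : (1 : ℝ) ≤ A.D := by exact_mod_cast A.D_pos
  have h2 : (1 : ℝ) ≤ A.d := by exact_mod_cast A.d_pos
  have h4 : (1 : ℝ) ≤ A.dF := by exact_mod_cast A.dF_pos
  have hh' : (A.h : ℝ) ≤ h₀ := by exact_mod_cast hh
  have hdh : (0 : ℝ) ≤ A.dh := Nat.cast_nonneg _
  have hh0 : (0 : ℝ) ≤ h₀ := Nat.cast_nonneg _
  have h5 : (0 : ℝ) ≤ A.d * dy := by positivity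
  have e1 : (A.h : ℝ) * A.d * A.dh ≤ h₀ * A.d * A.dh := by gcongr
  have e2 : (A.h : ℝ) * A.d * A.d ≤ h₀ * A.d * A.d := by gcongr
  have e3 : (1 : ℝ) ≤ A.d * A.dF := one_le_mul_of_one_le_of_one_le h2 h4
  have e4 : (2 : ℝ) + 2 * (A.h * A.d * A.dh) + A.h * A.d * A.d + 2 * (A.d * A.dF) ≤
      (4 + 2 * h₀) * (A.d * (A.dF + A.dh + A.d)) := by
    have p1 : (0 : ℝ) ≤ A.d * A.dh := by positivity
    have p2 : (0 : ℝ) ≤ A.d * A.d := by positivity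
    have p3 : (0 : ℝ) ≤ h₀ * (A.d * A.dF) := by positivity
    have p4 : (0 : ℝ) ≤ h₀ * (A.d * A.d) := by positivity
    nlinarith
  have e5 : (A.D : ℝ) ≤ (A.D : ℝ) ^ 2 := by nlinarith
  rw [numParams, Dbar]
  push_cast
  have e6 := mul_le_mul e5 e4 (by positivity) (by positivity)
  have e7 : (A.d : ℝ) * dy ≤ (4 + 2 * h₀) * (A.d * dy) :=
    le_mul_of_one_le_left h5 (by linarith)
  calc _ ≤ (A.D : ℝ) ^ 2 * ((4 + 2 * h₀) * (A.d * (A.dF + A.dh + A.d))) +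
        (4 + 2 * h₀) * (A.d * dy) := add_le_add e6 e7
    _ = _ := by ring

/-- The logarithmic size of the net is quadratic in the complexity term of `Δ_pre`. -/
theorem exists_numParams_mul_log_le (dy h₀ : ℕ) {τ₀ R₀ : ℝ} (hτ₀ : 0 < τ₀) (hR₀ : 0 < R₀) :
    ∃ C : ℝ, 0 ≤ C ∧ ∀ A : Arch, A.h ≤ h₀ → τ₀ ≤ A.τ → R₀ ≤ A.R → ∀ N T : ℕ, 0 < N → 0 < T →
      ∀ n : ℕ, 0 < n → (n : ℝ) ≤ 9 * sizeBound A N ^ 5 * (127 * sizeBound A N ^ 16) ^ A.D →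
        numParams A dy * Real.log n ≤
          C * (Dbar A dy * Real.log (1 + N * T * Bbar A)) ^ 2 := by
  set c : ℝ := 5 + h₀ + 1 / τ₀ + 7 / R₀ with hc
  have hc1 : 1 ≤ c := by
    have h1 : 0 < 1 / τ₀ := by positivity
    have h2 : 0 < 7 / R₀ := by positivity
    have h3 : (0 : ℝ) ≤ h₀ := Nat.cast_nonneg _
    linarith
  -- `lam` bounds `Λ` below, so `1 ≤ Λ / lam` can be inserted wherever a term lacks a factor `Λ`.
  set lam := Real.log (1 + R₀) with hlam
  have hlam0 : 0 < lam := Real.log_pos (by linarith)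
  have hlogc : 0 ≤ Real.log c := Real.log_nonneg hc1
  refine ⟨(4 + 2 * h₀) * ((8 + 21 * Real.log c) / lam + 21 + 21 / lam) / lam, by positivity, ?_⟩
  intro A hh hτ hR N T hN hT n hn hnU
  obtain ⟨hD1, hD2, hD3⟩ := sizes_le_Dbar (A := A) dy
  set U := sizeBound A N with hU
  set E := Dbar A dy with hE
  have hx : R₀ ≤ N * T * Bbar A := Bbar_ge hR hN hT
  set x := (N : ℝ) * T * Bbar A with hx'
  have hx0 : 0 < x := hR₀.trans_le hx
  set Λ := Real.log (1 + x) with hΛ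
  have hΛlam : lam ≤ Λ := Real.log_le_log (by linarith) (by linarith)
  have hΛ0 : 0 < Λ := hlam0.trans_le hΛlam
  have hU1 : 1 ≤ U := by
    have := A.R_pos
    have := inv_pos.2 A.τ_pos
    have := A.one_le_BA
    have := A.one_le_BA1
    have := A.one_le_BA2
    have := A.one_le_BQ
    have := A.one_le_BK
    have := A.one_le_BV
    have h1 : (0 : ℝ) ≤ N + A.h + A.d + A.dh + A.dF := by positivity
    rw [hU, sizeBound]
    linarith
  have hU0 : 0 < U := by linarith
  have hlogU : Real.log U ≤ Real.log c + Λ + (A.d + A.dh + A.dF) := by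
    have h1 := Real.log_le_log hU0 (sizeBound_le hτ₀ hR₀ hh hτ hR hN hT)
    rwa [Real.log_mul (by positivity) (Real.exp_pos _).ne', Real.log_exp,
      Real.log_mul (by positivity) (by positivity)] at h1
  have hlogU0 : 0 ≤ Real.log U := Real.log_nonneg hU1
  have hD0 : (1 : ℝ) ≤ A.D := by exact_mod_cast A.D_pos
  have h9 : Real.log 9 ≤ 3 := by
    rw [Real.log_le_iff_le_exp (by norm_num)]
    have h1 := Real.add_one_le_exp (1 : ℝ)
    have h2 : Real.exp 3 = Real.exp 1 ^ 3 := by rw [← Real.exp_nat_mul]; norm_num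
    have h3 := Real.exp_one_gt_d9
    rw [h2]
    calc (9 : ℝ) ≤ 2.7 ^ 3 := by norm_num
      _ ≤ _ := by gcongr; linarith
  have h127 : Real.log 127 ≤ 5 := by
    rw [Real.log_le_iff_le_exp (by norm_num)]
    have h2 : Real.exp 5 = Real.exp 1 ^ 5 := by rw [← Real.exp_nat_mul]; norm_num
    have h3 := Real.exp_one_gt_d9
    rw [h2]
    calc (127 : ℝ) ≤ 2.7 ^ 5 := by norm_num
      _ ≤ _ := by gcongr; linarith
  -- `8 = 3 + 5` from `log 9` and `log 127`, and `21 = 5 + 16` from the exponents of `U`, using `D ≥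
  -- 1`.
  have hlogn : Real.log n ≤ A.D * (8 + 21 * Real.log U) := by
    have h1 := Real.log_le_log (by exact_mod_cast hn) hnU
    rw [Real.log_mul (by positivity) (by positivity), Real.log_mul (by norm_num) (by positivity),
      Real.log_pow, Real.log_pow, Real.log_mul (by norm_num) (by positivity), Real.log_pow] at h1
    push_cast at h1
    nlinarith
  have hlogn0 : 0 ≤ Real.log n := Real.log_natCast_nonneg n
  have hlogn2 : Real.log n ≤ E * Λ * ((8 + 21 * Real.log c) / lam + 21 + 21 / lam) := by
    have h1 : (A.D : ℝ) * (8 + 21 * Real.log U) ≤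
        A.D * (8 + 21 * (Real.log c + Λ + (A.d + A.dh + A.dF))) := by gcongr
    have h2 : (A.D : ℝ) * (8 + 21 * (Real.log c + Λ + (A.d + A.dh + A.dF))) =
        A.D * (8 + 21 * Real.log c) + 21 * (A.D * Λ) + 21 * (A.D * (A.d + A.dh + A.dF)) := by ring
    have h3 : (A.D : ℝ) * (8 + 21 * Real.log c) ≤ E * (8 + 21 * Real.log c) := by gcongr
    have h4 : (A.D : ℝ) * Λ ≤ E * Λ := by gcongr
    have h5 : (1 : ℝ) ≤ Λ / lam := by rwa [one_le_div hlam0]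
    have h6 : E * (8 + 21 * Real.log c) ≤ E * (8 + 21 * Real.log c) * (Λ / lam) :=
      le_mul_of_one_le_right (by positivity) h5
    have h7 : E ≤ E * (Λ / lam) := le_mul_of_one_le_right (by positivity) h5
    have h8 : E * Λ * ((8 + 21 * Real.log c) / lam + 21 + 21 / lam) =
        E * (8 + 21 * Real.log c) * (Λ / lam) + 21 * (E * Λ) + 21 * (E * (Λ / lam)) := by
      field_simp
    linarith
  have hnum := numParams_le (A := A) dy hh
  set k := (8 + 21 * Real.log c) / lam + 21 + 21 / lam with hk
  have hk0 : 0 ≤ k := by positivity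
  have hE0 : 0 < E := by linarith
  -- Both factors are linear in `D̄`, hence the square; a second factor `Λ` is inserted to complete
  -- it.
  calc (numParams A dy : ℝ) * Real.log n ≤ (4 + 2 * h₀) * E * (E * Λ * k) :=
        mul_le_mul hnum hlogn2 hlogn0 (by positivity)
    _ = (4 + 2 * h₀) * k * E ^ 2 * Λ := by ring
    _ ≤ (4 + 2 * h₀) * k * E ^ 2 * Λ * (Λ / lam) :=
        le_mul_of_one_le_right (by positivity) (by rwa [one_le_div hlam0])
    _ = _ := by ring

end Entropy

/-! ### The pretraining error bound -/

section Pretraining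

variable {𝔛 Z : Type*} [Fintype 𝔛] [Fintype Z]

theorem paramSet_nonempty (A : Arch) : (paramSet A 𝔛).Nonempty := by
  have h1 := A.one_le_BA
  have h2 := A.one_le_BA1
  have h3 := A.one_le_BA2
  have h4 := A.one_le_BQ
  have h5 := A.one_le_BK
  have h6 := A.one_le_BV
  refine ⟨⟨fun _ => ⟨0, 0, 0, 0, 0, 0, 0⟩, 0⟩, ?_, fun t => ⟨?_, ?_, ?_, ?_, fun i => ⟨?_, ?_, ?_⟩⟩⟩
  all_goals simp [normT12, frob]
  all_goals linarith

theorem loss_eq {A : Arch} (emb : 𝔛 → EuclideanSpace ℝ (Fin A.d)) {N T : ℕ}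
    (ω : Dataset 𝔛 N T) (θ : Param A 𝔛) :
    loss emb ω θ = -(1 / N) * ∑ n, avgLogLik (transformer emb θ) (ω n) := by
  simp only [loss, avgLogLik, ← Finset.sum_div]
  ring

theorem dataProb_mono (P : Z → List 𝔛 → stdSimplex ℝ 𝔛) (π : stdSimplex ℝ Z) {N T : ℕ}
    {E E' : Set (Dataset 𝔛 N T)} (h : E ⊆ E') : dataProb P π E ≤ dataProb P π E' := by
  classical
  unfold dataProb
  refine Finset.sum_le_sum fun ω _ => ?_
  have h0 := datasetProb_nonneg P π ω
  by_cases h1 : ω ∈ E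
  · rw [if_pos h1, if_pos (h h1)]
  · rw [if_neg h1]
    split_ifs
    exacts [h0, le_rfl]

theorem complexity_nonneg (A : Arch) (dy N T : ℕ) {δ : ℝ} (hδ : 0 < δ) (hδ1 : δ < 1) :
    0 ≤ Dbar A dy * Real.log (1 + N * T * Bbar A) + Real.log (1 / δ) := by
  have hℓ : 0 ≤ Real.log (1 / δ) := Real.log_nonneg (by rw [le_div_iff₀ hδ]; linarith)
  have hB : 0 ≤ Bbar A := by
    have := A.R_pos
    have := A.τ_pos
    have h1 := zero_le_one.trans A.one_le_BA
    have h2 := zero_le_one.trans A.one_le_BA1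
    have h3 := zero_le_one.trans A.one_le_BA2
    have h4 := zero_le_one.trans A.one_le_BQ
    have h5 := zero_le_one.trans A.one_le_BK
    have h6 := zero_le_one.trans A.one_le_BV
    rw [Bbar]
    positivity
  have hΛ : 0 ≤ Real.log (1 + N * T * Bbar A) := Real.log_nonneg (by
    have : 0 ≤ N * T * Bbar A := by positivity
    linarith)
  have := mul_nonneg (zero_le_one.trans (sizes_le_Dbar (A := A) dy).1) hΛ
  linarith

theorem pretrainErr_nonneg (P : Z → List 𝔛 → stdSimplex ℝ 𝔛) (π : stdSimplex ℝ Z) (A : Arch)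
    (emb : 𝔛 → EuclideanSpace ℝ (Fin A.d)) (N T : ℕ) {δ : ℝ} (hδ : 0 < δ) (hδ1 : δ < 1) :
    0 ≤ pretrainErr P π A emb N T δ := by
  have hℓ : 0 ≤ Real.log (1 / δ) := Real.log_nonneg (by rw [le_div_iff₀ hδ]; linarith)
  have h1 := complexity_nonneg A (Fintype.card 𝔛) N T hδ hδ1
  have h2 : 0 ≤ ⨅ θ : paramSet A 𝔛,
      √(pretrainExp P π T fun S => kl (predictive P π S) (transformer emb θ.1 S)) :=
    Real.iInf_nonneg fun _ => Real.sqrt_nonneg _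
  rw [pretrainErr]
  positivity

/-- Here `t_mix ≥ T` pays for treating trajectories as single observations. The fourth-root term of
`Δ_pre` is nonnegative and simply dropped. -/
theorem add_div_sqrt_le_pretrainErr [Nontrivial 𝔛] (P : Z → List 𝔛 → stdSimplex ℝ 𝔛)
    (π : stdSimplex ℝ Z) (z : Z) (A : Arch) (emb : 𝔛 → EuclideanSpace ℝ (Fin A.d)) {N T : ℕ}
    (hT : 0 < T) {δ : ℝ} (hδ : 0 < δ) (hδ1 : δ < 1) :
    (⨅ θ : paramSet A 𝔛,
      √(pretrainExp P π T fun S => kl (predictive P π S) (transformer emb θ.1 S))) +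
      1 / √N * (Dbar A (Fintype.card 𝔛) * Real.log (1 + N * T * Bbar A) + Real.log (1 / δ)) ≤
    pretrainErr P π A emb N T δ := by
  have hT' : (0 : ℝ) < T := by exact_mod_cast hT
  have hℓ : 0 ≤ Real.log (1 / δ) := Real.log_nonneg (by rw [le_div_iff₀ hδ]; linarith)
  have h1 : 1 / √N ≤ √(mixTime P T) / √((N : ℝ) * T) := by
    have h2 : (T : ℝ) ≤ mixTime P T := by exact_mod_cast le_mixTime P z T
    rw [Real.sqrt_mul (Nat.cast_nonneg N)]
    rcases Nat.eq_zero_or_pos N with rfl | hN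
    · simp
    have hN' : 0 < √(N : ℝ) := Real.sqrt_pos.2 (by exact_mod_cast hN)
    have hT'' : 0 < √(T : ℝ) := Real.sqrt_pos.2 hT'
    rw [div_le_div_iff₀ hN' (mul_pos hN' hT''), one_mul, mul_comm]
    gcongr
  rw [pretrainErr]
  have h2 : 0 ≤ (mixTime P T : ℝ) ^ (1 / 4 : ℝ) * Real.log (1 / δ) /
      ((N : ℝ) * T) ^ (1 / 4 : ℝ) := by positivity
  have h3 := complexity_nonneg A (Fintype.card 𝔛) N T hδ hδ1
  have h4 := mul_le_mul_of_nonneg_right h1 h3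
  linarith

/-- The elementary inequality that balances the terms of the pretraining bound. -/
theorem pretraining_balance {I s W ℓ K Lg m w₀ C₁ Δ : ℝ} (hI : 0 ≤ I) (hs : 0 < s) (hs1 : s ≤ 1)
    (hw₀ : 0 < w₀) (hW : w₀ ≤ W) (hℓ : 0 ≤ ℓ) (hm : 0 < m) (hC₁ : 0 ≤ C₁)
    (hK : K ≤ (I + s) ^ 2) (hLg : Lg ≤ 2 + C₁ * W ^ 2 + 2 * ℓ)
    (hΔ : Δ = I + s * (W + ℓ)) :
    2 * s ^ 2 + ((s ^ 2 + 4 / m * K + 2 * s ^ 2 * Lg) / Δ + 4 * Δ) / 2 ≤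
      (2 / w₀ + (1 / w₀ ^ 2 + 4 / m * (1 + 1 / w₀) ^ 2 + 4 / w₀ ^ 2 + 2 * C₁ + 4 / w₀ + 4) / 2) *
        Δ := by
  have hsW : 0 < s * W := mul_pos hs (hw₀.trans_le hW)
  have hsℓ : 0 ≤ s * ℓ := by positivity
  have hΔ0 : 0 < Δ := by rw [hΔ, mul_add]; linarith
  have hIΔ : I ≤ Δ := by rw [hΔ, mul_add]; linarith
  have hWΔ : s * W ≤ Δ := by rw [hΔ, mul_add]; linarith
  have hℓΔ : s * ℓ ≤ Δ := by rw [hΔ, mul_add]; linarith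
  -- The lower bound `w₀` on the complexity makes the bare statistical scale `s` itself of order
  -- `Δ`; all remaining terms are then quadratic in `Δ` before division by `Δ`.
  have hsΔ : s ≤ Δ / w₀ := by
    rw [le_div_iff₀ hw₀]
    exact (mul_le_mul_of_nonneg_left hW hs.le).trans hWΔ
  have h1 : s ^ 2 ≤ (Δ / w₀) ^ 2 := pow_le_pow_left₀ hs.le hsΔ 2
  have h2 : K ≤ (Δ + Δ / w₀) ^ 2 :=
    hK.trans (pow_le_pow_left₀ (by positivity) (add_le_add hIΔ hsΔ) 2)
  have h3 : s ^ 2 * Lg ≤ 2 * (Δ / w₀) ^ 2 + C₁ * Δ ^ 2 + 2 * (Δ / w₀ * Δ) := by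
    have e1 : (s * W) ^ 2 ≤ Δ ^ 2 := pow_le_pow_left₀ hsW.le hWΔ 2
    have e2 : s * (s * ℓ) ≤ Δ / w₀ * Δ := mul_le_mul hsΔ hℓΔ hsℓ (by positivity)
    calc s ^ 2 * Lg ≤ s ^ 2 * (2 + C₁ * W ^ 2 + 2 * ℓ) := by gcongr
      _ = 2 * s ^ 2 + C₁ * (s * W) ^ 2 + 2 * (s * (s * ℓ)) := by ring
      _ ≤ _ := by gcongr
  have h4 : s ^ 2 + 4 / m * K + 2 * s ^ 2 * Lg ≤
      (1 / w₀ ^ 2 + 4 / m * (1 + 1 / w₀) ^ 2 + 4 / w₀ ^ 2 + 2 * C₁ + 4 / w₀) * Δ * Δ := by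
    calc _ ≤ (Δ / w₀) ^ 2 + 4 / m * (Δ + Δ / w₀) ^ 2 +
          2 * (2 * (Δ / w₀) ^ 2 + C₁ * Δ ^ 2 + 2 * (Δ / w₀ * Δ)) := by
          have := mul_le_mul_of_nonneg_left h2 (by positivity : 0 ≤ 4 / m)
          linarith
      _ = _ := by field_simp; ring
  have h5 : (s ^ 2 + 4 / m * K + 2 * s ^ 2 * Lg) / Δ ≤
      (1 / w₀ ^ 2 + 4 / m * (1 + 1 / w₀) ^ 2 + 4 / w₀ ^ 2 + 2 * C₁ + 4 / w₀) * Δ := by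
    rwa [div_le_iff₀ hΔ0]
  have h6 : 2 * s ^ 2 ≤ 2 / w₀ * Δ := by
    calc 2 * s ^ 2 ≤ 2 * s := by nlinarith
      _ ≤ 2 * (Δ / w₀) := by gcongr
      _ = _ := by ring
  linarith

set_option synthInstance.maxHeartbeats 400000 in
set_option synthInstance.maxSize 2000 in
/-- The expected total variation error of the maximum likelihood estimate is at most a constant
multiple of `Δ_pre`. -/
theorem exists_one_sub_le_dataProb_pretrainErr (𝔛 : Type*) [Fintype 𝔛] [Nontrivial 𝔛]
    (h₀ : ℕ) (B₀ : ℝ) {τ₀ R₀ : ℝ} (hτ₀ : 0 < τ₀) (hR₀ : 0 < R₀) :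
    ∃ C : ℝ, 0 < C ∧ ∀ (A : Arch), A.h ≤ h₀ → A.BA ≤ B₀ → τ₀ ≤ A.τ → R₀ ≤ A.R →
      ∀ emb : 𝔛 → EuclideanSpace ℝ (Fin A.d), (∀ x, ‖emb x‖ ≤ A.R) →
      ∀ {Z : Type*} [Fintype Z] (P : Z → List 𝔛 → stdSimplex ℝ 𝔛) (π : stdSimplex ℝ Z) (_ : Z)
        {c₀ : ℝ}, 0 < c₀ → (∀ z S x, c₀ ≤ P z S x) → ∀ N T : ℕ, 0 < N → 0 < T →
      ∀ δ : ℝ, 0 < δ → δ < 1 →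
        1 - δ ≤ dataProb P π {ω : Dataset 𝔛 N T | ∀ θ, IsMLE emb ω θ →
          (pretrainExp P π T fun S => ∑ x, |predictive P π S x - transformer emb θ S x|) ≤
            C * pretrainErr P π A emb N T δ} := by
  classical
  obtain ⟨C₁, hC₁, hent⟩ := exists_numParams_mul_log_le (Fintype.card 𝔛) h₀ hτ₀ hR₀
  set w₀ := Real.log (1 + R₀) with hw₀
  have hw₀0 : 0 < w₀ := Real.log_pos (by linarith)
  have hdy : (0 : ℝ) < Fintype.card 𝔛 := by exact_mod_cast Fintype.card_pos
  set m := Real.exp (-(2 * (B₀ / τ₀))) / Fintype.card 𝔛 with hm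
  have hm0 : 0 < m := div_pos (Real.exp_pos _) hdy
  refine ⟨2 / w₀ + (1 / w₀ ^ 2 + 4 / m * (1 + 1 / w₀) ^ 2 + 4 / w₀ ^ 2 + 2 * C₁ + 4 / w₀ + 4) / 2,
    by positivity, ?_⟩
  intro A hh hBA hτ hR emb hemb Z _ P π z c₀ hc₀ hP N T hN hT δ hδ hδ1
  have hN' : (0 : ℝ) < N := by exact_mod_cast hN
  have hN1 : (1 : ℝ) ≤ N := by exact_mod_cast hN
  set U := sizeBound A N with hU
  have hUle : A.SizeLe U ∧ 1 / A.τ ≤ U ∧ A.BA ≤ U ∧ A.BA1 ≤ U ∧ A.BA2 ≤ U ∧ A.BQ ≤ U ∧ A.BK ≤ U ∧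
      A.BV ≤ U ∧ A.R ≤ U ∧ (N : ℝ) ≤ U := by
    have r1 := A.R_pos
    have r2 := inv_pos.2 A.τ_pos
    have r3 := A.one_le_BA
    have r4 := A.one_le_BA1
    have r5 := A.one_le_BA2
    have r6 := A.one_le_BQ
    have r7 := A.one_le_BK
    have r8 := A.one_le_BV
    have r9 : (0 : ℝ) ≤ A.h := Nat.cast_nonneg _
    have r10 : (0 : ℝ) ≤ A.d := Nat.cast_nonneg _
    have r11 : (0 : ℝ) ≤ A.dh := Nat.cast_nonneg _
    have r12 : (0 : ℝ) ≤ A.dF := Nat.cast_nonneg _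
    have hUdef : U = 1 + A.R + N + A.h + A.τ⁻¹ +
      (A.BA + A.BA1 + A.BA2 + A.BQ + A.BK + A.BV) + (A.d + A.dh + A.dF) := rfl
    rw [one_div]
    refine ⟨⟨?_, ?_, ?_, ?_, ?_⟩, ?_, ?_, ?_, ?_, ?_, ?_, ?_, ?_, ?_⟩ <;> linarith
  obtain ⟨hUs, hUτ, hUA, hUA1, hUA2, hUQ, hUK, hUV, hUR, hUN⟩ := hUle
  have hU1 := hUs.one_le
  have hU0 : 0 < U := by linarith
  set κ := 4 * U ^ 3 * (127 * U ^ 16) ^ A.D with hκ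
  have hκ0 : 0 < κ := by positivity
  -- `κ` is the Lipschitz constant of the log-probabilities, so this mesh makes the net accurate to
  -- `1 / N`, the scale of the statistical error.
  set η := 1 / (N * κ) with hη
  have hη0 : 0 < η := by positivity
  obtain ⟨n, hn, hnle, v, hv, hvη⟩ := exists_grid hU0 hη0
  have hn9 : (n : ℝ) ≤ 9 * U ^ 5 * (127 * U ^ 16) ^ A.D := by
    refine hnle.trans ?_
    have h1 : 2 * U / η = 8 * N * U ^ 4 * (127 * U ^ 16) ^ A.D := by
      rw [hη, hκ]; field_simp; ring
    have h2 : 8 * N * U ^ 4 * (127 * U ^ 16) ^ A.D ≤ 8 * U * U ^ 4 * (127 * U ^ 16) ^ A.D := by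
      gcongr
    have h3 : (1 : ℝ) ≤ U ^ 5 * (127 * U ^ 16) ^ A.D :=
      one_le_mul_of_one_le_of_one_le (one_le_pow₀ hU1)
        (one_le_pow₀ (by linarith [one_le_pow₀ hU1 (n := 16)]))
    rw [h1]
    calc _ ≤ 8 * U * U ^ 4 * (127 * U ^ 16) ^ A.D + U ^ 5 * (127 * U ^ 16) ^ A.D :=
          add_le_add h2 h3
      _ = _ := by ring
  have hlogG := hent A hh hτ hR N T hN hT n hn hn9
  set W := Dbar A (Fintype.card 𝔛) * Real.log (1 + N * T * Bbar A) with hW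
  have hWw : w₀ ≤ W := by
    have h1 : w₀ ≤ Real.log (1 + N * T * Bbar A) :=
      Real.log_le_log (by linarith) (by linarith [Bbar_ge hR hN hT])
    exact h1.trans (le_mul_of_one_le_left (hw₀0.le.trans h1)
      (sizes_le_Dbar (A := A) (Fintype.card 𝔛)).1)
  set ℓ := Real.log (1 / δ) with hℓ
  have hℓ0 : 0 ≤ ℓ := Real.log_nonneg (by rw [le_div_iff₀ hδ]; linarith)
  set I := ⨅ θ : paramSet A 𝔛,
    √(pretrainExp P π T fun S => kl (predictive P π S) (transformer emb θ.1 S)) with hI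
  have hI0 : 0 ≤ I := Real.iInf_nonneg fun _ => Real.sqrt_nonneg _
  set s := 1 / √(N : ℝ) with hs
  have hsN : 1 ≤ √(N : ℝ) := Real.one_le_sqrt.2 hN1
  have hs0 : 0 < s := by positivity
  have hs1 : s ≤ 1 := by rw [hs, div_le_one (by linarith)]; exact hsN
  have hs2 : s ^ 2 = 1 / N := by rw [hs, div_pow, one_pow, Real.sq_sqrt hN'.le]
  have : Nonempty (paramSet A 𝔛) := (paramSet_nonempty A).to_subtype
  -- A near-minimiser serves as reference, since attainment of the infimum is not known here; a
  -- slack of `1 / √N` is within the target error.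
  obtain ⟨θs, hθs⟩ := exists_lt_of_ciInf_lt (show I < I + s by linarith)
  set K := pretrainExp P π T fun S => kl (predictive P π S) (transformer emb θs.1 S) with hK
  have hKle : K ≤ (I + s) ^ 2 := ((Real.sqrt_lt' (by linarith)).1 hθs).le
  have hlow : ∀ S x, m ≤ transformer emb θs.1 S x := fun S x => by
    refine le_trans ?_ (le_transformer emb θs.2 S x)
    have h1 : A.BA / A.τ ≤ B₀ / τ₀ :=
      div_le_div₀ (by linarith [A.one_le_BA]) hBA hτ₀ hτ
    rw [hm]
    gcongr
  have : Nonempty (Fin n) := ⟨⟨0, hn⟩⟩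
  have key := one_sub_le_dataProb_sum_abs_sub (N := N) (T := T) π hc₀ hP hN hT
    (G := ParamCode A 𝔛 (Fin n)) (qG := fun g => transformer emb (g.decode v))
    (fun g S x => transformer_pos _ _ _ _) (fun g S => sum_transformer _ _ _) hm0 hlow
    (fun S => sum_transformer _ _ _) hδ (1 / N)
  refine key.trans (dataProb_mono P π fun ω hω θ hθ => ?_)
  have hΔ0 : 0 < I + s * (W + ℓ) := by
    have : 0 < s * (W + ℓ) := mul_pos hs0 (by linarith)
    linarith
  have hlik : ∑ n, avgLogLik (transformer emb θs.1) (ω n) ≤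
      ∑ n, avgLogLik (transformer emb θ) (ω n) := by
    have h1 := hθ.2 _ θs.2
    rw [loss_eq, loss_eq, neg_mul, neg_mul, neg_le_neg_iff] at h1
    exact le_of_mul_le_mul_left h1 (by positivity)
  have hnet : ∃ g : ParamCode A 𝔛 (Fin n), ∀ S, S ≠ [] → ∀ x,
      |Real.log (transformer emb θ S x) - Real.log (transformer emb (g.decode v) S x)| ≤ 1 / N := by
    obtain ⟨g, hg⟩ := exists_abs_log_transformer_sub_decode_le hUs hη0.le hUτ hUA hUA1 hUA2 hUQ hUK
      hUV (fun x => (hemb x).trans hUR) hv hvη hθ.1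
    refine ⟨g, fun S _ x => (hg S x).trans (le_of_eq ?_)⟩
    rw [← hκ, hη]
    field_simp
  -- The free AM-GM weight is set to the target error `I + s (W + ℓ)`, which balances the Hellinger
  -- term against the linear one.
  have h1 := hω (transformer emb θ) (transformer_pos _ _) (sum_transformer _ _) hlik hnet _ hΔ0
  have hLg : Real.log (2 * Fintype.card (ParamCode A 𝔛 (Fin n)) / δ) + Real.log (2 / δ) ≤
      2 + C₁ * W ^ 2 + 2 * ℓ := by
    have hn0 : (0 : ℝ) < n := by exact_mod_cast hn
    have hlog2 : Real.log 2 ≤ 1 := by linarith [Real.log_le_sub_one_of_pos (zero_lt_two (α := ℝ))]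
    rw [card_paramCode, Nat.cast_pow, div_eq_mul_one_div, div_eq_mul_one_div 2 δ,
      Real.log_mul (by positivity) (by positivity), Real.log_mul (by norm_num) (by positivity),
      Real.log_mul (by norm_num) (by positivity), Real.log_pow]
    linarith
  have h2 := pretraining_balance (m := m) (C₁ := C₁) hI0 hs0 hs1 hw₀0 hWw hℓ0 hm0 hC₁ hKle hLg rfl
  have h3 := add_div_sqrt_le_pretrainErr P π z A emb (N := N) hT hδ hδ1
  rw [hs2] at h2
  have e : (2 : ℝ) / N = 2 * (1 / N) := by ring
  rw [e] at h1
  exact (h1.trans h2).trans (mul_le_mul_of_nonneg_left h3 (by positivity))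

end Pretraining

/-! ### Prompts -/

section PromptTokens

variable {𝔛 : Type*} {l : ℕ}

theorem pairsTokens_cons (a : (Fin l → 𝔛) × 𝔛) (S : List ((Fin l → 𝔛) × 𝔛)) :
    pairsTokens (a :: S) = pairTokens a ++ pairsTokens S :=
  List.flatMap_cons

theorem pairsTokens_singleton (a : (Fin l → 𝔛) × 𝔛) : pairsTokens [a] = pairTokens a := by
  simp [pairsTokens]

theorem length_pairTokens (a : (Fin l → 𝔛) × 𝔛) : (pairTokens a).length = l + 1 := by
  simp [pairTokens]

theorem length_pairsTokens (S : List ((Fin l → 𝔛) × 𝔛)) :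
    (pairsTokens S).length = S.length * (l + 1) := by
  induction S with
  | nil => simp [pairsTokens]
  | cons a S ih =>
    rw [pairsTokens_cons, List.length_append, ih, length_pairTokens, List.length_cons]
    ring

theorem pairTokens_injective : Function.Injective (pairTokens (𝔛 := 𝔛) (l := l)) := by
  rintro ⟨c, r⟩ ⟨c', r'⟩ h
  obtain ⟨h1, h2⟩ := List.append_inj h (by simp)
  have h3 : c = c' := List.ofFn_injective h1
  have h4 : r = r' := by simpa using h2
  rw [h3, h4]

theorem pairsTokens_append_inj {S S' : List ((Fin l → 𝔛) × 𝔛)} {c c' : List 𝔛}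
    (hlen : S.length = S'.length) (h : pairsTokens S ++ c = pairsTokens S' ++ c') :
    S = S' ∧ c = c' := by
  induction S generalizing S' with
  | nil =>
    obtain rfl : S' = [] := List.length_eq_zero_iff.1 hlen.symm
    exact ⟨rfl, by simpa [pairsTokens] using h⟩
  | cons a S ih =>
    cases S' with
    | nil => simp at hlen
    | cons a' S' =>
      rw [pairsTokens_cons, pairsTokens_cons, List.append_assoc, List.append_assoc] at h
      obtain ⟨h1, h2⟩ := List.append_inj h (by simp [length_pairTokens])
      obtain ⟨h3, h4⟩ := ih (by simpa using hlen) h2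
      exact ⟨by rw [pairTokens_injective h1, h3], h4⟩

variable {t : ℕ}

theorem length_promptTokens (p : Prompt 𝔛 l t) :
    (promptTokens p).length = t * (l + 1) + l := by
  simp [promptTokens, length_pairsTokens, queryTokens]

/-- With `l` and `t` fixed the token string can be cut back into examples. A sum over prompts is
therefore part of a sum over strings, without multiplicities. -/
theorem promptTokens_injective : Function.Injective (promptTokens (𝔛 := 𝔛) (l := l) (t := t)) := by
  rintro ⟨c, r⟩ ⟨c', r'⟩ h
  obtain ⟨h1, h2⟩ := pairsTokens_append_inj (by simp) h
  have h3 := List.ofFn_injective h1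
  have h4 : c (Fin.last t) = c' (Fin.last t) := List.ofFn_injective h2
  simp only [funext_iff, Prod.mk.injEq] at h3
  refine Prod.ext (funext fun i => ?_) (funext fun i => (h3 i).2)
  refine Fin.lastCases h4 (fun i => funext fun j => (h3 i).1 j) i

end PromptTokens

/-! ### Change of measure from prompts to the pretraining distribution. -/

section Coverage

variable {𝔛 Z : Type*} [Fintype 𝔛] [Fintype Z] {l t : ℕ}

/-- All prompts share one length, so the left side is part of a single summand of the average over
`t`; if that length is outside `1, …, T`, the left side vanishes. -/
theorem sum_pretrainProb_promptTokens_le (P : Z → List 𝔛 → stdSimplex ℝ 𝔛) (π : stdSimplex ℝ Z)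
    (T : ℕ) {F : List 𝔛 → ℝ} (hF : ∀ S, 0 ≤ F S) :
    ∑ p : Prompt 𝔛 l t, pretrainProb P π T (promptTokens p) * F (promptTokens p) ≤
      pretrainExp P π T F := by
  classical
  by_cases hn : 1 ≤ t * (l + 1) + l ∧ t * (l + 1) + l ≤ T
  · set n := t * (l + 1) + l with hn'
    have hG : ∀ S, 0 ≤ margProb P π S * F S := fun S => mul_nonneg (margProb_nonneg P π S) (hF S)
    have h1 : ∑ p : Prompt 𝔛 l t, margProb P π (promptTokens p) * F (promptTokens p) ≤
        ∑ s : Fin n → 𝔛, margProb P π (List.ofFn s) * F (List.ofFn s) := by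
      rw [← Finset.sum_image (f := fun S => margProb P π S * F S) (g := promptTokens)
          fun a _ b _ h => promptTokens_injective h,
        ← Finset.sum_image (f := fun S => margProb P π S * F S)
          (g := fun s : Fin n → 𝔛 => List.ofFn s) fun a _ b _ h => List.ofFn_injective h]
      refine Finset.sum_le_sum_of_subset_of_nonneg (fun S hS => ?_) fun S _ _ => hG S
      obtain ⟨p, -, rfl⟩ := Finset.mem_image.1 hS
      refine Finset.mem_image.2 ⟨fun i => (promptTokens p).get
        (i.cast (length_promptTokens p).symm), Finset.mem_univ _, ?_⟩
      refine List.ext_get (by simp [length_promptTokens, hn']) fun i h1 h2 => ?_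
      simp
    have h2 : ∀ p : Prompt 𝔛 l t, pretrainProb P π T (promptTokens p) * F (promptTokens p) =
        margProb P π (promptTokens p) * F (promptTokens p) / T := fun p => by
      rw [pretrainProb, length_promptTokens, if_pos hn]
      ring
    simp only [h2, ← Finset.sum_div]
    refine div_le_div_of_nonneg_right (h1.trans ?_) (Nat.cast_nonneg T)
    exact Finset.single_le_sum
      (f := fun t => ∑ s : Fin t → 𝔛, margProb P π (List.ofFn s) * F (List.ofFn s))
      (fun t _ => Finset.sum_nonneg fun s _ => hG _) (Finset.mem_Icc.2 hn)
  · refine (Finset.sum_nonpos fun p _ => ?_).trans (pretrainExp_nonneg P π T fun S _ => hF S)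
    rw [pretrainProb, length_promptTokens, if_neg hn, zero_mul]

theorem pretrainProb_nonneg (P : Z → List 𝔛 → stdSimplex ℝ 𝔛) (π : stdSimplex ℝ Z) (T : ℕ)
    (S : List 𝔛) : 0 ≤ pretrainProb P π T S := by
  have := margProb_nonneg P π S
  rw [pretrainProb]
  split_ifs <;> positivity

theorem coverage_nonneg {P : Z → List 𝔛 → stdSimplex ℝ 𝔛} {π : stdSimplex ℝ Z} {T : ℕ}
    {Q : stdSimplex ℝ (Prompt 𝔛 l t)} {κ : ℝ}
    (hκ : ∀ p, Q p ≤ κ * pretrainProb P π T (promptTokens p)) : 0 ≤ κ := by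
  by_contra! h
  have h1 : ∑ p, Q p ≤ 0 := Finset.sum_nonpos fun p _ =>
    (hκ p).trans (mul_nonpos_of_nonpos_of_nonneg h.le (pretrainProb_nonneg P π T _))
  have h2 : ∑ p, Q p = 1 := Q.2.2
  linarith

theorem sum_prompt_le_mul_pretrainExp {P : Z → List 𝔛 → stdSimplex ℝ 𝔛} {π : stdSimplex ℝ Z}
    {T : ℕ} {Q : stdSimplex ℝ (Prompt 𝔛 l t)} {κ : ℝ}
    (hκ : ∀ p, Q p ≤ κ * pretrainProb P π T (promptTokens p)) {F : List 𝔛 → ℝ}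
    (hF : ∀ S, 0 ≤ F S) : ∑ p, Q p * F (promptTokens p) ≤ κ * pretrainExp P π T F := by
  refine le_trans ?_ (mul_le_mul_of_nonneg_left (sum_pretrainProb_promptTokens_le (l := l) (t := t)
    P π T hF) (coverage_nonneg hκ))
  rw [Finset.mul_sum]
  refine Finset.sum_le_sum fun p _ => ?_
  rw [← mul_assoc]
  exact mul_le_mul_of_nonneg_right (hκ p) (hF _)

end Coverage

/-! ### Concentration of the posterior under wrong labels -/

section Posterior

variable {𝔛 Z : Type*} [Fintype 𝔛] [Fintype Z] {l t : ℕ}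

theorem seqProb_pairsTokens {P : Z → List 𝔛 → stdSimplex ℝ 𝔛} (hI : PairsIndep P l) (z : Z)
    (S : List ((Fin l → 𝔛) × 𝔛)) :
    seqProb P z (pairsTokens S) = (S.map fun p => seqProb P z (pairTokens p)).prod := by
  induction S with
  | nil => simp [pairsTokens, seqProb_nil]
  | cons a S ih =>
    rw [pairsTokens_cons, ← pairsTokens_singleton, hI, ih, pairsTokens_singleton, List.map_cons,
      List.prod_cons]

/-- Independence is assumed for complete pairs only; summing over the response to the query extends
it to a trailing covariate. -/
theorem seqProb_pairsTokens_append_query {P : Z → List 𝔛 → stdSimplex ℝ 𝔛} (hI : PairsIndep P l)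
    (z : Z) (S : List ((Fin l → 𝔛) × 𝔛)) (c : Fin l → 𝔛) :
    seqProb P z (pairsTokens S ++ List.ofFn c) =
      seqProb P z (pairsTokens S) * seqProb P z (List.ofFn c) := by
  rw [← sum_seqProb_append_singleton, ← sum_seqProb_append_singleton P z (List.ofFn c),
    Finset.mul_sum]
  refine Finset.sum_congr rfl fun x _ => ?_
  have := hI z S [(c, x)]
  rwa [pairsTokens_singleton, pairTokens, ← List.append_assoc] at this

/-- Given the concept, the earlier examples carry no information about the response. Wrong labels
can therefore act on the prediction only through the posterior. -/
theorem apply_pairsTokens_append_query {P : Z → List 𝔛 → stdSimplex ℝ 𝔛} {c₀ : ℝ} (hc₀ : 0 < c₀)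
    (hP : ∀ z S x, c₀ ≤ P z S x) (hI : PairsIndep P l) (z : Z)
    (S : List ((Fin l → 𝔛) × 𝔛)) (c : Fin l → 𝔛) (x : 𝔛) :
    P z (pairsTokens S ++ List.ofFn c) x = P z (List.ofFn c) x := by
  have h := hI z S [(c, x)]
  rw [pairsTokens_singleton, pairTokens, ← List.append_assoc, seqProb_append_singleton,
    seqProb_append_singleton, seqProb_pairsTokens_append_query hI, ← mul_assoc] at h
  exact mul_left_cancel₀ (mul_pos (seqProb_pos hc₀ hP z _) (seqProb_pos hc₀ hP z _)).ne' h

theorem seqProb_promptTokens {P : Z → List 𝔛 → stdSimplex ℝ 𝔛} (hI : PairsIndep P l) (z : Z)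
    (p : Prompt 𝔛 l t) : seqProb P z (promptTokens p) =
      (∏ i : Fin t, P z (List.ofFn (p.1 i.castSucc)) (p.2 i)) *
        ∏ i, seqProb P z (List.ofFn (p.1 i)) := by
  rw [promptTokens, queryTokens, seqProb_pairsTokens_append_query hI, seqProb_pairsTokens hI,
    List.map_ofFn, List.prod_ofFn, Fin.prod_univ_castSucc, ← mul_assoc, ← Finset.prod_mul_distrib]
  congr 1
  refine Finset.prod_congr rfl fun i _ => ?_
  simp only [Function.comp, pairTokens, seqProb_append_singleton]
  ring

/-- Log-likelihood ratio of a covariate. -/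
def covLogRatio (P : Z → List 𝔛 → stdSimplex ℝ 𝔛) (z z' : Z) (c : Fin l → 𝔛) : ℝ :=
  Real.log (seqProb P z (List.ofFn c)) - Real.log (seqProb P z' (List.ofFn c))

theorem abs_covLogRatio_le {P : Z → List 𝔛 → stdSimplex ℝ 𝔛} {c₀ : ℝ} (hc₀ : 0 < c₀)
    (hP : ∀ z S x, c₀ ≤ P z S x) (z z' : Z) (c : Fin l → 𝔛) :
    |covLogRatio P z z' c| ≤ l * Real.log (1 / c₀) := by
  have h : ∀ z, -(l * Real.log (1 / c₀)) ≤ Real.log (seqProb P z (List.ofFn c)) ∧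
      Real.log (seqProb P z (List.ofFn c)) ≤ 0 := fun z => by
    refine ⟨?_, Real.log_nonpos (seqProb_nonneg P z _) (seqProb_le_one P z _)⟩
    have h1 := Real.log_le_log (pow_pos hc₀ _) (pow_le_seqProb hc₀ hP z (List.ofFn c))
    rw [Real.log_pow, List.length_ofFn] at h1
    rwa [one_div, Real.log_inv, mul_neg, neg_neg]
  rw [covLogRatio]
  exact abs_le.2 ⟨by linarith [(h z).1, (h z').2], by linarith [(h z).2, (h z').1]⟩

/-- The labels contribute at most `log (1 / c₀)` to the divergence between pairs. -/
theorem klPair_le {P : Z → List 𝔛 → stdSimplex ℝ 𝔛} {c₀ : ℝ} (hc₀ : 0 < c₀)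
    (hP : ∀ z S x, c₀ ≤ P z S x) (z z' : Z) : klPair P l z z' ≤
      ∑ c : Fin l → 𝔛, seqProb P z (List.ofFn c) * covLogRatio P z z' c + Real.log (1 / c₀) := by
  have hs := fun z S => seqProb_pos hc₀ hP z S
  have h1 : ∀ (c : Fin l → 𝔛) (r : 𝔛), seqProb P z (pairTokens (c, r)) *
      Real.log (seqProb P z (pairTokens (c, r)) / seqProb P z' (pairTokens (c, r))) ≤
      seqProb P z (pairTokens (c, r)) * (covLogRatio P z z' c + Real.log (1 / c₀)) := by
    intro c r
    refine mul_le_mul_of_nonneg_left ?_ (seqProb_nonneg P z _)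
    have hp := hc₀.trans_le (hP z (List.ofFn c) r)
    have hp' := hc₀.trans_le (hP z' (List.ofFn c) r)
    rw [pairTokens, seqProb_append_singleton, seqProb_append_singleton,
      Real.log_div (mul_pos (hs _ _) hp).ne' (mul_pos (hs _ _) hp').ne',
      Real.log_mul (hs _ _).ne' hp.ne', Real.log_mul (hs _ _).ne' hp'.ne', covLogRatio, one_div,
      Real.log_inv]
    have h2 := Real.log_nonpos hp.le (stdSimplex_apply_le_one (P z (List.ofFn c)) r)
    have h3 := Real.log_le_log hc₀ (hP z' (List.ofFn c) r)
    linarith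
  rw [klPair, kl, Fintype.sum_prod_type]
  refine (Finset.sum_le_sum fun c _ => Finset.sum_le_sum fun r _ => h1 c r).trans (le_of_eq ?_)
  simp only [← Finset.sum_mul, pairTokens, sum_seqProb_append_singleton, mul_add,
    Finset.sum_add_distrib]
  rw [sum_seqProb_ofFn, one_mul]

/-- A Bernstein bound for the moment generating function of the log-likelihood ratio. -/
theorem sum_seqProb_exp_covLogRatio_le {P : Z → List 𝔛 → stdSimplex ℝ 𝔛} {c₀ : ℝ} (hc₀ : 0 < c₀)
    (hP : ∀ z S x, c₀ ≤ P z S x) (z z' : Z) {lam v : ℝ} (hlam : 0 ≤ lam)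
    (h1 : lam * (l * Real.log (1 / c₀)) ≤ 1) (hv : (lam * (l * Real.log (1 / c₀))) ^ 2 ≤ v) :
    ∑ c : Fin l → 𝔛, seqProb P z (List.ofFn c) * Real.exp (-(lam * covLogRatio P z z' c)) ≤
      Real.exp (v - lam * (klPair P l z z' - Real.log (1 / c₀))) := by
  have h2 : ∀ c : Fin l → 𝔛, Real.exp (-(lam * covLogRatio P z z' c)) ≤
      1 + v - lam * covLogRatio P z z' c := by
    intro c
    have h3 : |-(lam * covLogRatio P z z' c)| ≤ lam * (l * Real.log (1 / c₀)) := by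
      rw [abs_neg, abs_mul, abs_of_nonneg hlam]
      exact mul_le_mul_of_nonneg_left (abs_covLogRatio_le hc₀ hP z z' c) hlam
    have h4 := (abs_le.1 (Real.abs_exp_sub_one_sub_id_le (h3.trans h1))).2
    have h5 := pow_le_pow_left₀ (abs_nonneg _) h3 2
    rw [sq_abs] at h5
    linarith
  calc _ ≤ ∑ c : Fin l → 𝔛, seqProb P z (List.ofFn c) * (1 + v - lam * covLogRatio P z z' c) :=
        Finset.sum_le_sum fun c _ => mul_le_mul_of_nonneg_left (h2 c) (seqProb_nonneg P z _)
    _ = 1 + v - lam * ∑ c : Fin l → 𝔛, seqProb P z (List.ofFn c) * covLogRatio P z z' c := by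
        simp only [mul_sub, Finset.sum_sub_distrib, ← Finset.sum_mul, sum_seqProb_ofFn, one_mul,
          Finset.mul_sum]
        congr 1
        exact Finset.sum_congr rfl fun c _ => by ring
    _ ≤ 1 + (v - lam * (klPair P l z z' - Real.log (1 / c₀))) := by
        have := mul_le_mul_of_nonneg_left (klPair_le (l := l) hc₀ hP z z') hlam
        linarith
    _ ≤ _ := by
        rw [add_comm]
        exact Real.add_one_le_exp _

/-- Bounding label probabilities by 1 under `z` and by `c₀` under `zs` eliminates the labels. The
posterior is then at most both `1` and `exp y / c₁`, hence at most `exp (lam * y) / c₁` for every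
`lam` in `[0, 1]`; the freedom in `lam` is what the Chernoff bound needs. -/
theorem posterior_le_exp {P : Z → List 𝔛 → stdSimplex ℝ 𝔛} {c₀ c₁ : ℝ} (hc₀ : 0 < c₀)
    (hP : ∀ z S x, c₀ ≤ P z S x) (hI : PairsIndep P l) (hc₁ : 0 < c₁) {π : stdSimplex ℝ Z} {zs : Z}
    (hπ : c₁ ≤ π zs) (z : Z) {lam : ℝ} (hlam0 : 0 ≤ lam) (hlam1 : lam ≤ 1) (p : Prompt 𝔛 l t) :
    posterior P π (promptTokens p) z ≤
      1 / c₁ * Real.exp (lam * (t * Real.log (1 / c₀) - ∑ i, covLogRatio P zs z (p.1 i))) := by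
  set y := t * Real.log (1 / c₀) - ∑ i, covLogRatio P zs z (p.1 i) with hy
  have hc₁1 : c₁ ≤ 1 := hπ.trans (stdSimplex_apply_le_one π zs)
  have hmarg := margProb_pos π hc₀ hP (promptTokens p)
  have h1 : posterior P π (promptTokens p) z ≤ 1 := by
    rw [← sum_posterior π hc₀ hP (promptTokens p)]
    exact Finset.single_le_sum (fun z _ => posterior_nonneg P π _ z) (Finset.mem_univ z)
  have hc : 1 ≤ 1 / c₁ := by rwa [one_le_div hc₁]
  rcases le_or_gt 0 y with hy0 | hy0
  · calc _ ≤ 1 * 1 := by rwa [one_mul]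
      _ ≤ _ := mul_le_mul hc (Real.one_le_exp (mul_nonneg hlam0 hy0)) zero_le_one (by positivity)
  have hs := fun z S => seqProb_pos hc₀ hP z S
  have h2 : seqProb P z (promptTokens p) ≤ seqProb P zs (promptTokens p) * Real.exp y := by
    rw [← Real.log_le_log_iff (hs _ _) (mul_pos (hs _ _) (Real.exp_pos _)),
      Real.log_mul (hs _ _).ne' (Real.exp_pos _).ne', Real.log_exp]
    have hlog : ∀ z, Real.log (seqProb P z (promptTokens p)) =
        ∑ i : Fin t, Real.log (P z (List.ofFn (p.1 i.castSucc)) (p.2 i)) +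
          ∑ i, Real.log (seqProb P z (List.ofFn (p.1 i))) := fun z => by
      have e1 : ∀ i : Fin t, P z (List.ofFn (p.1 i.castSucc)) (p.2 i) ≠ 0 := fun i =>
        (hc₀.trans_le (hP _ _ _)).ne'
      rw [seqProb_promptTokens hI, Real.log_mul (Finset.prod_ne_zero_iff.2 fun i _ => e1 i)
        (Finset.prod_ne_zero_iff.2 fun i _ => (hs _ _).ne'), Real.log_prod fun i _ => e1 i,
        Real.log_prod fun i _ => (hs _ _).ne']
    rw [hlog, hlog, hy]
    simp only [covLogRatio, Finset.sum_sub_distrib]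
    have e2 : ∑ i : Fin t, Real.log (P z (List.ofFn (p.1 i.castSucc)) (p.2 i)) ≤ 0 :=
      Finset.sum_nonpos fun i _ => Real.log_nonpos ((P z _).2.1 _) (stdSimplex_apply_le_one _ _)
    have e3 : ∑ i : Fin t, Real.log c₀ ≤
        ∑ i : Fin t, Real.log (P zs (List.ofFn (p.1 i.castSucc)) (p.2 i)) :=
      Finset.sum_le_sum fun i _ => Real.log_le_log hc₀ (hP _ _ _)
    simp only [Finset.sum_const, Finset.card_univ, Fintype.card_fin, nsmul_eq_mul] at e3
    rw [one_div, Real.log_inv]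
    linarith
  have h3 : c₁ * seqProb P zs (promptTokens p) ≤ margProb P π (promptTokens p) :=
    (mul_le_mul_of_nonneg_right hπ (seqProb_nonneg P zs _)).trans
      (Finset.single_le_sum (f := fun z => π z * seqProb P z (promptTokens p))
        (fun z _ => mul_nonneg (π.2.1 z) (seqProb_nonneg P z _)) (Finset.mem_univ zs))
  rw [posterior, div_le_iff₀ hmarg]
  calc π z * seqProb P z (promptTokens p) ≤ 1 * (seqProb P zs (promptTokens p) * Real.exp y) :=
        mul_le_mul (stdSimplex_apply_le_one π z) h2 (seqProb_nonneg P z _) zero_le_one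
    _ = 1 / c₁ * Real.exp y * (c₁ * seqProb P zs (promptTokens p)) := by field_simp
    _ ≤ 1 / c₁ * Real.exp y * margProb P π (promptTokens p) := by gcongr
    _ ≤ _ := by
      gcongr
      nlinarith

/-- The pointwise bound depends on the covariates alone, so the labels sum out whatever their joint
law, and the i.i.d. covariates turn the expectation into a `(t + 1)`-th power. -/
theorem sum_mul_posterior_le {P : Z → List 𝔛 → stdSimplex ℝ 𝔛} {c₀ c₁ : ℝ} (hc₀ : 0 < c₀)
    (hP : ∀ z S x, c₀ ≤ P z S x) (hI : PairsIndep P l) (hc₁ : 0 < c₁) {π : stdSimplex ℝ Z} {zs : Z}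
    (hπ : c₁ ≤ π zs) (z : Z) {Q : stdSimplex ℝ (Prompt 𝔛 l t)} (hQ : IsPerturbedPromptLaw P zs Q)
    {lam v : ℝ} (hlam0 : 0 ≤ lam) (hlam1 : lam ≤ 1)
    (h1 : lam * (l * Real.log (1 / c₀)) ≤ 1) (hv : (lam * (l * Real.log (1 / c₀))) ^ 2 ≤ v) :
    ∑ p, Q p * posterior P π (promptTokens p) z ≤ 1 / c₁ * Real.exp (lam * (t * Real.log (1 / c₀)) +
      (t + 1) * (v - lam * (klPair P l zs z - Real.log (1 / c₀)))) := by
  have h2 : ∑ p, Q p * posterior P π (promptTokens p) z ≤ ∑ p : Prompt 𝔛 l t, Q p *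
      (1 / c₁ * Real.exp (lam * (t * Real.log (1 / c₀)))) *
        ∏ i, Real.exp (-(lam * covLogRatio P zs z (p.1 i))) := by
    refine Finset.sum_le_sum fun p _ => ?_
    rw [mul_assoc]
    refine mul_le_mul_of_nonneg_left ?_ (Q.2.1 p)
    refine (posterior_le_exp hc₀ hP hI hc₁ hπ z hlam0 hlam1 p).trans (le_of_eq ?_)
    rw [mul_assoc, ← Real.exp_sum, ← Real.exp_add]
    congr 2
    rw [Finset.sum_neg_distrib, ← Finset.mul_sum]
    ring
  refine h2.trans ?_
  have h3 : ∑ p : Prompt 𝔛 l t, Q p * (1 / c₁ * Real.exp (lam * (t * Real.log (1 / c₀)))) *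
        ∏ i, Real.exp (-(lam * covLogRatio P zs z (p.1 i))) =
      (1 / c₁ * Real.exp (lam * (t * Real.log (1 / c₀)))) *
        (∑ c : Fin l → 𝔛, seqProb P zs (List.ofFn c) *
          Real.exp (-(lam * covLogRatio P zs z c))) ^ (t + 1) := by
    rw [Fintype.sum_prod_type, Fintype.sum_pow, Finset.mul_sum]
    refine Finset.sum_congr rfl fun c _ => ?_
    simp only [← Finset.sum_mul]
    rw [hQ c, Finset.prod_mul_distrib]
    ring
  rw [h3, Real.exp_add, ← mul_assoc (1 / c₁)]
  refine mul_le_mul_of_nonneg_left ?_ (by positivity)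
  have h4 := pow_le_pow_left₀ (Finset.sum_nonneg fun c _ =>
    mul_nonneg (seqProb_nonneg P zs _) (Real.exp_pos _).le)
    (sum_seqProb_exp_covLogRatio_le (l := l) hc₀ hP zs z hlam0 h1 hv) (t + 1)
  rwa [← Real.exp_nat_mul, Nat.cast_add, Nat.cast_one] at h4

/-- The expected posterior mass of a wrong concept decays exponentially in `√t`. -/
theorem sum_mul_posterior_le_exp_sqrt [Nontrivial 𝔛] {P : Z → List 𝔛 → stdSimplex ℝ 𝔛}
    {c₀ c₁ : ℝ} (hc₀ : 0 < c₀) (hP : ∀ z S x, c₀ ≤ P z S x) (hI : PairsIndep P l) (hc₁ : 0 < c₁)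
    {π : stdSimplex ℝ Z} {zs : Z} (hπ : c₁ ≤ π zs) {z : Z}
    (hz : 2 * Real.log (1 / c₀) < klPair P l zs z) {Q : stdSimplex ℝ (Prompt 𝔛 l t)}
    (hQ : IsPerturbedPromptLaw P zs Q) (ht : 0 < t) :
    ∑ p, Q p * posterior P π (promptTokens p) z ≤ Real.exp 2 / c₁ *
      Real.exp (-(√t / ((1 + l) * Real.log (1 / c₀)) *
        (klPair P l zs z - 2 * Real.log (1 / c₀)))) := by
  set b := Real.log (1 / c₀) with hb
  -- Two tokens share mass at most 1, so `log (1 / c₀) ≥ log 2` stays away from zero.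
  have hc₀2 : c₀ ≤ 1 / 2 := by
    obtain ⟨x, y, hxy⟩ := exists_pair_ne 𝔛
    have h1 : ∑ x, P zs [] x = 1 := (P zs []).2.2
    have h2 := Finset.add_le_sum (f := fun x => P zs [] x) (fun x _ => (P zs []).2.1 x)
      (Finset.mem_univ x) (Finset.mem_univ y) hxy
    have h3 := hP zs [] x
    have h4 := hP zs [] y
    linarith
  have hb2 : Real.log 2 ≤ b := by
    refine Real.log_le_log (by norm_num) ?_
    rw [le_div_iff₀ hc₀]
    linarith
  have hlog2 := Real.log_two_gt_d9
  have hb0 : 0 < b := by linarith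
  -- A pair has divergence at most `(l + 1) b`, so the separation assumption forces `l > 1`.
  -- Together with `b ≥ log 2` this gives `w ≥ 1`, and hence `lam ≤ 1`.
  have hl : 1 < (l : ℝ) := by
    have h1 := klPair_le (l := l) hc₀ hP zs z
    have h2 : ∑ c : Fin l → 𝔛, seqProb P zs (List.ofFn c) * covLogRatio P zs z c ≤ l * b := by
      calc _ ≤ ∑ c : Fin l → 𝔛, seqProb P zs (List.ofFn c) * (l * b) :=
            Finset.sum_le_sum fun c _ => mul_le_mul_of_nonneg_left
              ((le_abs_self _).trans (abs_covLogRatio_le hc₀ hP zs z c)) (seqProb_nonneg P zs _)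
        _ = _ := by rw [← Finset.sum_mul, sum_seqProb_ofFn, one_mul]
    by_contra! h3
    have h4 := mul_le_mul_of_nonneg_right h3 hb0.le
    linarith
  have ht1 : (1 : ℝ) ≤ t := by exact_mod_cast ht
  have hst : 1 ≤ √(t : ℝ) := Real.one_le_sqrt.2 ht1
  have hsq : √(t : ℝ) * √(t : ℝ) = t := Real.mul_self_sqrt (by linarith)
  set w := (1 + (l : ℝ)) * b with hw
  have hw1 : 1 ≤ w := by nlinarith
  have hw0 : 0 < w := by linarith
  have hlb : (l : ℝ) * b ≤ w := by rw [hw]; linarith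
  -- This choice keeps the accumulated quadratic term `(t + 1) (lam l b)²` below 2, the source of
  -- `exp 2`, while `lam * t` produces the rate `√t / ((1 + l) b)`.
  set lam := 1 / (√(t : ℝ) * w) with hlam
  have hlam0 : 0 < lam := by positivity
  have hlamt : lam * t = √(t : ℝ) / w := by
    rw [hlam, one_div_mul_eq_div, div_eq_div_iff (by positivity) hw0.ne']
    linear_combination -w * hsq
  have hlamw : lam * (l * b) ≤ 1 / √(t : ℝ) := by
    calc lam * (l * b) ≤ lam * w := by gcongr
      _ = _ := by rw [hlam]; field_simp
  have hinv : 1 / √(t : ℝ) ≤ 1 := by rw [div_le_one (by linarith)]; exact hst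
  have hv : (lam * (l * b)) ^ 2 ≤ 1 / t := by
    calc _ ≤ (1 / √(t : ℝ)) ^ 2 := pow_le_pow_left₀ (by positivity) hlamw 2
      _ = _ := by rw [div_pow, one_pow, sq, hsq]
  have hlam1 : lam ≤ 1 := by
    rw [hlam, div_le_one (by positivity)]
    exact one_le_mul_of_one_le_of_one_le hst hw1
  refine (sum_mul_posterior_le hc₀ hP hI hc₁ hπ z hQ hlam0.le hlam1 (hlamw.trans hinv) hv).trans ?_
  rw [div_eq_mul_one_div (Real.exp 2), mul_comm (Real.exp 2), mul_assoc, ← Real.exp_add, ← hlamt]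
  refine mul_le_mul_of_nonneg_left (Real.exp_le_exp.2 ?_) (by positivity)
  have h1 : ((t : ℝ) + 1) * (1 / t) ≤ 2 := by
    rw [mul_one_div, div_le_iff₀ (by linarith)]
    linarith
  -- The contribution of the query covariate, the `(t + 1)`-st, is favourable and is discarded.
  have h2 : 0 ≤ lam * (klPair P l zs z - b) := mul_nonneg hlam0.le (by linarith)
  linarith

/-- With wrong labels, the predictive distribution still approaches the response law of the
prompt concept. -/
theorem sum_mul_sum_abs_sub_predictive_le [Nontrivial 𝔛] {P : Z → List 𝔛 → stdSimplex ℝ 𝔛}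
    {c₀ c₁ : ℝ} (hc₀ : 0 < c₀) (hP : ∀ z S x, c₀ ≤ P z S x) (hI : PairsIndep P l) (hc₁ : 0 < c₁)
    {π : stdSimplex ℝ Z} {zs : Z} (hπ : c₁ ≤ π zs)
    (hz : ∀ z, z ≠ zs → 2 * Real.log (1 / c₀) < klPair P l zs z)
    {Q : stdSimplex ℝ (Prompt 𝔛 l t)} (hQ : IsPerturbedPromptLaw P zs Q) :
    ∑ p, Q p * ∑ x, |P zs (queryTokens p) x - predictive P π (promptTokens p) x| ≤
      2 * Fintype.card Z * (1 + Real.exp 2 / c₁) *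
        Real.exp (-(√t / (2 * (1 + l) * Real.log (1 / c₀)) *
          ((⨅ z : {z : Z // z ≠ zs}, klPair P l zs z) + 2 * Real.log c₀))) := by
  classical
  set b := Real.log (1 / c₀) with hb
  set M := ⨅ z : {z : Z // z ≠ zs}, klPair P l zs z with hM
  set E := Real.exp (-(√t / (2 * (1 + l) * b) * (M + 2 * Real.log c₀))) with hE
  have hlogc : Real.log c₀ = -b := by rw [hb, one_div, Real.log_inv, neg_neg]
  have hb0 : 0 ≤ b := by
    have x : 𝔛 := Classical.arbitrary 𝔛
    have := Real.log_nonpos hc₀.le ((hP zs [] x).trans (stdSimplex_apply_le_one _ x))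
    linarith
  have h1 : ∀ p : Prompt 𝔛 l t,
      ∑ x, |P zs (queryTokens p) x - predictive P π (promptTokens p) x| ≤
        2 * ∑ z ∈ Finset.univ.erase zs, posterior P π (promptTokens p) z := by
    intro p
    -- The posterior weights sum to 1 and the `zs` term vanishes, so the ℓ¹ error is at most twice
    -- the posterior mass of the wrong concepts.
    have h2 : ∀ x, P zs (queryTokens p) x - predictive P π (promptTokens p) x =
        ∑ z ∈ Finset.univ.erase zs, posterior P π (promptTokens p) z *
          (P zs (promptTokens p) x - P z (promptTokens p) x) := by
      intro x
      rw [show P zs (queryTokens p) x = P zs (promptTokens p) x from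
        (apply_pairsTokens_append_query hc₀ hP hI zs _ _ x).symm, Finset.sum_erase _ (by simp)]
      simp only [mul_sub, Finset.sum_sub_distrib, ← Finset.sum_mul, sum_posterior π hc₀ hP, one_mul]
      rfl
    simp only [h2]
    calc _ ≤ ∑ x, ∑ z ∈ Finset.univ.erase zs, posterior P π (promptTokens p) z *
          (P zs (promptTokens p) x + P z (promptTokens p) x) := by
          refine Finset.sum_le_sum fun x _ => (Finset.abs_sum_le_sum_abs _ _).trans
            (Finset.sum_le_sum fun z _ => ?_)
          rw [abs_mul, abs_of_nonneg (posterior_nonneg P π _ z)]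
          refine mul_le_mul_of_nonneg_left ?_ (posterior_nonneg P π _ z)
          have e1 := (P zs (promptTokens p)).2.1 x
          have e2 := (P z (promptTokens p)).2.1 x
          exact abs_le.2 ⟨by change 0 ≤ P zs (promptTokens p) x at e1; linarith,
            by change 0 ≤ P z (promptTokens p) x at e2; linarith⟩
      _ = _ := by
          rw [Finset.sum_comm, Finset.mul_sum]
          refine Finset.sum_congr rfl fun z _ => ?_
          have e1 : ∑ x, P zs (promptTokens p) x = 1 := (P zs _).2.2
          have e2 : ∑ x, P z (promptTokens p) x = 1 := (P z _).2.2
          rw [← Finset.mul_sum, Finset.sum_add_distrib, e1, e2]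
          ring
  have h3 : ∀ z, z ≠ zs → ∑ p, Q p * posterior P π (promptTokens p) z ≤
      (1 + Real.exp 2 / c₁) * E := by
    intro z hzz
    have hMz : M ≤ klPair P l zs z :=
      ciInf_le (f := fun z : {z : Z // z ≠ zs} => klPair P l zs z) (Set.finite_range _).bddBelow
        ⟨z, hzz⟩
    have hMb : 2 * b ≤ M := by
      have : Nonempty {z : Z // z ≠ zs} := ⟨⟨z, hzz⟩⟩
      exact le_ciInf fun z => (hz z z.2).le
    -- Without examples the exponent is zero and the trivial bound on the posterior suffices; the
    -- choice of `lam` requires `t > 0`.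
    rcases Nat.eq_zero_or_pos t with rfl | ht
    · have hE1 : E = 1 := by simp [hE]
      have e1 : ∑ p, Q p * posterior P π (promptTokens p) z ≤ ∑ p, Q p * 1 := by
        refine Finset.sum_le_sum fun p _ => mul_le_mul_of_nonneg_left ?_ (Q.2.1 p)
        rw [← sum_posterior π hc₀ hP (promptTokens p)]
        exact Finset.single_le_sum (fun z _ => posterior_nonneg P π _ z) (Finset.mem_univ z)
      have e2 : ∑ p, Q p = 1 := Q.2.2
      simp only [mul_one, e2] at e1
      rw [hE1]
      have : 0 < Real.exp 2 / c₁ := by positivity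
      linarith
    · refine (sum_mul_posterior_le_exp_sqrt hc₀ hP hI hc₁ hπ (hz z hzz) hQ ht).trans ?_
      rw [← hb]
      refine mul_le_mul (by linarith) (Real.exp_le_exp.2 ?_) (Real.exp_pos _).le (by positivity)
      rw [hlogc, neg_le_neg_iff]
      -- The exponent obtained is twice the required one; it may be halved because `M - 2 b ≥ 0`.
      have e1 : √(t : ℝ) / (2 * (1 + l) * b) = √(t : ℝ) / ((1 + l) * b) / 2 := by
        rw [div_div]; ring_nf
      rw [e1]
      have e2 : 0 ≤ √(t : ℝ) / ((1 + l) * b) := by positivity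
      have e3 := mul_le_mul_of_nonneg_left
        (by linarith : M - 2 * b ≤ klPair P l zs z - 2 * b) e2
      have e4 := mul_nonneg e2 (by linarith : 0 ≤ M - 2 * b)
      linarith
  calc _ ≤ ∑ p, Q p * (2 * ∑ z ∈ Finset.univ.erase zs, posterior P π (promptTokens p) z) :=
        Finset.sum_le_sum fun p _ => mul_le_mul_of_nonneg_left (h1 p) (Q.2.1 p)
    _ = 2 * ∑ z ∈ Finset.univ.erase zs, ∑ p, Q p * posterior P π (promptTokens p) z := by
        rw [Finset.sum_comm, Finset.mul_sum]
        refine Finset.sum_congr rfl fun p _ => ?_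
        rw [← Finset.mul_sum]
        ring
    _ ≤ 2 * ∑ z ∈ Finset.univ.erase zs, (1 + Real.exp 2 / c₁) * E := by
        gcongr with z hzz
        exact h3 z (Finset.ne_of_mem_erase hzz)
    _ ≤ 2 * ∑ z : Z, (1 + Real.exp 2 / c₁) * E := by
        gcongr
        exact Finset.erase_subset _ _
    _ = _ := by
        simp only [Finset.sum_const, Finset.card_univ, nsmul_eq_mul]
        ring

end Posterior

/-! ### The one-token alphabet and the assembly of the theorem. -/

section Final

variable {𝔛 : Type*} [Fintype 𝔛]

theorem kl_eq_zero_of_subsingleton [Subsingleton 𝔛] {p q : 𝔛 → ℝ} (hp : ∑ x, p x = 1)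
    (hq : ∑ x, q x = 1) : kl p q = 0 := by
  refine Finset.sum_eq_zero fun x _ => ?_
  rw [Fintype.sum_subsingleton p x] at hp
  rw [Fintype.sum_subsingleton q x] at hq
  rw [hp, hq]
  simp

theorem dataProb_univ {Z : Type*} [Fintype Z] (P : Z → List 𝔛 → stdSimplex ℝ 𝔛)
    (π : stdSimplex ℝ Z) (N T : ℕ) :
    dataProb P π (Set.univ : Set (Dataset 𝔛 N T)) = 1 := by
  simp [dataProb, sum_datasetProb]

end Final

end ICL

end

/-- The constant `C` depends only on the alphabet, the concept space, `c₀`, `c₁`, upper bounds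
`h₀` and `B₀` for the number of heads and for `B_A`, and lower bounds `τ₀`, `R₀` for `τ` and `R`. -/
theorem mainTheorem7 {𝔛 Z : Type*} [Fintype 𝔛] [Fintype Z]
    (c₀ c₁ : ℝ) (hc₀ : 0 < c₀) (hc₁ : 0 < c₁)
    (h₀ : ℕ) (B₀ τ₀ R₀ : ℝ) (hτ₀ : 0 < τ₀) (hR₀ : 0 < R₀) :
    ∃ C : ℝ, 0 < C ∧
      ∀ (A : ICL.Arch), A.h ≤ h₀ → A.BA ≤ B₀ → τ₀ ≤ A.τ → R₀ ≤ A.R →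
      ∀ (emb : 𝔛 → EuclideanSpace ℝ (Fin A.d)), (∀ x, ‖emb x‖ ≤ A.R) →
      ∀ (P : Z → List 𝔛 → stdSimplex ℝ 𝔛) (π : stdSimplex ℝ Z) (zs : Z) (l : ℕ),
        (∀ z S x, c₀ ≤ P z S x) →
        ICL.PairsIndep P l →
        c₁ ≤ π zs →
        (∀ z, z ≠ zs → 2 * Real.log (1 / c₀) < ICL.klPair P l zs z) →
      ∀ (N T : ℕ), 0 < N → 0 < T →
      ∀ (δ : ℝ), 0 < δ → δ < 1 →
      ∀ (θhat : ICL.Dataset 𝔛 N T → ICL.Param A 𝔛), (∀ ω, ICL.IsMLE emb ω (θhat ω)) →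
      ∀ (t : ℕ) (Q : stdSimplex ℝ (ICL.Prompt 𝔛 l t)), ICL.IsPerturbedPromptLaw P zs Q →
      ∀ (κ : ℝ), (∀ p, Q p ≤ κ * ICL.pretrainProb P π T (ICL.promptTokens p)) →
        1 - δ ≤ ICL.dataProb P π {ω : ICL.Dataset 𝔛 N T |
          ∑ p, Q p * ICL.kl (P zs (ICL.queryTokens p))
              (ICL.transformer emb (θhat ω) (ICL.promptTokens p)) ≤
            C * (κ * ICL.pretrainErr P π A emb N T δ +
              Real.exp (-(√t / (2 * (1 + l) * Real.log (1 / c₀)) *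
                ((⨅ z : {z : Z // z ≠ zs}, ICL.klPair P l zs z) + 2 * Real.log c₀))))} := by
  -- The lower bound on the mixing time needs two tokens. With a single token all next-token laws
  -- coincide, and the left side is zero.
  rcases subsingleton_or_nontrivial 𝔛 with h𝔛 | h𝔛
  · refine ⟨1, one_pos, ?_⟩
    intro A _ _ _ _ emb _ P π zs l _ _ _ _ N T _ _ δ hδ hδ1 θhat _ t Q _ κ hκ
    refine (show 1 - δ ≤ 1 by linarith).trans
      ((ICL.dataProb_univ P π N T).symm.le.trans (ICL.dataProb_mono P π fun ω _ => ?_))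
    have h1 : ∀ p : ICL.Prompt 𝔛 l t, Q p * ICL.kl (P zs (ICL.queryTokens p))
        (ICL.transformer emb (θhat ω) (ICL.promptTokens p)) = 0 := fun p => by
      have hp : ∑ x, P zs (ICL.queryTokens p) x = 1 := (P zs _).2.2
      have : Nonempty 𝔛 := by
        by_contra h
        rw [not_nonempty_iff] at h
        simp at hp
      rw [ICL.kl_eq_zero_of_subsingleton hp (ICL.sum_transformer _ _ _), mul_zero]
    have h2 := ICL.coverage_nonneg hκ
    have h3 := ICL.pretrainErr_nonneg P π A emb N T hδ hδ1
    simp only [Set.mem_ofPred_eq, h1, Finset.sum_const_zero]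
    positivity
  obtain ⟨C₁, hC₁, hpre⟩ := ICL.exists_one_sub_le_dataProb_pretrainErr 𝔛 h₀ B₀ hτ₀ hR₀
  have hdy : (0 : ℝ) < Fintype.card 𝔛 := by exact_mod_cast Fintype.card_pos
  -- A lower bound for the output probabilities of all admissible architectures simultaneously; this
  -- is where the constant depends on `B₀` and `τ₀`.
  set m := Real.exp (-(2 * (B₀ / τ₀))) / Fintype.card 𝔛 with hm
  have hm0 : 0 < m := div_pos (Real.exp_pos _) hdy
  set C₂ := 2 * Fintype.card Z * (1 + Real.exp 2 / c₁) with hC₂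
  have hC₂0 : 0 ≤ C₂ := by positivity
  refine ⟨1 / m * (C₁ + C₂), by positivity, ?_⟩
  intro A hh hBA hτ hR emb hemb P π zs l hP hI hπ hz N T hN hT δ hδ hδ1 θhat hθ t Q hQ κ hκ
  refine (hpre A hh hBA hτ hR emb hemb P π zs hc₀ hP N T hN hT δ hδ hδ1).trans
    (ICL.dataProb_mono P π fun ω hω => ?_)
  have h1 := hω (θhat ω) (hθ ω)
  set q := ICL.transformer emb (θhat ω) with hq
  have hκ0 := ICL.coverage_nonneg hκ
  have hq1 : ∀ S, ∑ x, q S x = 1 := ICL.sum_transformer _ _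
  have hlow : ∀ S x, m ≤ q S x := fun S x => by
    refine le_trans ?_ (ICL.le_transformer emb (hθ ω).1 S x)
    have h1 : A.BA / A.τ ≤ B₀ / τ₀ := div_le_div₀ (by linarith [A.one_le_BA]) hBA hτ₀ hτ
    rw [hm]
    gcongr
  have h2 := ICL.sum_prompt_le_mul_pretrainExp hκ
    (F := fun S => ∑ x, |ICL.predictive P π S x - q S x|)
    fun S => Finset.sum_nonneg fun x _ => abs_nonneg _
  have h3 := ICL.sum_mul_sum_abs_sub_predictive_le hc₀ hP hI hc₁ hπ hz hQ
  set E := Real.exp (-(√t / (2 * (1 + l) * Real.log (1 / c₀)) *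
    ((⨅ z : {z : Z // z ≠ zs}, ICL.klPair P l zs z) + 2 * Real.log c₀))) with hE
  set Δ := ICL.pretrainErr P π A emb N T δ with hΔ
  have hΔ0 : 0 ≤ Δ := ICL.pretrainErr_nonneg P π A emb N T hδ hδ1
  -- KL obeys no triangle inequality, so it is first passed to ℓ¹ and only then split at the
  -- predictive distribution.
  have h4 : ∀ p : ICL.Prompt 𝔛 l t,
      ICL.kl (P zs (ICL.queryTokens p)) (q (ICL.promptTokens p)) ≤
        1 / m * (∑ x, |P zs (ICL.queryTokens p) x - ICL.predictive P π (ICL.promptTokens p) x| +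
          ∑ x, |ICL.predictive P π (ICL.promptTokens p) x - q (ICL.promptTokens p) x|) := by
    intro p
    refine (ICL.kl_le_sum_abs_sub hm0 (fun x => hc₀.trans_le (hP _ _ x)) (hlow _)
      (P zs (ICL.queryTokens p)).2.2 (hq1 _)).trans ?_
    rw [← Finset.sum_add_distrib]
    gcongr
    exact abs_sub_le _ _ _
  change ∑ p, Q p * ICL.kl (P zs (ICL.queryTokens p)) (q (ICL.promptTokens p)) ≤
    1 / m * (C₁ + C₂) * (κ * Δ + E)
  calc _ ≤ ∑ p, Q p * (1 / m *
        (∑ x, |P zs (ICL.queryTokens p) x - ICL.predictive P π (ICL.promptTokens p) x| +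
          ∑ x, |ICL.predictive P π (ICL.promptTokens p) x - q (ICL.promptTokens p) x|)) :=
        Finset.sum_le_sum fun p _ => mul_le_mul_of_nonneg_left (h4 p) (Q.2.1 p)
    _ = 1 / m * (∑ p, Q p *
          ∑ x, |P zs (ICL.queryTokens p) x - ICL.predictive P π (ICL.promptTokens p) x| +
        ∑ p, Q p *
          ∑ x, |ICL.predictive P π (ICL.promptTokens p) x - q (ICL.promptTokens p) x|) := by
        rw [← Finset.sum_add_distrib, Finset.mul_sum]
        exact Finset.sum_congr rfl fun p _ => by ring
    _ ≤ 1 / m * (C₂ * E + κ * (C₁ * Δ)) := by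
        gcongr
        exact h2.trans (mul_le_mul_of_nonneg_left h1 hκ0)
    _ ≤ _ := by
        rw [mul_assoc (1 / m)]
        gcongr
        have e1 := mul_nonneg hC₂0 (mul_nonneg hκ0 hΔ0)
        have e2 := mul_nonneg hC₁.le (Real.exp_pos (-(√t / (2 * (1 + l) * Real.log (1 / c₀)) *
          ((⨅ z : {z : Z // z ≠ zs}, ICL.klPair P l zs z) + 2 * Real.log c₀)))).le
        rw [← hE] at e2
        nlinarith
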